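/- Let $q:[0,\pi]\to\mathbb C$ belong to $W_1^2[0,\pi]=\{f: f,f'\in AC[0,\pi],\ f''\in L(0,\pi)\}$ and let $q(0)+q(\pi)=0$. Consider the eigenvalue problem with frozen argument $a=\pi/2$, $$-y''(x)+q(x)\,y(\tfrac{\pi}{2})=\lambda y(x),\quad x\in(0,\pi),\qquad y(0)=y(\pi)=0,$$ and, for $m\ge 1$, $l=2m-1$, $h=\frac{\pi}{l+1}=\frac{\pi}{2m}$, its finite-difference approximation $$-\frac{y_{j+1}-2y_j+y_{j-1}}{h^2}+q(jh)\,y_m=\lambda y_j,\quad j=1,\dots,l,\qquad y_0=y_{l+1}=0.$$ The eigenvalues of the continuous problem coincide with the zeros of its characteristic function $\Delta(\lambda)=C(0,\lambda)S(\pi,\lambda)-C(\pi,\lambda)S(0,\lambda)$, where $\rho=\sqrt\lambda$ and $$C(x,\lambda)=\cos\rho(x-\tfrac{\pi}{2})+\int_{\pi/2}^x q(t)\frac{\sin\rho(x-t)}{\rho}\,dt,\qquad S(x,\lambda)=\frac{\sin\rho(x-\frac{\pi}{2})}{\rho}.$$ They can be numbered as $\{\lambda_n\}_{n\ge1}$,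 counted with multiplicity as zeros of $\Delta$, so that $\lambda_n=n^2$ for even $n$ and $\lambda_n=(n+\varkappa_n/n)^2$ for all $n$, with $\{\varkappa_n\}\in\ell_2$. The eigenvalues of the discrete problem can be numbered, for every $m\ge1$, as $\{\lambda_{n,l}\}_{n=1}^{l}$, counted with algebraic multiplicity, so that $\lambda_{n,l}=\frac{4\sin^2(nh/2)}{h^2}$ for even $n$ and, for every fixed $\alpha>0$, $\lambda_{n,l}=\frac{2-2\cos\theta_{n,l}}{h^2}$ with $\theta_{n,l}=nh+o(h)$ as $l\to\infty$, uniformly for $\frac{n}{2m}\ge\alpha$. For any numberings with these properties and any fixed $\alpha>0$, $$\lambda_n-n^2=\lambda_{n,l}-\frac{4\sin^2\left(\frac{nh}{2}\right)}{h^2}+O(h^2)\quad\text{uniformly for }\frac{n}{2m}\ge\alpha,$$ that is, there is a constant $C$ (independent of $m$ and $n$) such that for all $m\ge1$ and all $1\le n\le 2m-1$ with $\frac{n}{2m}\ge\alpha$ $$\left|\left(\lambda_n-n^2\right)-\left(\lambda_{n,l}-\frac{4\sin^2(nh/2)}{h^2}\right)\right|\le C h^2 .$$ -/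

import Mathlib

open Real Set MeasureTheory

noncomputable section

namespace FrozenArgument

/-- The space `W_1^2[0, π]`: `f, f' ∈ AC[0, π]` and `f'' ∈ L(0, π)`, for complex-valued `f`. -/
def MemW12 (f : ℝ → ℂ) : Prop :=
  AbsolutelyContinuousOnInterval f 0 π ∧
  DifferentiableOn ℝ f (Icc 0 π) ∧
  AbsolutelyContinuousOnInterval (derivWithin f (Icc 0 π)) 0 π ∧
  IntervalIntegrable (derivWithin (derivWithin f (Icc 0 π)) (Icc 0 π)) volume 0 π

/-! ### The continuous problem `-y'' + q(x) y(π/2) = z y`, `y(0) = y(π) = 0` -/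

/-- `z` is an eigenvalue of the continuous problem (for continuous `q`; here `y'` is the
derivative of the nontrivial solution `y`). -/
def IsEigenvalue (q : ℝ → ℂ) (z : ℂ) : Prop :=
  ∃ y y' : ℝ → ℂ,
    (∀ x ∈ Icc 0 π, HasDerivWithinAt y (y' x) (Icc 0 π) x) ∧
    (∀ x ∈ Icc 0 π, HasDerivWithinAt y' (q x * y (π / 2) - z * y x) (Icc 0 π) x) ∧
    y 0 = 0 ∧ y π = 0 ∧ ∃ x ∈ Icc 0 π, y x ≠ 0

/-- `cos (ρ x)` with `ρ = √z`. -/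
def cosSqrt (z : ℂ) (x : ℝ) : ℂ := Complex.cos (z ^ (1 / 2 : ℂ) * x)

/-- `sin (ρ x) / ρ` with `ρ = √z`, understood as its limit `x` for `z = 0`. -/
def sinSqrt (z : ℂ) (x : ℝ) : ℂ :=
  if z = 0 then (x : ℂ) else Complex.sin (z ^ (1 / 2 : ℂ) * x) / z ^ (1 / 2 : ℂ)

/-- The solution `C(x, z)` of the equation with `C(π/2, z) = 1`, `C'(π/2, z) = 0`. -/
def solC (q : ℝ → ℂ) (x : ℝ) (z : ℂ) : ℂ :=
  cosSqrt z (x - π / 2) + ∫ t in (π / 2)..x, q t * sinSqrt z (x - t)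

/-- The solution `S(x, z)` of the equation with `S(π/2, z) = 0`, `S'(π/2, z) = 1`. -/
def solS (x : ℝ) (z : ℂ) : ℂ := sinSqrt z (x - π / 2)

/-- The characteristic function of the continuous problem, an entire function of `z`. -/
def charFun (q : ℝ → ℂ) (z : ℂ) : ℂ :=
  solC q 0 z * solS π z - solC q π z * solS 0 z

/-- `lam 1, lam 2, …` is a numbering of the eigenvalues of the continuous problem, each one
repeated according to its multiplicity as a zero of the characteristic function, such that
`lam n = n²` for even `n` and `lam n = (n + ϰ n / n)²` with `ϰ ∈ ℓ₂`. -/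
structure IsNumbering (q : ℝ → ℂ) (lam : ℕ → ℂ) : Prop where
  eigenvalue_iff : ∀ z, IsEigenvalue q z ↔ ∃ n, 1 ≤ n ∧ lam n = z
  multiplicity : ∀ z, {n : ℕ | 1 ≤ n ∧ lam n = z}.encard = analyticOrderAt (charFun q) z
  even : ∀ n, 1 ≤ n → Even n → lam n = (n : ℂ) ^ 2
  asymptotics : ∃ ϰ : ℕ → ℂ, Summable (fun n => ‖ϰ n‖ ^ 2) ∧
    ∀ n, 1 ≤ n → lam n = ((n : ℂ) + ϰ n / n) ^ 2

/-! ### The discrete problem with `l = 2m - 1` inner nodes -/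

/-- The mesh size `h = π / (l + 1) = π / (2m)`. -/
def step (m : ℕ) : ℝ := π / (2 * m)

/-- The `l × l` matrix, `l = 2m - 1`, of the discrete problem
`-(y_{j+1} - 2 y_j + y_{j-1}) / h² + q(j h) y_m = z y_j`, `j = 1, …, l`, `y_0 = y_{l+1} = 0`.
The unknown `y_j` has the index `j - 1` in `Fin (2 * m - 1)`. -/
def discreteMatrix (q : ℝ → ℂ) (m : ℕ) : Matrix (Fin (2 * m - 1)) (Fin (2 * m - 1)) ℂ :=
  Matrix.of fun i k =>
    ((if k = i then 2 else 0) - (if (k : ℕ) = i + 1 then 1 else 0)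
        - (if (k : ℕ) + 1 = i then 1 else 0)) / (step m : ℂ) ^ 2
      + (if (k : ℕ) + 1 = m then q (((i : ℕ) + 1 : ℝ) * step m) else 0)

/-- The eigenvalue `4 sin²(n h / 2) / h²` of the discrete problem with `q = 0`. -/
def freeEigenvalue (m n : ℕ) : ℝ := 4 * Real.sin (n * step m / 2) ^ 2 / step m ^ 2

/-- For every `m ≥ 1`, `lamD m 1, …, lamD m (2m - 1)` is a numbering of the eigenvalues of the
discrete problem with `l = 2m - 1`, repeated according to their algebraic multiplicities, such that
`lamD m n = 4 sin²(n h / 2) / h²` for even `n` and, for each `α > 0`,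
`lamD m n = (2 - 2 cos θ) / h²` with `θ = n h + o(h)` as `m → ∞`, uniformly in `n ≥ 2 m α`. -/
structure IsDiscreteNumbering (q : ℝ → ℂ) (lamD : ℕ → ℕ → ℂ) : Prop where
  roots_eq : ∀ m, 1 ≤ m →
    (Finset.Icc 1 (2 * m - 1)).val.map (lamD m) = (discreteMatrix q m).charpoly.roots
  even : ∀ m n, 1 ≤ n → n ≤ 2 * m - 1 → Even n → lamD m n = freeEigenvalue m n
  location : ∀ α : ℝ, 0 < α → ∀ δ : ℝ, 0 < δ → ∃ M : ℕ, ∀ m, M ≤ m →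
    ∀ n, 1 ≤ n → n ≤ 2 * m - 1 → α ≤ (n : ℝ) / (2 * m) →
      ∃ θ : ℂ, lamD m n = (2 - 2 * Complex.cos θ) / (step m : ℂ) ^ 2 ∧
        ‖θ - (n * step m : ℝ)‖ ≤ δ * step m

end FrozenArgument

end

namespace FrozenArgument

/-! No cancellation between the two problems is needed. Because q(0) + q(π) = 0, each of the two
differences is O(n⁻²) on its own, and n/(2m) ≥ α means nh ≥ πα, so that n⁻² = O(h²). The finitely
many m not covered by the asymptotics are absorbed into the constant.

Continuous side. Since S is odd about π/2, the characteristic function is sin(ρπ/2)/ρ times F =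
C(0,·) + C(π,·) (`charFun_eq`). The first factor has the simple zeros n², n ≥ 2 even. Integrating by
parts twice in F (`MemW12.mul_integral_sinSqrt`), the boundary values of q add up to zero and those
of q' cancel, so F = 2cos(ρπ/2)(1 - q(π/2)/ρ²) + O(|ρ|⁻³ exp(|Im ρ|π/2)). Hence the roots ρ of large
zeros lie within O(|ρ|⁻³) of odd integers (`exists_norm_sub_odd_le`), and squaring gives O(n⁻²)
(`IsNumbering.exists_norm_sub_sq_le`). In a given numbering, ϰ_n → 0 decides which integer it is.

Discrete side. The sine transform diagonalizes the second difference, and the frozen term is a rank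
one perturbation. With μ_k the free eigenvalues, the matrix determinant lemma turns the
characteristic equation into 1 = Σ T_k/(z - μ_k) off the poles (`eval_charpoly_discreteMatrix`). The
residues T_k vanish for even k, and summation by parts gives T_k = O(k⁻²) for odd k
(`MemW12.exists_norm_residueCoeff_le`), the boundary terms again cancelling by q(0) + q(π) = 0. For
z near μ_n one has |z - μ_k| ≥ c(n-k)² for k ≠ n, so the terms with k ≠ n sum to O(n⁻²). The n-th
term must then be at least 1/2 in modulus, whence |z - μ_n| ≤ 2|T_n|.

The numberings exist by Rouché's theorem, applied to F and 2cos(ρπ/2) on the circles |ρ| = 2K, and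
to the secular polynomial and its unperturbed product on small circles around μ_n. -/

/-! ### Lower and upper bounds for the complex sine -/

lemma norm_sin_sq (w : ℂ) : ‖Complex.sin w‖ ^ 2 = Real.sin w.re ^ 2 + Real.sinh w.im ^ 2 := by
  rw [Complex.sq_norm, Complex.sin_eq, ← Complex.ofReal_sin, ← Complex.ofReal_cos,
    ← Complex.ofReal_sinh, ← Complex.ofReal_cosh, Complex.normSq_apply]
  simp only [Complex.add_re, Complex.add_im, Complex.mul_re, Complex.mul_im, Complex.ofReal_re,
    Complex.ofReal_im, Complex.I_re, Complex.I_im]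
  have h1 := Real.cosh_sq w.im
  have h2 := Real.sin_sq_add_cos_sq w.re
  ring_nf
  rw [h1]
  linear_combination Real.sinh w.im ^ 2 * h2

lemma abs_sin_re_le_norm_sin (w : ℂ) : |Real.sin w.re| ≤ ‖Complex.sin w‖ := by
  refine abs_le_of_sq_le_sq ?_ (norm_nonneg _)
  rw [norm_sin_sq]; nlinarith [sq_nonneg (Real.sinh w.im)]

lemma abs_sinh_im_le_norm_sin (w : ℂ) : |Real.sinh w.im| ≤ ‖Complex.sin w‖ := by
  refine abs_le_of_sq_le_sq ?_ (norm_nonneg _)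
  rw [norm_sin_sq]; nlinarith [sq_nonneg (Real.sin w.re)]

lemma norm_sin_le_exp (w : ℂ) : ‖Complex.sin w‖ ≤ Real.exp |w.im| := by
  have h : ‖Complex.sin w‖ ^ 2 ≤ Real.exp |w.im| ^ 2 := by
    rw [norm_sin_sq]
    have h1 : Real.sin w.re ^ 2 ≤ 1 := Real.sin_sq_le_one _
    have h2 : Real.sinh w.im ^ 2 + 1 = Real.cosh |w.im| ^ 2 := by
      rw [Real.cosh_abs, Real.cosh_sq]
    have h3 : Real.cosh |w.im| ≤ Real.exp |w.im| := by
      rw [Real.cosh_eq]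
      have : Real.exp (-|w.im|) ≤ Real.exp |w.im| :=
        Real.exp_le_exp.2 (by linarith [abs_nonneg w.im])
      linarith
    nlinarith [Real.cosh_pos |w.im|]
  exact le_of_sq_le_sq h (Real.exp_pos _).le

/-- Subtract the multiple of π nearest to Re w. Jordan's inequality bounds the real part of the
rest, |t| ≤ |sinh t| its imaginary part, and `norm_sin_sq` combines the two. -/
lemma exists_int_norm_sub_le_of_norm_sin (w : ℂ) :
    ∃ k : ℤ, ‖w - k * π‖ ≤ π / 2 * ‖Complex.sin w‖ := by
  refine ⟨round (w.re / π), ?_⟩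
  set k := round (w.re / π) with hk
  have hp := Real.pi_pos
  set v : ℂ := w - k * π with hv
  have hre : v.re = w.re - k * π := by simp [hv]
  have him : v.im = w.im := by simp [hv]
  have hsin : ‖Complex.sin v‖ = ‖Complex.sin w‖ := by
    have h1 := norm_sin_sq v
    have h2 := norm_sin_sq w
    rw [hre, him, Real.sin_sub_int_mul_pi, mul_pow] at h1
    have : (((-1 : ℝ)) ^ k) ^ 2 = 1 := by
      rw [← zpow_natCast, ← zpow_mul, mul_comm, zpow_mul]; norm_num
    rw [this, one_mul, ← h2] at h1
    exact (sq_eq_sq₀ (norm_nonneg _) (norm_nonneg _)).1 h1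
  have hbd : |v.re| ≤ π / 2 := by
    have := abs_sub_round (w.re / π)
    rw [hre]
    have h3 : w.re - k * π = (w.re / π - k) * π := by field_simp
    rw [h3, abs_mul, abs_of_pos hp]
    nlinarith
  have h1 : |v.re| ≤ π / 2 * |Real.sin v.re| := by
    have := Real.mul_abs_le_abs_sin hbd
    have h4 : π / 2 * (2 / π * |v.re|) = |v.re| := by field_simp
    rw [← h4]; gcongr
  have h2 : |v.im| ≤ π / 2 * |Real.sinh v.im| := by
    have h5 : |v.im| ≤ |Real.sinh v.im| := by
      rw [Real.abs_sinh]; exact Real.self_le_sinh_iff.2 (abs_nonneg _)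
    have : 1 ≤ π / 2 := by linarith [Real.pi_gt_three]
    nlinarith [abs_nonneg (Real.sinh v.im)]
  rw [← hsin]
  refine le_of_sq_le_sq ?_ (by positivity)
  rw [mul_pow, norm_sin_sq, Complex.sq_norm, Complex.normSq_apply]
  have h1' := mul_self_le_mul_self (abs_nonneg _) h1
  have h2' := mul_self_le_mul_self (abs_nonneg _) h2
  rw [abs_mul_abs_self] at h1' h2'
  have e1 := abs_mul_abs_self (Real.sin v.re)
  have e2 := abs_mul_abs_self (Real.sinh v.im)
  nlinarith

/-- If the sine is small compared to its exponential growth, then the argument is close to a zero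
of the sine. -/
lemma exists_int_norm_sub_le_of_norm_sin_le {w : ℂ} {ε : ℝ} (hε : ε ≤ 1 / 4)
    (h : ‖Complex.sin w‖ ≤ ε * Real.exp |w.im|) : ∃ k : ℤ, ‖w - k * π‖ ≤ π * ε := by
  obtain ⟨k, hk⟩ := exists_int_norm_sub_le_of_norm_sin w
  refine ⟨k, hk.trans ?_⟩
  have hε0 : 0 ≤ ε := by
    by_contra hc
    push Not at hc
    nlinarith [norm_nonneg (Complex.sin w), Real.exp_pos |w.im|]
  have h1 := (abs_sinh_im_le_norm_sin w).trans h
  -- With ε ≤ 1/4 the bound on sinh forces exp|Im w| ≤ 2 exp(-|Im w|), so the exponential is at most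
  -- 2 and can be dropped from the hypothesis.
  rw [Real.abs_sinh, Real.sinh_eq] at h1
  have he : 0 < Real.exp |w.im| := Real.exp_pos _
  have h2 : Real.exp |w.im| ≤ 2 * Real.exp (-|w.im|) := by nlinarith
  have h3 : Real.exp |w.im| * Real.exp (-|w.im|) = 1 := by rw [← Real.exp_add]; simp
  have h4 : Real.exp |w.im| ≤ 2 := by nlinarith
  have h5 : ‖Complex.sin w‖ ≤ 2 * ε := by nlinarith
  nlinarith [Real.pi_pos]

/-! ### The functions `cos (√z x)` and `sin (√z x) / √z` -/

lemma sqrt_sq (z : ℂ) : (z ^ (1 / 2 : ℂ)) ^ 2 = z := by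
  rw [← Complex.cpow_nat_mul]; norm_num

/-- Evenness in ρ makes the choice of the square root irrelevant, so later arguments may work with
any root w of z. -/
lemma cosSqrt_of_sq {w z : ℂ} (h : w ^ 2 = z) (x : ℝ) : cosSqrt z x = Complex.cos (w * x) := by
  unfold cosSqrt
  rcases sq_eq_sq_iff_eq_or_eq_neg.1 ((sqrt_sq z).trans h.symm) with h1 | h1 <;> rw [h1]
  rw [neg_mul, Complex.cos_neg]

lemma sinSqrt_of_sq {w z : ℂ} (h : w ^ 2 = z) (hw : w ≠ 0) (x : ℝ) :
    sinSqrt z x = Complex.sin (w * x) / w := by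
  unfold sinSqrt
  rw [if_neg (by rw [← h]; exact pow_ne_zero 2 hw)]
  rcases sq_eq_sq_iff_eq_or_eq_neg.1 ((sqrt_sq z).trans h.symm) with h1 | h1 <;> rw [h1]
  rw [neg_mul, Complex.sin_neg, neg_div_neg_eq]

/-- The sign condition later singles out the root near n rather than the one near -n. -/
lemma exists_sq (z : ℂ) : ∃ w : ℂ, w ^ 2 = z ∧ 0 ≤ w.re := by
  refine ⟨z ^ (1 / 2 : ℂ), sqrt_sq z, ?_⟩
  rcases eq_or_ne z 0 with rfl | hz
  · simp
  rw [Complex.cpow_def_of_ne_zero hz, Complex.exp_re]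
  refine mul_nonneg (Real.exp_pos _).le (Real.cos_nonneg_of_mem_Icc ?_)
  have e : (Complex.log z * (1 / 2)).im = z.arg / 2 := by
    have : (1 / 2 : ℂ) = ((1 / 2 : ℝ) : ℂ) := by norm_num
    rw [this, Complex.im_mul_ofReal, Complex.log_im]; ring
  rw [e]
  constructor <;> linarith [Complex.neg_pi_lt_arg z, Complex.arg_le_pi z]

lemma sinSqrt_zero_left (x : ℝ) : sinSqrt 0 x = x := by simp [sinSqrt]
lemma cosSqrt_zero_left (x : ℝ) : cosSqrt 0 x = 1 := by simp [cosSqrt]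
@[simp] lemma cosSqrt_zero_right (z : ℂ) : cosSqrt z 0 = 1 := by simp [cosSqrt]
@[simp] lemma sinSqrt_zero_right (z : ℂ) : sinSqrt z 0 = 0 := by simp [sinSqrt]
lemma cosSqrt_neg (z : ℂ) (x : ℝ) : cosSqrt z (-x) = cosSqrt z x := by simp [cosSqrt]
lemma sinSqrt_neg (z : ℂ) (x : ℝ) : sinSqrt z (-x) = -sinSqrt z x := by
  unfold sinSqrt; split_ifs <;> simp [neg_div]

lemma hasDerivAt_cosSqrt (z : ℂ) (x : ℝ) : HasDerivAt (cosSqrt z) (-z * sinSqrt z x) x := by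
  rcases eq_or_ne z 0 with rfl | hz
  · have : cosSqrt 0 = fun _ => 1 := funext cosSqrt_zero_left
    rw [this]; simpa using hasDerivAt_const x (1 : ℂ)
  obtain ⟨w, hw, -⟩ := exists_sq z
  have hw0 : w ≠ 0 := by rintro rfl; apply hz; rw [← hw]; simp
  have : cosSqrt z = fun x : ℝ => Complex.cos (w * x) := funext (cosSqrt_of_sq hw)
  rw [this, sinSqrt_of_sq hw hw0]
  have h := ((hasDerivAt_id (x : ℂ)).const_mul w).ccos.comp_ofReal
  refine h.congr_deriv ?_
  rw [← hw]; simp; field_simp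

lemma hasDerivAt_sinSqrt (z : ℂ) (x : ℝ) : HasDerivAt (sinSqrt z) (cosSqrt z x) x := by
  rcases eq_or_ne z 0 with rfl | hz
  · have : sinSqrt 0 = fun x : ℝ => (x : ℂ) := funext sinSqrt_zero_left
    rw [this, cosSqrt_zero_left]; exact (hasDerivAt_id (x : ℂ)).comp_ofReal
  obtain ⟨w, hw, -⟩ := exists_sq z
  have hw0 : w ≠ 0 := by rintro rfl; apply hz; rw [← hw]; simp
  have : sinSqrt z = fun x : ℝ => Complex.sin (w * x) / w := funext (sinSqrt_of_sq hw hw0)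
  rw [this, cosSqrt_of_sq hw]
  have h := (((hasDerivAt_id (x : ℂ)).const_mul w).csin.div_const w).comp_ofReal
  refine h.congr_deriv ?_
  simp; field_simp

lemma continuous_cosSqrt (z : ℂ) : Continuous (cosSqrt z) :=
  continuous_iff_continuousAt.2 fun x => (hasDerivAt_cosSqrt z x).continuousAt

lemma continuous_sinSqrt (z : ℂ) : Continuous (sinSqrt z) :=
  continuous_iff_continuousAt.2 fun x => (hasDerivAt_sinSqrt z x).continuousAt

lemma sinSqrt_sub (z : ℂ) (x y : ℝ) :
    sinSqrt z (x - y) = sinSqrt z x * cosSqrt z y - cosSqrt z x * sinSqrt z y := by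
  rcases eq_or_ne z 0 with rfl | hz
  · simp [sinSqrt_zero_left, cosSqrt_zero_left]
  obtain ⟨w, hw, -⟩ := exists_sq z
  have hw0 : w ≠ 0 := by rintro rfl; apply hz; rw [← hw]; simp
  simp only [sinSqrt_of_sq hw hw0, cosSqrt_of_sq hw]
  push_cast
  rw [mul_sub, Complex.sin_sub]; field_simp

lemma norm_sinSqrt_le {w z : ℂ} (h : w ^ 2 = z) (hw : w ≠ 0) {x b : ℝ} (hx : |x| ≤ b) :
    ‖sinSqrt z x‖ ≤ Real.exp (|w.im| * b) / ‖w‖ := by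
  rw [sinSqrt_of_sq h hw, norm_div]
  gcongr
  refine (norm_sin_le_exp _).trans (Real.exp_le_exp.2 ?_)
  rw [Complex.im_mul_ofReal, abs_mul]
  gcongr

lemma hasSum_cosSqrt (z : ℂ) (x : ℝ) :
    HasSum (fun k : ℕ => ((-1) ^ k * (x : ℂ) ^ (2 * k) / (2 * k).factorial) * z ^ k)
      (cosSqrt z x) := by
  obtain ⟨w, hw, -⟩ := exists_sq z
  rw [cosSqrt_of_sq hw]
  convert Complex.hasSum_cos (w * x) using 2 with k
  rw [← hw]; ring

lemma hasSum_sinSqrt (z : ℂ) (x : ℝ) :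
    HasSum (fun k : ℕ => ((-1) ^ k * (x : ℂ) ^ (2 * k + 1) / (2 * k + 1).factorial) * z ^ k)
      (sinSqrt z x) := by
  rcases eq_or_ne z 0 with rfl | hz
  · rw [sinSqrt_zero_left]
    convert hasSum_single (f := fun k : ℕ => ((-1) ^ k * (x : ℂ) ^ (2 * k + 1) /
      (2 * k + 1).factorial) * (0 : ℂ) ^ k) 0 (fun k hk => by simp [hk]) using 1
    simp
  obtain ⟨w, hw, -⟩ := exists_sq z
  have hw0 : w ≠ 0 := by rintro rfl; apply hz; rw [← hw]; simp
  rw [sinSqrt_of_sq hw hw0]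
  refine ((Complex.hasSum_sin (w * x)).div_const w).congr_fun fun k => ?_
  rw [← hw]; field_simp; ring

/-- Convergence at the real point R dominates the series on the disc of radius R, so convergence is
locally uniform. -/
lemma differentiable_of_hasSum_mul_pow {a : ℕ → ℂ} {f : ℂ → ℂ}
    (h : ∀ z, HasSum (fun k => a k * z ^ k) (f z)) : Differentiable ℂ f := by
  intro z
  have hf : f = fun z => ∑' k, a k * z ^ k := funext fun z => (h z).tsum_eq.symm
  set R : ℝ := ‖z‖ + 1
  have hR : 0 < R := by positivity
  have hd : DifferentiableOn ℂ f (Metric.ball 0 R) := by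
    rw [hf]
    refine Complex.differentiableOn_tsum_of_summable_norm
      (u := fun k => ‖a k * (R : ℂ) ^ k‖) ((h R).summable.norm) (fun k => ?_)
      Metric.isOpen_ball (fun k w hw => ?_)
    · fun_prop
    · rw [norm_mul, norm_mul, norm_pow, norm_pow, Complex.norm_real, Real.norm_of_nonneg hR.le]
      have : ‖w‖ ≤ R := by simpa using (mem_ball_zero_iff.1 hw).le
      gcongr
  exact hd.differentiableAt (Metric.isOpen_ball.mem_nhds (by simp [R]))

lemma differentiable_cosSqrt (x : ℝ) : Differentiable ℂ (fun z => cosSqrt z x) :=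
  differentiable_of_hasSum_mul_pow fun z => hasSum_cosSqrt z x

lemma differentiable_sinSqrt (x : ℝ) : Differentiable ℂ (fun z => sinSqrt z x) :=
  differentiable_of_hasSum_mul_pow fun z => hasSum_sinSqrt z x

/-- Termwise integration of the power series in z gives again a power series converging for every z,
which replaces differentiation under the integral. -/
lemma differentiable_integral_sinSqrt {f : ℝ → ℂ} {a b : ℝ} (x : ℝ)
    (hf : ContinuousOn f (uIcc a b)) :
    Differentiable ℂ (fun z => ∫ t in a..b, f t * sinSqrt z (x - t)) := by
  refine differentiable_of_hasSum_mul_pow (a := fun k => ∫ t in a..b,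
    f t * ((-1) ^ k * ((x - t : ℝ) : ℂ) ^ (2 * k + 1) / (2 * k + 1).factorial)) fun z => ?_
  obtain ⟨M, hM⟩ := isCompact_uIcc.exists_bound_of_continuousOn hf
  obtain ⟨D, hD⟩ := isCompact_uIcc.exists_bound_of_continuousOn
    (f := fun t : ℝ => x - t) (s := uIcc a b) (by fun_prop)
  have hM0 : 0 ≤ M := (norm_nonneg _).trans (hM a left_mem_uIcc)
  have hD0 : 0 ≤ D := (norm_nonneg _).trans (hD a left_mem_uIcc)
  simp_rw [← intervalIntegral.integral_mul_const]
  refine intervalIntegral.hasSum_integral_of_dominated_convergence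
    (bound := fun k _ => M * ((D ^ (2 * k + 1) / (2 * k + 1).factorial) * ‖z‖ ^ k)) ?_ ?_ ?_ ?_ ?_
  · intro k
    refine ContinuousOn.aestronglyMeasurable ?_ measurableSet_uIoc
    refine ContinuousOn.mul (ContinuousOn.mul (hf.mono uIoc_subset_uIcc) ?_) continuousOn_const
    fun_prop
  · intro k
    refine Filter.Eventually.of_forall fun t ht => ?_
    have ht' := uIoc_subset_uIcc ht
    rw [mul_assoc, norm_mul, norm_mul, norm_div, norm_mul, norm_pow, norm_pow, norm_pow,
      Complex.norm_real, Complex.norm_natCast]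
    simp only [norm_neg, norm_one, one_pow, one_mul]
    have h1 := hM t ht'
    have h2 := hD t ht'
    gcongr
  · refine Filter.Eventually.of_forall fun t _ => Summable.mul_left _ ?_
    -- The dominating series is the sine series at the real arguments ‖z‖ and D with all signs
    -- removed.
    have := (hasSum_sinSqrt ‖z‖ D).summable.norm
    refine this.congr fun k => ?_
    simp [abs_of_nonneg hD0]
  · simp
  · refine Filter.Eventually.of_forall fun t _ => ?_
    refine ((hasSum_sinSqrt z (x - t)).mul_left (f t)).congr_fun fun k => ?_
    ring

/-! ### Zeros of entire functions and Rouché's theorem -/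

/-- One nonzero value makes every order finite by the identity theorem. The quotient is entire
because near z₀ it agrees with the local analytic factor. -/
lemma exists_pow_mul_of_differentiable {f : ℂ → ℂ} (hf : Differentiable ℂ f) {w : ℂ}
    (hw : f w ≠ 0) (z₀ : ℂ) : ∃ (n : ℕ) (g : ℂ → ℂ), Differentiable ℂ g ∧ g z₀ ≠ 0 ∧
      ∀ z, f z = (z - z₀) ^ n * g z := by
  have han : AnalyticOnNhd ℂ f univ := fun z _ => hf.analyticAt z
  have htop : analyticOrderAt f z₀ ≠ ⊤ := by
    intro h
    have h1 := han.eqOn_zero_of_preconnected_of_eventuallyEq_zero isPreconnected_univ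
      (mem_univ z₀) (analyticOrderAt_eq_top.1 h)
    exact hw (h1 (mem_univ w))
  obtain ⟨g, hg, hg0, hfg⟩ := (hf.analyticAt z₀).analyticOrderAt_ne_top.1 htop
  set n := analyticOrderNatAt f z₀
  refine ⟨n, fun z => if z = z₀ then g z₀ else f z / (z - z₀) ^ n, fun z => ?_, by simpa, ?_⟩
  · rcases eq_or_ne z z₀ with rfl | hz
    · refine hg.differentiableAt.congr_of_eventuallyEq ?_
      filter_upwards [hfg] with x hx
      split_ifs with h
      · rw [h]
      · rw [hx, smul_eq_mul, mul_div_cancel_left₀ _ (pow_ne_zero _ (sub_ne_zero.2 h))]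
    · have h2 : DifferentiableAt ℂ (fun z => f z / (z - z₀) ^ n) z :=
        (hf z).div (by fun_prop) (pow_ne_zero _ (sub_ne_zero.2 hz))
      refine h2.congr_of_eventuallyEq ?_
      filter_upwards [isOpen_ne.mem_nhds hz] with x hx
      rw [if_neg hx]
  · intro z
    rcases eq_or_ne z z₀ with rfl | hz
    · simpa using hfg.self_of_nhds
    · simp only [if_neg hz]
      rw [mul_div_cancel₀ _ (pow_ne_zero _ (sub_ne_zero.2 hz))]

lemma differentiable_multiset_prod_sub (S : Multiset ℂ) :
    Differentiable ℂ (fun z : ℂ => (S.map fun s => z - s).prod) := by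
  induction S using Multiset.induction with
  | empty => simp
  | cons a S ih =>
    simp only [Multiset.map_cons, Multiset.prod_cons]
    exact (differentiable_id.sub_const a).mul ih

lemma multiset_prod_sub_ne_zero {S : Multiset ℂ} {z : ℂ} (h : z ∉ S) :
    (S.map fun s => z - s).prod ≠ 0 := by
  refine Multiset.prod_ne_zero fun h0 => ?_
  obtain ⟨s, hs, hsz⟩ := Multiset.mem_map.1 h0
  exact h (sub_eq_zero.1 hsz ▸ hs)

lemma analyticOrderAt_multiset_prod_sub (S : Multiset ℂ) (z₀ : ℂ) :
    analyticOrderAt (fun z : ℂ => (S.map fun s => z - s).prod) z₀ = S.count z₀ := by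
  induction S using Multiset.induction with
  | empty =>
    simp only [Multiset.map_zero, Multiset.prod_zero, Multiset.count_zero, Nat.cast_zero]
    exact (analyticAt_const.analyticOrderAt_eq_zero).2 one_ne_zero
  | cons a S ih =>
    have h := analyticOrderAt_mul (f := fun z : ℂ => z - a)
      (g := fun z : ℂ => (S.map fun s => z - s).prod) (z₀ := z₀) (by fun_prop)
      ((differentiable_multiset_prod_sub S).analyticAt z₀)
    simp only [Multiset.map_cons, Multiset.prod_cons]
    rw [show (fun z : ℂ => (z - a) * (S.map fun s => z - s).prod) =
      (fun z : ℂ => z - a) * (fun z : ℂ => (S.map fun s => z - s).prod) from rfl, h, ih,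
      Multiset.count_cons]
    split_ifs with h1
    · subst h1
      have : analyticOrderAt (fun z : ℂ => z - z₀) z₀ = 1 := by
        have := analyticOrderAt_centeredMonomial (𝕜 := ℂ) (z₀ := z₀) (n := 1)
        rwa [pow_one] at this
      rw [this]; push_cast; rw [add_comm]
    · have : analyticOrderAt (fun z : ℂ => z - a) z₀ = 0 :=
        (AnalyticAt.analyticOrderAt_eq_zero (by fun_prop)).2 (sub_ne_zero.2 h1)
      rw [this]; simp

lemma exists_multiset_prod_mul_of_finset {f : ℂ → ℂ} (hf : Differentiable ℂ f) {w : ℂ}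
    (hw : f w ≠ 0) (Z : Finset ℂ) : ∃ (S : Multiset ℂ) (g : ℂ → ℂ), Differentiable ℂ g ∧
      (∀ s ∈ S, s ∈ Z) ∧ (∀ z ∈ Z, g z ≠ 0) ∧ ∀ z, f z = (S.map fun s => z - s).prod * g z := by
  classical
  induction Z using Finset.induction_on with
  | empty => exact ⟨0, f, hf, by simp, by simp, by simp⟩
  | insert a Z _ ih =>
    obtain ⟨S, g, hg, hS, hgZ, hfg⟩ := ih
    have hgw : g w ≠ 0 := by
      intro h; apply hw; rw [hfg, h, mul_zero]
    obtain ⟨n, k, hk, hka, hgk⟩ := exists_pow_mul_of_differentiable hg hgw a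
    refine ⟨Multiset.replicate n a + S, k, hk, ?_, ?_, ?_⟩
    · intro s hs
      rcases Multiset.mem_add.1 hs with h | h
      · rw [Multiset.eq_of_mem_replicate h]; exact Finset.mem_insert_self _ _
      · exact Finset.mem_insert_of_mem (hS s h)
    · intro z hz
      rcases Finset.mem_insert.1 hz with rfl | h
      · exact hka
      · intro h0; apply hgZ z h; rw [hgk, h0, mul_zero]
    · intro z
      rw [hfg, hgk, Multiset.map_add, Multiset.prod_add, Multiset.map_replicate,
        Multiset.prod_replicate]
      ring

/-- A compact set contains only finitely many zeros, since an accumulation point would make f vanish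
identically; they are divided out one by one. -/
lemma exists_multiset_prod_mul {f : ℂ → ℂ} (hf : Differentiable ℂ f) {w : ℂ} (hw : f w ≠ 0)
    {K : Set ℂ} (hK : IsCompact K) : ∃ (S : Multiset ℂ) (g : ℂ → ℂ), Differentiable ℂ g ∧
      (∀ s ∈ S, s ∈ K) ∧ (∀ z ∈ K, g z ≠ 0) ∧ ∀ z, f z = (S.map fun s => z - s).prod * g z := by
  have han : AnalyticOnNhd ℂ f univ := fun z _ => hf.analyticAt z
  have hfin : (K ∩ {z | f z = 0}).Finite := by
    by_contra hinf
    obtain ⟨x, -, hx⟩ := Set.Infinite.exists_accPt_of_subset_isCompact hinf hK inter_subset_left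
    have h1 : ∃ᶠ z in nhdsWithin x {x}ᶜ, f z = 0 := by
      rw [accPt_iff_frequently_nhdsNE] at hx
      exact hx.mono fun z hz => hz.2
    exact hw (han.eqOn_zero_of_preconnected_of_frequently_eq_zero isPreconnected_univ
      (mem_univ x) h1 (mem_univ w))
  obtain ⟨S, g, hg, hS, hgZ, hfg⟩ := exists_multiset_prod_mul_of_finset hf hw hfin.toFinset
  refine ⟨S, g, hg, fun s hs => (hfin.mem_toFinset.1 (hS s hs)).1, fun z hz h0 => ?_, hfg⟩
  exact hgZ z (hfin.mem_toFinset.2 ⟨hz, by simp [hfg, h0]⟩) h0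

lemma analyticOrderAt_of_multiset_prod_mul {f g : ℂ → ℂ} {S : Multiset ℂ}
    (hg : Differentiable ℂ g) (hfg : ∀ z, f z = (S.map fun s => z - s).prod * g z) {z : ℂ}
    (hz : g z ≠ 0) : analyticOrderAt f z = S.count z := by
  have : f = (fun z => (S.map fun s => z - s).prod) * g := funext hfg
  rw [this, analyticOrderAt_mul ((differentiable_multiset_prod_sub S).analyticAt z)
    (hg.analyticAt z), analyticOrderAt_multiset_prod_sub,
    (hg.analyticAt z).analyticOrderAt_eq_zero.2 hz, add_zero]

lemma circleIntegral_logDeriv_multiset_prod_sub {c : ℂ} {R : ℝ} (hR : 0 < R) (S : Multiset ℂ)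
    (hS : ∀ s ∈ S, s ∈ Metric.ball c R) :
    CircleIntegrable (logDeriv fun z : ℂ => (S.map fun s => z - s).prod) c R ∧
    (∮ z in C(c, R), logDeriv (fun z : ℂ => (S.map fun s => z - s).prod) z) =
      2 * π * Complex.I * Multiset.card S := by
  induction S using Multiset.induction with
  | empty =>
    have : logDeriv (fun z : ℂ => ((0 : Multiset ℂ).map fun s => z - s).prod) = 0 := by
      simp only [Multiset.map_zero, Multiset.prod_zero]; exact logDeriv_const 1
    rw [this]
    exact ⟨circleIntegrable_const (0 : ℂ) c R, by simp [circleIntegral]⟩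
  | cons a S ih =>
    obtain ⟨ih1, ih2⟩ := ih fun s hs => hS s (Multiset.mem_cons_of_mem hs)
    have ha := hS a (Multiset.mem_cons_self a S)
    have hint : CircleIntegrable (fun z => (z - a)⁻¹) c R := by
      rw [circleIntegrable_sub_inv_iff]; right
      intro h
      rw [Metric.mem_ball] at ha
      rw [Metric.mem_sphere, abs_of_pos hR] at h
      exact absurd h ha.ne
    have hcongr : ∀ z ∈ Metric.sphere c R,
        logDeriv (fun z : ℂ => ((a ::ₘ S).map fun s => z - s).prod) z =
          (z - a)⁻¹ + logDeriv (fun z : ℂ => (S.map fun s => z - s).prod) z := by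
      intro z hz
      simp only [Multiset.map_cons, Multiset.prod_cons]
      have hzS : ∀ s ∈ a ::ₘ S, z ≠ s := by
        rintro s hs rfl
        exact absurd (Metric.mem_sphere.1 hz) (Metric.mem_ball.1 (hS z hs)).ne
      rw [logDeriv_mul (f := fun z => z - a) z (sub_ne_zero.2 (hzS a (Multiset.mem_cons_self a S)))
        (multiset_prod_sub_ne_zero fun h => hzS z (Multiset.mem_cons_of_mem h) rfl)
        (by fun_prop) (differentiable_multiset_prod_sub S z)]
      congr 1
      simp [logDeriv_apply]
    refine ⟨(hint.add ih1).congr (fun z hz => ?_), ?_⟩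
    · have := circleMap_mem_sphere c hR.le z
      exact (hcongr _ this).symm
    · rw [circleIntegral.integral_congr hR.le hcongr, circleIntegral.integral_add hint ih1, ih2,
        circleIntegral.integral_sub_inv_of_mem_ball ha, Multiset.card_cons]
      push_cast; ring

/-- The argument principle for an entire function with a given factorization. -/
lemma circleIntegral_logDeriv_of_multiset_prod_mul {f g : ℂ → ℂ} {S : Multiset ℂ} {c : ℂ} {R : ℝ}
    (hR : 0 < R) (hS : ∀ s ∈ S, s ∈ Metric.ball c R) (hg : Differentiable ℂ g)
    (hgz : ∀ z ∈ Metric.closedBall c R, g z ≠ 0)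
    (hfg : ∀ z, f z = (S.map fun s => z - s).prod * g z) :
    CircleIntegrable (logDeriv f) c R ∧
    (∮ z in C(c, R), logDeriv f z) = 2 * π * Complex.I * Multiset.card S := by
  obtain ⟨h1, h2⟩ := circleIntegral_logDeriv_multiset_prod_sub hR S hS
  have hf : f = fun z => (S.map fun s => z - s).prod * g z := funext hfg
  have hd : DifferentiableOn ℂ (logDeriv g) (Metric.closedBall c R) := fun z hz =>
    (((hg.analyticAt z).deriv.differentiableAt).div (hg z) (hgz z hz)).differentiableWithinAt
  have hcont : ContinuousOn (logDeriv g) (Metric.closedBall c R) := hd.continuousOn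
  have h3 : CircleIntegrable (logDeriv g) c R :=
    (hcont.mono Metric.sphere_subset_closedBall).circleIntegrable hR.le
  have h4 : (∮ z in C(c, R), logDeriv g z) = 0 :=
    Complex.circleIntegral_eq_zero_of_differentiable_on_off_countable hR.le countable_empty hcont
      fun z hz => hd.differentiableAt (Metric.closedBall_mem_nhds_of_mem hz.1)
  have hcongr : ∀ z ∈ Metric.sphere c R, logDeriv f z =
      logDeriv (fun z : ℂ => (S.map fun s => z - s).prod) z + logDeriv g z := by
    intro z hz
    rw [hf]
    refine logDeriv_mul (g := g) z (multiset_prod_sub_ne_zero fun h => ?_)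
      (hgz z (Metric.sphere_subset_closedBall hz)) (differentiable_multiset_prod_sub S z) (hg z)
    exact absurd (Metric.mem_sphere.1 hz) (Metric.mem_ball.1 (hS z h)).ne
  refine ⟨(h1.add h3).congr fun z hz => ?_, ?_⟩
  · have := circleMap_mem_sphere c hR.le z
    exact (hcongr _ this).symm
  · rw [circleIntegral.integral_congr hR.le hcongr, circleIntegral.integral_add h1 h3, h2, h4,
      add_zero]

/-- **Rouché's theorem** for entire functions, where the multisets `S` and `S₀` list the zeros in
the disc with multiplicities. -/
theorem exists_zeros_card_eq_of_norm_sub_lt {f f₀ : ℂ → ℂ} (hf : Differentiable ℂ f)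
    (hf₀ : Differentiable ℂ f₀) {c : ℂ} {R : ℝ} (hR : 0 < R)
    (h : ∀ z ∈ Metric.sphere c R, ‖f z - f₀ z‖ < ‖f₀ z‖) :
    ∃ S S₀ : Multiset ℂ, (∀ s ∈ S, s ∈ Metric.ball c R) ∧ (∀ s ∈ S₀, s ∈ Metric.ball c R) ∧
      (∀ z ∈ Metric.ball c R, analyticOrderAt f z = S.count z) ∧
      (∀ z ∈ Metric.ball c R, analyticOrderAt f₀ z = S₀.count z) ∧
      Multiset.card S = Multiset.card S₀ := by
  have hf₀z : ∀ z ∈ Metric.sphere c R, f₀ z ≠ 0 := fun z hz h0 => by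
    have := h z hz; rw [h0] at this; simp at this; linarith [norm_nonneg (f z)]
  have hfz : ∀ z ∈ Metric.sphere c R, f z ≠ 0 := fun z hz h0 => by
    have := h z hz; rw [h0] at this; simp at this
  obtain ⟨w, hw⟩ : (Metric.sphere c R).Nonempty := NormedSpace.sphere_nonempty.2 hR.le
  -- Zeros are divided out on the closed disc; having none on the circle moves them all into the
  -- open disc, where the argument principle applies.
  have key : ∀ {F : ℂ → ℂ}, Differentiable ℂ F → (∀ z ∈ Metric.sphere c R, F z ≠ 0) →
      ∃ S : Multiset ℂ, (∀ s ∈ S, s ∈ Metric.ball c R) ∧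
        (∀ z ∈ Metric.ball c R, analyticOrderAt F z = S.count z) ∧
        CircleIntegrable (logDeriv F) c R ∧
        (∮ z in C(c, R), logDeriv F z) = 2 * π * Complex.I * Multiset.card S := by
    intro F hF hFz
    obtain ⟨S, g, hg, hS, hgz, hfg⟩ :=
      exists_multiset_prod_mul hF (hFz w hw) (isCompact_closedBall c R)
    have hS' : ∀ s ∈ S, s ∈ Metric.ball c R := by
      intro s hs
      rcases (Metric.mem_closedBall.1 (hS s hs)).lt_or_eq with h1 | h1
      · exact h1
      · refine absurd ?_ (hFz s h1)
        rw [hfg, Multiset.prod_eq_zero (Multiset.mem_map.2 ⟨s, hs, sub_self s⟩), zero_mul]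
    exact ⟨S, hS', fun z hz => analyticOrderAt_of_multiset_prod_mul hg hfg
      (hgz z (Metric.ball_subset_closedBall hz)),
      circleIntegral_logDeriv_of_multiset_prod_mul hR hS' hg hgz hfg⟩
  obtain ⟨S, hS, hSo, hSi, hSc⟩ := key hf hfz
  obtain ⟨S₀, hS₀, hS₀o, hS₀i, hS₀c⟩ := key hf₀ hf₀z
  refine ⟨S, S₀, hS, hS₀, hSo, hS₀o, ?_⟩
  -- On the circle f/f₀ stays within distance 1 of 1, hence in the slit plane, so log(f/f₀) is a
  -- primitive of the difference of the logarithmic derivatives.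
  have hzero : (∮ z in C(c, R), (logDeriv f z - logDeriv f₀ z)) = 0 := by
    refine circleIntegral.integral_eq_zero_of_hasDerivWithinAt
      (f := fun z => Complex.log (f z / f₀ z)) hR.le fun z hz => ?_
    have hslit : f z / f₀ z ∈ Complex.slitPlane := by
      refine Complex.mem_slitPlane_of_norm_lt_one (z := f z / f₀ z - 1) ?_ |> fun h => by simpa using h
      rw [div_sub_one (hf₀z z hz), norm_div, div_lt_one (norm_pos_iff.2 (hf₀z z hz))]
      exact h z hz
    have h1 := ((hf z).hasDerivAt.div (hf₀ z).hasDerivAt (hf₀z z hz)).clog hslit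
    refine (h1.congr_deriv ?_).hasDerivWithinAt
    have e1 := hfz z hz
    have e2 := hf₀z z hz
    rw [logDeriv_apply, logDeriv_apply]
    simp only [Pi.div_apply]
    field_simp
  rw [circleIntegral.integral_sub hSi hS₀i, hSc, hS₀c, sub_eq_zero] at hzero
  have := mul_left_cancel₀ Complex.two_pi_I_ne_zero hzero
  exact_mod_cast this

/-- If the zeros of `f` in an exhausting sequence of discs are counted by `K` for the `K`-th disc,
then the zeros of `f` can be enumerated accordingly. -/
theorem exists_enumeration_zeros {f : ℂ → ℂ} {R : ℕ → ℝ} (hR : Monotone R)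
    (hRt : Filter.Tendsto R Filter.atTop Filter.atTop) {N : ℕ} {S : ℕ → Multiset ℂ}
    (hball : ∀ K, N ≤ K → ∀ s ∈ S K, s ∈ Metric.ball 0 (R K))
    (hcount : ∀ K, N ≤ K → ∀ z ∈ Metric.ball 0 (R K), analyticOrderAt f z = (S K).count z)
    (hcard : ∀ K, N ≤ K → Multiset.card (S K) = K) :
    ∃ μ : ℕ → ℂ, (∀ z, {k | μ k = z}.encard = analyticOrderAt f z) ∧
      ∀ k, N ≤ k → μ k ∈ Metric.ball 0 (R (k + 1)) ∧ μ k ∉ Metric.ball 0 (R k) := by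
  classical
  have hsucc : ∀ K, N ≤ K → ∀ z ∈ Metric.ball (0 : ℂ) (R K),
      (S K).count z = (S (K + 1)).count z := by
    intro K hK z hz
    have h1 := hcount K hK z hz
    have h2 := hcount (K + 1) (by omega) z (Metric.ball_subset_ball (hR (by omega)) hz)
    exact_mod_cast h1.symm.trans h2
  have hle : ∀ K, N ≤ K → S K ≤ S (K + 1) := by
    intro K hK
    refine Multiset.le_iff_count.2 fun z => ?_
    by_cases hz : z ∈ Metric.ball (0 : ℂ) (R K)
    · exact (hsucc K hK z hz).le
    · rw [Multiset.count_eq_zero.2 fun h => hz (hball K hK z h)]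
      exact Nat.zero_le _
  -- The multisets increase and their cardinalities grow by one, so exactly one zero enters at each
  -- step; it becomes the K-th one. The first N are taken from S N in any order.
  have hone : ∀ K, ∃ t, N ≤ K → S (K + 1) = S K + {t} := by
    intro K
    by_cases hK : N ≤ K
    · obtain ⟨T, hT⟩ := Multiset.le_iff_exists_add.1 (hle K hK)
      have hc := congrArg Multiset.card hT
      rw [Multiset.card_add, hcard K hK, hcard (K + 1) (by omega)] at hc
      obtain ⟨t, rfl⟩ := Multiset.card_eq_one.1 (by omega : Multiset.card T = 1)
      exact ⟨t, fun _ => hT⟩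
    · exact ⟨0, fun h => absurd h hK⟩
  choose t ht using hone
  have hlen : (S N).toList.length = N := by rw [Multiset.length_toList, hcard N le_rfl]
  set μ : ℕ → ℂ := fun k => if h : k < N then (S N).toList.get ⟨k, by omega⟩ else t k with hμ
  have hrange : ∀ K, N ≤ K → (Multiset.range K).map μ = S K := by
    intro K hK
    induction K, hK using Nat.le_induction with
    | base =>
      have : (List.range N).map μ = (S N).toList := by
        refine List.ext_get (by simp [hlen]) fun n h1 h2 => ?_
        have hn : n < N := by simpa using h1
        simp [hμ, hn]
      conv_rhs => rw [← Multiset.coe_toList (S N), ← this]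
      simp [Multiset.range]
    | succ K hK ih =>
      rw [Multiset.range_succ, Multiset.map_cons, ih, ht K hK]
      have : μ K = t K := by simp [hμ, not_lt.2 hK]
      rw [this, add_comm, Multiset.singleton_add]
  have hμt : ∀ k, N ≤ k → μ k ∈ Metric.ball 0 (R (k + 1)) ∧ μ k ∉ Metric.ball 0 (R k) := by
    intro k hk
    have e : μ k = t k := by simp [hμ, not_lt.2 hk]
    rw [e]
    refine ⟨hball (k + 1) (by omega) _ (by rw [ht k hk]; simp), fun hz => ?_⟩
    -- If the new zero lay in the smaller disc, its count would have to be the same in both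
    -- multisets, but it has just gone up by one.
    have := hsucc k hk _ hz
    rw [ht k hk] at this
    simp at this
  refine ⟨μ, fun z => ?_, hμt⟩
  obtain ⟨K, hK, hKz⟩ : ∃ K, N ≤ K ∧ ‖z‖ < R K := by
    obtain ⟨K, h1, h2⟩ := ((hRt.eventually_gt_atTop ‖z‖).and (Filter.eventually_ge_atTop N)).exists
    exact ⟨K, h2, h1⟩
  have hset : {k | μ k = z} = ((Finset.range K).filter fun k => z = μ k : Finset ℕ) := by
    ext k
    simp only [mem_ofPred_eq, Finset.coe_filter, Finset.mem_range]
    refine ⟨fun h => ⟨?_, h.symm⟩, fun h => h.2.symm⟩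
    by_contra hk
    push Not at hk
    refine (hμt k (hK.trans hk)).2 (Metric.ball_subset_ball (hR hk) ?_)
    rw [h]; simpa using hKz
  rw [hset, Set.encard_coe_eq_coe_finsetCard, hcount K hK z (by simpa using hKz), ← hrange K hK,
    Multiset.count_map]
  rfl

/-! ### Calculus on `[0, π]` -/

lemma integral_eq_sub_of_hasDerivWithinAt_Icc {A A' : ℝ → ℂ}
    (hA : ∀ x ∈ Icc 0 π, HasDerivWithinAt A (A' x) (Icc 0 π) x)
    (hA' : ContinuousOn A' (Icc 0 π)) {a b : ℝ} (ha : a ∈ Icc 0 π) (hb : b ∈ Icc 0 π) :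
    ∫ t in a..b, A' t = A b - A a := by
  have hsub : uIcc a b ⊆ Icc 0 π := uIcc_subset_Icc ha hb
  refine intervalIntegral.integral_eq_sub_of_hasDeriv_right
    (fun x hx => ((hA x (hsub hx)).continuousWithinAt).mono hsub) (fun x hx => ?_)
    (hA'.mono hsub).intervalIntegrable
  have h1 : 0 < x := (le_min ha.1 hb.1).trans_lt hx.1
  have h2 : x < π := hx.2.trans_le (max_le ha.2 hb.2)
  exact ((hA x ⟨h1.le, h2.le⟩).hasDerivAt (Icc_mem_nhds h1 h2)).hasDerivWithinAt

lemma hasDerivWithinAt_integral_Icc {f : ℝ → ℂ} (hf : ContinuousOn f (Icc 0 π)) {a x : ℝ}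
    (ha : a ∈ Icc 0 π) (hx : x ∈ Icc 0 π) :
    HasDerivWithinAt (fun u => ∫ t in a..u, f t) (f x) (Icc 0 π) x := by
  -- The constant extension beyond the endpoints is continuous on the whole line, so that the usual
  -- two-sided theorem applies at the endpoints too.
  set g : ℝ → ℂ := IccExtend Real.pi_pos.le ((Icc 0 π).domRestrict f) with hg
  have hgc : Continuous g := (continuousOn_iff_continuous_domRestrict.1 hf).Icc_extend'
  have hgf : ∀ t ∈ Icc 0 π, g t = f t := fun t ht => by
    rw [hg, IccExtend_of_mem _ _ ht]; rfl
  have hi : ∀ u ∈ Icc 0 π, ∫ t in a..u, f t = ∫ t in a..u, g t := fun u hu =>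
    intervalIntegral.integral_congr fun t ht => (hgf t (uIcc_subset_Icc ha hu ht)).symm
  rw [← hgf x hx]
  exact (intervalIntegral.integral_hasDerivAt_right (hgc.intervalIntegrable _ _)
    hgc.aestronglyMeasurable.stronglyMeasurableAtFilter hgc.continuousAt).hasDerivWithinAt.congr
    hi (hi x hx)

lemma _root_.AbsolutelyContinuousOnInterval.of_dist_le {E F : Type*} [PseudoMetricSpace E]
    [PseudoMetricSpace F] {f : ℝ → E} {g : ℝ → F} {a b : ℝ}
    (hf : AbsolutelyContinuousOnInterval f a b) (h : ∀ x y, dist (g x) (g y) ≤ dist (f x) (f y)) :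
    AbsolutelyContinuousOnInterval g a b :=
  squeeze_zero (fun _ => Finset.sum_nonneg fun _ _ => dist_nonneg)
    (fun _ => Finset.sum_le_sum fun _ _ => h _ _) hf

/-- The fundamental theorem of calculus for complex-valued absolutely continuous functions. -/
lemma _root_.AbsolutelyContinuousOnInterval.integral_eq_sub_of_ae_hasDerivAt {G G' : ℝ → ℂ}
    {a b : ℝ} (hG : AbsolutelyContinuousOnInterval G a b)
    (hG' : ∀ᵐ x, x ∈ uIcc a b → HasDerivAt G (G' x) x) :
    IntervalIntegrable G' volume a b ∧ ∫ x in a..b, G' x = G b - G a := by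
  -- The real-valued theorem is applied to the real and imaginary parts separately.
  have hre : AbsolutelyContinuousOnInterval (fun x => (G x).re) a b :=
    hG.of_dist_le fun x y => by
      rw [Real.dist_eq, Complex.dist_eq, ← Complex.sub_re]; exact Complex.abs_re_le_norm _
  have him : AbsolutelyContinuousOnInterval (fun x => (G x).im) a b :=
    hG.of_dist_le fun x y => by
      rw [Real.dist_eq, Complex.dist_eq, ← Complex.sub_im]; exact Complex.abs_im_le_norm _
  have hre' : ∀ᵐ x, x ∈ uIcc a b → deriv (fun x => (G x).re) x = (G' x).re := by
    filter_upwards [hG'] with x hx hxm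
    exact (Complex.reCLM.hasFDerivAt.comp_hasDerivAt x (hx hxm)).deriv
  have him' : ∀ᵐ x, x ∈ uIcc a b → deriv (fun x => (G x).im) x = (G' x).im := by
    filter_upwards [hG'] with x hx hxm
    exact (Complex.imCLM.hasFDerivAt.comp_hasDerivAt x (hx hxm)).deriv
  set H : ℝ → ℂ := fun x => ((deriv (fun x => (G x).re) x : ℝ) : ℂ) +
    Complex.I * ((deriv (fun x => (G x).im) x : ℝ) : ℂ) with hH
  have i1 := hre.intervalIntegrable_deriv
  have i2 := him.intervalIntegrable_deriv
  have i1' : IntervalIntegrable (fun x => ((deriv (fun x => (G x).re) x : ℝ) : ℂ)) volume a b :=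
    ⟨i1.1.ofReal, i1.2.ofReal⟩
  have i2' : IntervalIntegrable (fun x => ((deriv (fun x => (G x).im) x : ℝ) : ℂ)) volume a b :=
    ⟨i2.1.ofReal, i2.2.ofReal⟩
  have hcongr : ∀ᵐ x, x ∈ uIoc a b → H x = G' x := by
    filter_upwards [hre', him'] with x h1 h2 hx
    have hx' := uIoc_subset_uIcc hx
    simp only [hH, h1 hx', h2 hx']
    rw [mul_comm]; exact Complex.re_add_im _
  have iH : IntervalIntegrable H volume a b := i1'.add (i2'.const_mul Complex.I)
  refine ⟨iH.congr_ae ((ae_restrict_iff' measurableSet_uIoc).2 hcongr), ?_⟩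
  rw [← intervalIntegral.integral_congr_ae hcongr,
    intervalIntegral.integral_add i1' (i2'.const_mul Complex.I),
    intervalIntegral.integral_const_mul, intervalIntegral.integral_ofReal,
    intervalIntegral.integral_ofReal, hre.integral_deriv_eq_sub, him.integral_deriv_eq_sub]
  apply Complex.ext <;> simp

/-! ### The initial value problems at `π / 2` -/

lemma pi_div_two_mem_Icc : π / 2 ∈ Icc 0 π := ⟨by positivity, by linarith [Real.pi_pos]⟩

lemma cosSqrt_sq_add (z : ℂ) (x : ℝ) : cosSqrt z x ^ 2 + z * sinSqrt z x ^ 2 = 1 := by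
  rcases eq_or_ne z 0 with rfl | hz
  · simp [cosSqrt_zero_left]
  obtain ⟨w, hw, -⟩ := exists_sq z
  have hw0 : w ≠ 0 := by rintro rfl; apply hz; rw [← hw]; simp
  rw [sinSqrt_of_sq hw hw0, cosSqrt_of_sq hw, ← hw, div_pow, mul_div_cancel₀ _ (pow_ne_zero 2 hw0),
    Complex.cos_sq_add_sin_sq]

lemma hasDerivAt_cosSqrt_const_sub (z : ℂ) (x t : ℝ) :
    HasDerivAt (fun t => cosSqrt z (x - t)) (z * sinSqrt z (x - t)) t := by
  have := (hasDerivAt_cosSqrt z (x - t)).comp_const_sub x t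
  exact this.congr_deriv (by ring)

lemma hasDerivAt_sinSqrt_const_sub (z : ℂ) (x t : ℝ) :
    HasDerivAt (fun t => sinSqrt z (x - t)) (-cosSqrt z (x - t)) t :=
  (hasDerivAt_sinSqrt z (x - t)).comp_const_sub x t

/-- The variation of constants formula. -/
lemma eq_of_hasDerivWithinAt {y y' f : ℝ → ℂ} {z : ℂ} (hf : ContinuousOn f (Icc 0 π))
    (hy : ∀ x ∈ Icc 0 π, HasDerivWithinAt y (y' x) (Icc 0 π) x)
    (hy' : ∀ x ∈ Icc 0 π, HasDerivWithinAt y' (f x - z * y x) (Icc 0 π) x) {x : ℝ}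
    (hx : x ∈ Icc 0 π) :
    y x = y (π / 2) * cosSqrt z (x - π / 2) + y' (π / 2) * sinSqrt z (x - π / 2) +
      ∫ t in (π / 2)..x, f t * sinSqrt z (x - t) := by
  have hs : Continuous fun t => sinSqrt z (x - t) := (continuous_sinSqrt z).comp (by fun_prop)
  -- The function of t is chosen so that its value at t = x is y x, while the terms with z and y'
  -- cancel in its derivative.
  have h := integral_eq_sub_of_hasDerivWithinAt_Icc
    (A := fun t => y t * cosSqrt z (x - t) + y' t * sinSqrt z (x - t))
    (A' := fun t => f t * sinSqrt z (x - t)) (fun t ht => ?_) (hf.mul hs.continuousOn)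
    pi_div_two_mem_Icc hx
  · rw [h]; simp
  · refine (((hy t ht).mul (hasDerivAt_cosSqrt_const_sub z x t).hasDerivWithinAt).add
      ((hy' t ht).mul (hasDerivAt_sinSqrt_const_sub z x t).hasDerivWithinAt)).congr_deriv ?_
    ring

/-- The addition formula moves x out of the integrand, so that x-derivatives reduce to the product
rule and the fundamental theorem. -/
lemma solC_eq {q : ℝ → ℂ} (hq : ContinuousOn q (Icc 0 π)) (z : ℂ) {x : ℝ} (hx : x ∈ Icc 0 π) :
    solC q x z = cosSqrt z (x - π / 2) +
      (sinSqrt z x * (∫ t in (π / 2)..x, q t * cosSqrt z t) -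
        cosSqrt z x * ∫ t in (π / 2)..x, q t * sinSqrt z t) := by
  have hsub : uIcc (π / 2) x ⊆ Icc 0 π := uIcc_subset_Icc pi_div_two_mem_Icc hx
  rw [solC, ← intervalIntegral.integral_const_mul, ← intervalIntegral.integral_const_mul,
    ← intervalIntegral.integral_sub]
  · congr 1
    refine intervalIntegral.integral_congr fun t _ => ?_
    simp only [sinSqrt_sub]; ring
  · exact (continuousOn_const.mul ((hq.mono hsub).mul
      (continuous_cosSqrt z).continuousOn)).intervalIntegrable
  · exact (continuousOn_const.mul ((hq.mono hsub).mul
      (continuous_sinSqrt z).continuousOn)).intervalIntegrable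

lemma exists_hasDerivWithinAt_solC {q : ℝ → ℂ} (hq : ContinuousOn q (Icc 0 π)) (z : ℂ) :
    ∃ C' : ℝ → ℂ,
      (∀ x ∈ Icc 0 π, HasDerivWithinAt (fun x => solC q x z) (C' x) (Icc 0 π) x) ∧
      ∀ x ∈ Icc 0 π, HasDerivWithinAt C' (q x - z * solC q x z) (Icc 0 π) x := by
  have hcs : ContinuousOn (fun t => q t * cosSqrt z t) (Icc 0 π) :=
    hq.mul (continuous_cosSqrt z).continuousOn
  have hsn : ContinuousOn (fun t => q t * sinSqrt z t) (Icc 0 π) :=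
    hq.mul (continuous_sinSqrt z).continuousOn
  refine ⟨fun x => -z * sinSqrt z (x - π / 2) +
      (cosSqrt z x * (∫ t in (π / 2)..x, q t * cosSqrt z t) +
        z * (sinSqrt z x * ∫ t in (π / 2)..x, q t * sinSqrt z t)), fun x hx => ?_, fun x hx => ?_⟩
  · refine HasDerivWithinAt.congr ?_ (fun t ht => solC_eq hq z ht) (solC_eq hq z hx)
    have h1 := ((hasDerivAt_cosSqrt z (x - π / 2)).comp_sub_const x (π / 2)).hasDerivWithinAt
      (s := Icc 0 π)
    have h2 := (hasDerivAt_sinSqrt z x).hasDerivWithinAt.mul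
      (hasDerivWithinAt_integral_Icc hcs pi_div_two_mem_Icc hx)
    have h3 := (hasDerivAt_cosSqrt z x).hasDerivWithinAt.mul
      (hasDerivWithinAt_integral_Icc hsn pi_div_two_mem_Icc hx)
    refine (h1.add (h2.sub h3)).congr_deriv ?_
    ring
  · have h1 := ((hasDerivAt_sinSqrt z (x - π / 2)).comp_sub_const x (π / 2)).hasDerivWithinAt
      (s := Icc 0 π)
    have h2 := (hasDerivAt_cosSqrt z x).hasDerivWithinAt.mul
      (hasDerivWithinAt_integral_Icc hcs pi_div_two_mem_Icc hx)
    have h3 := (hasDerivAt_sinSqrt z x).hasDerivWithinAt.mul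
      (hasDerivWithinAt_integral_Icc hsn pi_div_two_mem_Icc hx)
    refine ((h1.const_mul (-z)).add (h2.add (h3.const_mul z))).congr_deriv ?_
    rw [solC_eq hq z hx]
    linear_combination q x * cosSqrt_sq_add z x

/-- S is odd about π/2, so its two boundary values differ only in sign and factor out. -/
lemma charFun_eq (q : ℝ → ℂ) (z : ℂ) :
    charFun q z = sinSqrt z (π / 2) * (solC q 0 z + solC q π z) := by
  rw [charFun, solS, solS, show π - π / 2 = π / 2 by ring, zero_sub, sinSqrt_neg]
  ring

lemma solC_pi_div_two (q : ℝ → ℂ) (z : ℂ) : solC q (π / 2) z = 1 := by simp [solC]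

/-- With y(π/2) treated as a constant, a solution is y(π/2) C + y'(π/2) S. If y(π/2) = 0, the
boundary conditions force S to vanish at both ends; otherwise adding them eliminates S and leaves
C(0) + C(π) = 0. -/
theorem isEigenvalue_iff_charFun {q : ℝ → ℂ} (hq : ContinuousOn q (Icc 0 π)) (z : ℂ) :
    IsEigenvalue q z ↔ charFun q z = 0 := by
  rw [charFun_eq, mul_eq_zero]
  have e1 : π - π / 2 = π / 2 := by ring
  constructor
  · rintro ⟨y, y', hy, hy', hy0, hyπ, x, hx, hyx⟩
    have hrep : ∀ x ∈ Icc 0 π,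
        y x = y (π / 2) * solC q x z + y' (π / 2) * sinSqrt z (x - π / 2) := by
      intro x hx
      rw [eq_of_hasDerivWithinAt (f := fun t => q t * y (π / 2)) (hq.mul continuousOn_const) hy hy'
        hx, solC, mul_add, ← intervalIntegral.integral_const_mul]
      have : ∀ t, q t * y (π / 2) * sinSqrt z (x - t) = y (π / 2) * (q t * sinSqrt z (x - t)) :=
        fun t => by ring
      simp_rw [this]
      ring
    have h0 := hrep 0 (left_mem_Icc.2 Real.pi_pos.le)
    have hπ := hrep π (right_mem_Icc.2 Real.pi_pos.le)
    rw [hy0, zero_sub, sinSqrt_neg] at h0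
    rw [hyπ, e1] at hπ
    by_cases ha : y (π / 2) = 0
    · left
      rw [ha] at hπ
      have hb : y' (π / 2) ≠ 0 := by
        intro hb
        apply hyx
        rw [hrep x hx, ha, hb]; ring
      have : y' (π / 2) * sinSqrt z (π / 2) = 0 := by rw [hπ]; ring
      exact (mul_eq_zero.1 this).resolve_left hb
    · right
      have : y (π / 2) * (solC q 0 z + solC q π z) = 0 := by linear_combination -h0 - hπ
      exact (mul_eq_zero.1 this).resolve_left ha
  · intro h
    have hS : ∀ x, HasDerivAt (fun x => sinSqrt z (x - π / 2)) (cosSqrt z (x - π / 2)) x :=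
      fun x => (hasDerivAt_sinSqrt z (x - π / 2)).comp_sub_const x (π / 2)
    have hS' : ∀ x, HasDerivAt (fun x => cosSqrt z (x - π / 2))
        (-z * sinSqrt z (x - π / 2)) x :=
      fun x => (hasDerivAt_cosSqrt z (x - π / 2)).comp_sub_const x (π / 2)
    by_cases hs : sinSqrt z (π / 2) = 0
    · refine ⟨fun x => sinSqrt z (x - π / 2), fun x => cosSqrt z (x - π / 2),
        fun x _ => (hS x).hasDerivWithinAt, fun x _ => ?_, ?_, ?_, ?_⟩
      · refine (hS' x).hasDerivWithinAt.congr_deriv ?_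
        simp
      · simp [sinSqrt_neg, hs]
      · simp only [e1, hs]
      · by_contra! hcon
        -- S is not identically zero because its derivative at π/2 is 1.
        have h1 : HasDerivWithinAt (fun x => sinSqrt z (x - π / 2)) 0 (Icc 0 π) (π / 2) :=
          (hasDerivWithinAt_const _ _ (0 : ℂ)).congr hcon (hcon _ pi_div_two_mem_Icc)
        have h2 := (uniqueDiffOn_Icc Real.pi_pos _ pi_div_two_mem_Icc).eq_deriv _ h1
          (hS (π / 2)).hasDerivWithinAt
        simp at h2
    · have hF := h.resolve_left hs
      obtain ⟨C', hC, hC'⟩ := exists_hasDerivWithinAt_solC hq z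
      -- Chosen to make C + bS vanish at 0; it then vanishes at π because C(0) + C(π) = 0.
      set b := solC q 0 z / sinSqrt z (π / 2)
      have hb : b * sinSqrt z (π / 2) = solC q 0 z := div_mul_cancel₀ _ hs
      refine ⟨fun x => solC q x z + b * sinSqrt z (x - π / 2),
        fun x => C' x + b * cosSqrt z (x - π / 2),
        fun x hx => (hC x hx).add ((hS x).const_mul b).hasDerivWithinAt, fun x hx => ?_, ?_, ?_,
        π / 2, pi_div_two_mem_Icc, ?_⟩
      · refine ((hC' x hx).add ((hS' x).const_mul b).hasDerivWithinAt).congr_deriv ?_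
        simp only [solC_pi_div_two, sub_self, sinSqrt_zero_right]
        ring
      · simp only [zero_sub, sinSqrt_neg]
        linear_combination -hb
      · simp only [e1]
        linear_combination hb + hF
      · simp [solC_pi_div_two]

/-! ### The factor of the characteristic function with the eigenvalues of odd number -/

noncomputable section

/-- The characteristic function is the product of this function with `sin (√z π / 2) / √z`. -/
def oddCharFun (q : ℝ → ℂ) (z : ℂ) : ℂ := solC q 0 z + solC q π z

end

lemma differentiable_oddCharFun {q : ℝ → ℂ} (hq : ContinuousOn q (Icc 0 π)) :
    Differentiable ℂ (oddCharFun q) := by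
  have h : ∀ x ∈ Icc 0 π, Differentiable ℂ (solC q x) := fun x hx =>
    (differentiable_cosSqrt _).add (differentiable_integral_sinSqrt x
      (hq.mono (uIcc_subset_Icc pi_div_two_mem_Icc hx)))
  exact (h 0 (left_mem_Icc.2 Real.pi_pos.le)).add (h π (right_mem_Icc.2 Real.pi_pos.le))

lemma MemW12.continuousOn {q : ℝ → ℂ} (hq : MemW12 q) : ContinuousOn q (Icc 0 π) :=
  hq.2.1.continuousOn

/-- Two integrations by parts. The first is classical; in the second q' is only absolutely
continuous, so q'' exists almost everywhere and the Lebesgue version is used. -/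
lemma MemW12.mul_integral_sinSqrt {q : ℝ → ℂ} (hq : MemW12 q) :
    ∃ q'' : ℝ → ℂ, IntervalIntegrable q'' volume 0 π ∧ ∀ z : ℂ, ∀ b ∈ Icc 0 π,
      z * (∫ t in (π / 2)..b, q t * sinSqrt z (b - t)) =
        q b - q (π / 2) * cosSqrt z (b - π / 2)
          - derivWithin q (Icc 0 π) (π / 2) * sinSqrt z (b - π / 2)
          - ∫ t in (π / 2)..b, q'' t * sinSqrt z (b - t) := by
  set q' := derivWithin q (Icc 0 π) with hq'
  have hd : ∀ x ∈ Icc 0 π, HasDerivWithinAt q (q' x) (Icc 0 π) x := fun x hx =>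
    (hq.2.1 x hx).hasDerivWithinAt
  have hac : AbsolutelyContinuousOnInterval q' 0 π := hq.2.2.1
  have hq'c : ContinuousOn q' (Icc 0 π) := by
    have := hac.continuousOn; rwa [uIcc_of_le Real.pi_pos.le] at this
  -- Bounded variation gives differentiability within the interval almost everywhere; discarding the
  -- two endpoints makes it two-sided.
  have hae : ∀ᵐ x, x ∈ uIcc 0 π → HasDerivAt q' (deriv q' x) x := by
    filter_upwards [hac.boundedVariationOn.locallyBoundedVariationOn.ae_differentiableWithinAt_of_mem,
      Measure.ae_ne volume 0, Measure.ae_ne volume π] with x hx h0 hπ hxm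
    rw [uIcc_of_le Real.pi_pos.le] at hxm hx
    exact ((hx hxm).differentiableAt (Icc_mem_nhds (lt_of_le_of_ne hxm.1 (Ne.symm h0))
      (lt_of_le_of_ne hxm.2 hπ))).hasDerivAt
  refine ⟨deriv q', (hac.integral_eq_sub_of_ae_hasDerivAt hae).1, fun z b hb => ?_⟩
  have hsub : uIcc (π / 2) b ⊆ Icc 0 π := uIcc_subset_Icc pi_div_two_mem_Icc hb
  have hsub' : uIcc (π / 2) b ⊆ uIcc 0 π := by rwa [uIcc_of_le Real.pi_pos.le]
  have hc : Continuous fun t => cosSqrt z (b - t) := (continuous_cosSqrt z).comp (by fun_prop)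
  have hs : Continuous fun t => sinSqrt z (b - t) := (continuous_sinSqrt z).comp (by fun_prop)
  have i1 : IntervalIntegrable (fun t => q' t * cosSqrt z (b - t)) volume (π / 2) b :=
    ((hq'c.mono hsub).mul hc.continuousOn).intervalIntegrable
  have i2 : IntervalIntegrable (fun t => q t * sinSqrt z (b - t)) volume (π / 2) b :=
    ((hq.continuousOn.mono hsub).mul hs.continuousOn).intervalIntegrable
  have h1 := integral_eq_sub_of_hasDerivWithinAt_Icc (A := fun t => q t * cosSqrt z (b - t))
    (A' := fun t => q' t * cosSqrt z (b - t) + z * (q t * sinSqrt z (b - t)))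
    (fun t ht => ((hd t ht).mul (hasDerivAt_cosSqrt_const_sub z b t).hasDerivWithinAt).congr_deriv
      (by ring)) ((hq'c.mul hc.continuousOn).add
        (continuousOn_const.mul (hq.continuousOn.mul hs.continuousOn))) pi_div_two_mem_Icc hb
  rw [intervalIntegral.integral_add i1 (i2.const_mul z),
    intervalIntegral.integral_const_mul] at h1
  have hsac : AbsolutelyContinuousOnInterval (fun t => sinSqrt z (b - t)) (π / 2) b := by
    refine ContDiffOn.absolutelyContinuousOnInterval (ContDiff.contDiffOn ?_)
    rw [contDiff_one_iff_deriv]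
    refine ⟨fun t => (hasDerivAt_sinSqrt_const_sub z b t).differentiableAt, ?_⟩
    have : deriv (fun t => sinSqrt z (b - t)) = fun t => -cosSqrt z (b - t) :=
      funext fun t => (hasDerivAt_sinSqrt_const_sub z b t).deriv
    rw [this]; exact hc.neg
  obtain ⟨i3, h2⟩ := ((hac.mono hsub').smul hsac).integral_eq_sub_of_ae_hasDerivAt
    (G' := fun t => deriv q' t * sinSqrt z (b - t) - q' t * cosSqrt z (b - t)) (by
      filter_upwards [hae] with t ht htm
      exact ((ht (hsub' htm)).mul (hasDerivAt_sinSqrt_const_sub z b t)).congr_deriv (by ring))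
  have i4 : IntervalIntegrable (fun t => deriv q' t * sinSqrt z (b - t)) volume (π / 2) b := by
    have := i3.add i1
    refine this.congr_ae (Filter.Eventually.of_forall fun t => ?_)
    simp
  rw [intervalIntegral.integral_sub i4 i1] at h2
  simp only [sub_self, cosSqrt_zero_right, sinSqrt_zero_right, Pi.smul_apply', smul_eq_mul,
    mul_one, mul_zero] at h1 h2
  linear_combination h1 + h2

/-- The asymptotics of the characteristic function; here `w = √z`. -/
lemma exists_norm_oddCharFun_sub_le {q : ℝ → ℂ} (hq : MemW12 q) (hq0 : q 0 + q π = 0) :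
    ∃ K : ℝ, 0 ≤ K ∧ ∀ w : ℂ, w ≠ 0 →
      ‖oddCharFun q (w ^ 2) - 2 * cosSqrt (w ^ 2) (π / 2) * (1 - q (π / 2) / w ^ 2)‖ ≤
        K / ‖w‖ ^ 3 * Real.exp (|w.im| * (π / 2)) := by
  obtain ⟨q'', hint, h⟩ := hq.mul_integral_sinSqrt
  have hp := Real.pi_pos
  have hsub : ∀ b ∈ Icc 0 π, uIcc (π / 2) b ⊆ uIcc 0 π := fun b hb => by
    rw [uIcc_of_le hp.le]; exact uIcc_subset_Icc pi_div_two_mem_Icc hb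
  refine ⟨|∫ t in (π / 2)..0, ‖q'' t‖| + |∫ t in (π / 2)..π, ‖q'' t‖|, by positivity,
    fun w hw => ?_⟩
  have hw2 : w ^ 2 ≠ 0 := pow_ne_zero 2 hw
  have h0m : (0 : ℝ) ∈ Icc 0 π := left_mem_Icc.2 hp.le
  have hπm : π ∈ Icc 0 π := right_mem_Icc.2 hp.le
  have key : ∀ b ∈ Icc 0 π, |b - π / 2| ≤ π / 2 →
      ‖∫ t in (π / 2)..b, q'' t * sinSqrt (w ^ 2) (b - t)‖ ≤
        |∫ t in (π / 2)..b, ‖q'' t‖| * (Real.exp (|w.im| * (π / 2)) / ‖w‖) := by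
    intro b hb hbd
    have hi := (hint.mono_set (hsub b hb)).norm
    have h1 := intervalIntegral.norm_integral_le_abs_of_norm_le (a := π / 2) (b := b)
      (f := fun t => q'' t * sinSqrt (w ^ 2) (b - t)) (μ := volume)
      (g := fun t => ‖q'' t‖ * (Real.exp (|w.im| * (π / 2)) / ‖w‖)) ?_ (hi.mul_const _)
    · refine h1.trans_eq ?_
      rw [intervalIntegral.integral_mul_const, abs_mul]
      congr 1
      exact abs_of_nonneg (by positivity)
    · refine (ae_restrict_iff' measurableSet_uIoc).2 (Filter.Eventually.of_forall fun t ht => ?_)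
      rw [norm_mul]
      gcongr
      refine norm_sinSqrt_le rfl hw ?_
      have ht' := uIoc_subset_uIcc ht
      have := abs_sub_left_of_mem_uIcc ht'
      rw [abs_sub_comm]
      rw [uIcc_comm] at ht'
      have h3 := abs_sub_left_of_mem_uIcc ht'
      rw [abs_sub_comm b] at hbd
      exact h3.trans hbd
  have k0 := key 0 h0m (by rw [zero_sub, abs_neg, abs_of_pos (by positivity)])
  have kπ := key π hπm (by rw [show π - π / 2 = π / 2 by ring, abs_of_pos (by positivity)])
  have e0 := h (w ^ 2) 0 h0m
  have eπ := h (w ^ 2) π hπm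
  -- Adding the formulas for b = 0 and b = π, the terms with q'(π/2) cancel by oddness of the sine
  -- and q(0) + q(π) = 0 removes the endpoint values. Only the integrals of q'' remain.
  have e : oddCharFun q (w ^ 2) - 2 * cosSqrt (w ^ 2) (π / 2) * (1 - q (π / 2) / w ^ 2) =
      -((∫ t in (π / 2)..0, q'' t * sinSqrt (w ^ 2) (0 - t)) +
        ∫ t in (π / 2)..π, q'' t * sinSqrt (w ^ 2) (π - t)) / w ^ 2 := by
    rw [show π - π / 2 = π / 2 by ring] at eπ
    rw [show (0 : ℝ) - π / 2 = -(π / 2) by ring, cosSqrt_neg, sinSqrt_neg] at e0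
    rw [oddCharFun, solC, solC, show π - π / 2 = π / 2 by ring,
      show (0 : ℝ) - π / 2 = -(π / 2) by ring, cosSqrt_neg, eq_div_iff hw2]
    have : q (π / 2) / w ^ 2 * w ^ 2 = q (π / 2) := div_mul_cancel₀ _ hw2
    linear_combination e0 + eπ + hq0 + 2 * cosSqrt (w ^ 2) (π / 2) * this
  rw [e, norm_div, norm_neg, norm_pow]
  have hn : 0 < ‖w‖ := norm_pos_iff.2 hw
  calc _ ≤ (|∫ t in (π / 2)..0, ‖q'' t‖| * (Real.exp (|w.im| * (π / 2)) / ‖w‖) +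
        |∫ t in (π / 2)..π, ‖q'' t‖| * (Real.exp (|w.im| * (π / 2)) / ‖w‖)) / ‖w‖ ^ 2 := by
        gcongr
        exact (norm_add_le _ _).trans (add_le_add k0 kπ)
    _ = _ := by field_simp

/-- Where the function `oddCharFun` is not dominated by its leading term, `√z` is close to an odd
integer. -/
lemma exists_norm_sub_odd_le {q : ℝ → ℂ} (hq : MemW12 q) (hq0 : q 0 + q π = 0) :
    ∃ K W : ℝ, 0 ≤ K ∧ 1 ≤ W ∧ ∀ w : ℂ, W ≤ ‖w‖ →
      ‖2 * cosSqrt (w ^ 2) (π / 2)‖ ≤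
        ‖oddCharFun q (w ^ 2) - 2 * cosSqrt (w ^ 2) (π / 2)‖ →
      ∃ k : ℤ, ‖w - (2 * k + 1)‖ ≤ K / ‖w‖ ^ 3 := by
  obtain ⟨K, hK, h⟩ := exists_norm_oddCharFun_sub_le hq hq0
  -- The threshold ensures |q(π/2)/w²| ≤ 1/2 and K/|w|³ ≤ 1/4, the latter being the smallness
  -- required by the sine lemma.
  refine ⟨2 * K, 1 + 2 * ‖q (π / 2)‖ + 4 * K, by positivity, ?_, fun w hw hle => ?_⟩
  · linarith [norm_nonneg (q (π / 2))]
  have hq0 := norm_nonneg (q (π / 2))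
  have hw1 : 1 ≤ ‖w‖ := by linarith
  have hwp : 0 < ‖w‖ := by linarith
  have hw0 : w ≠ 0 := norm_pos_iff.1 hwp
  have h1 := h w hw0
  have hwsq : ‖w‖ ≤ ‖w‖ ^ 2 := by nlinarith
  have hwcu : ‖w‖ ≤ ‖w‖ ^ 3 := by nlinarith
  have e : cosSqrt (w ^ 2) (π / 2) = Complex.sin (w * (π / 2 : ℝ) + π / 2) := by
    rw [cosSqrt_of_sq rfl, Complex.sin_add_pi_div_two]
  set c := cosSqrt (w ^ 2) (π / 2) with hc
  have h2 : ‖q (π / 2) / w ^ 2‖ ≤ 1 / 2 := by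
    rw [norm_div, norm_pow, div_le_iff₀ (by positivity)]; linarith
  -- The q(π/2)/w² term takes up at most half of |2c| and is absorbed on the left, leaving |c|
  -- bounded by the remainder alone.
  have h3 : ‖2 * c‖ ≤ ‖2 * c‖ * (1 / 2) + K / ‖w‖ ^ 3 * Real.exp (|w.im| * (π / 2)) := by
    refine hle.trans ?_
    have : oddCharFun q (w ^ 2) - 2 * c =
        -(2 * c * (q (π / 2) / w ^ 2)) + (oddCharFun q (w ^ 2) - 2 * c * (1 - q (π / 2) / w ^ 2)) := by
      ring
    rw [this]
    refine (norm_add_le _ _).trans (add_le_add ?_ h1)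
    rw [norm_neg, norm_mul]
    gcongr
  rw [norm_mul, Complex.norm_two] at h3
  have him : |(w * (π / 2 : ℝ) + π / 2).im| = |w.im| * (π / 2) := by
    have : (w * (π / 2 : ℝ) + π / 2 : ℂ) = w * (π / 2 : ℝ) + (π / 2 : ℝ) := by push_cast; ring
    rw [this, Complex.add_im, Complex.im_mul_ofReal, Complex.ofReal_im, add_zero, abs_mul,
      abs_of_pos (by positivity : (0 : ℝ) < π / 2)]
  obtain ⟨k, hk⟩ := exists_int_norm_sub_le_of_norm_sin_le (w := w * (π / 2 : ℝ) + π / 2)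
    (ε := K / ‖w‖ ^ 3) (by rw [div_le_iff₀ (by positivity)]; linarith)
    (by rw [him, ← e]; linarith)
  refine ⟨k - 1, ?_⟩
  have e2 : (w * (π / 2 : ℝ) + π / 2 - k * π : ℂ) =
      (w - (2 * ((k - 1 : ℤ) : ℂ) + 1)) * (π / 2 : ℝ) := by push_cast; ring
  have hp : (0 : ℝ) < π / 2 := by positivity
  rw [e2, norm_mul, Complex.norm_real, Real.norm_of_nonneg hp.le] at hk
  have : π * (K / ‖w‖ ^ 3) = (2 * K / ‖w‖ ^ 3) * (π / 2) := by ring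
  rw [this] at hk
  exact le_of_mul_le_mul_right hk hp

/-! ### Zeros of `sin (√z π / 2) / √z` and of `cos (√z π / 2)` -/

lemma exists_eq_of_sinSqrt_eq_zero {w : ℂ} (hw : w ≠ 0) (h : sinSqrt (w ^ 2) (π / 2) = 0) :
    ∃ k : ℤ, w = 2 * k := by
  rw [sinSqrt_of_sq rfl hw, div_eq_zero_iff, or_iff_left hw, Complex.sin_eq_zero_iff] at h
  obtain ⟨k, hk⟩ := h
  refine ⟨k, ?_⟩
  have hp : (π : ℂ) ≠ 0 := Complex.ofReal_ne_zero.2 Real.pi_ne_zero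
  push_cast at hk
  apply mul_right_cancel₀ hp
  linear_combination 2 * hk

lemma exists_eq_of_cosSqrt_eq_zero {w : ℂ} (h : cosSqrt (w ^ 2) (π / 2) = 0) :
    ∃ k : ℤ, w = 2 * k + 1 := by
  rw [cosSqrt_of_sq rfl, Complex.cos_eq_zero_iff] at h
  obtain ⟨k, hk⟩ := h
  refine ⟨k, ?_⟩
  have hp : (π : ℂ) ≠ 0 := Complex.ofReal_ne_zero.2 Real.pi_ne_zero
  push_cast at hk
  apply mul_right_cancel₀ hp
  linear_combination 2 * hk

lemma sinSqrt_eq_zero_iff (z : ℂ) :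
    sinSqrt z (π / 2) = 0 ↔ ∃ n : ℕ, (1 ≤ n ∧ Even n) ∧ (n : ℂ) ^ 2 = z := by
  constructor
  · intro h
    obtain ⟨w, rfl, -⟩ := exists_sq z
    have hw : w ≠ 0 := by
      rintro rfl
      rw [zero_pow two_ne_zero, sinSqrt_zero_left] at h
      exact (Complex.ofReal_ne_zero.2 (by positivity : (π / 2 : ℝ) ≠ 0)) h
    obtain ⟨k, rfl⟩ := exists_eq_of_sinSqrt_eq_zero hw h
    have hk : k ≠ 0 := by rintro rfl; simp at hw
    refine ⟨2 * k.natAbs, ⟨by omega, even_two_mul _⟩, ?_⟩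
    have : ((k.natAbs : ℂ)) ^ 2 = (k : ℂ) ^ 2 := by
      have h1 : ((k.natAbs : ℤ)) ^ 2 = k ^ 2 := Int.natAbs_sq k
      have h2 := congrArg (Int.cast : ℤ → ℂ) h1
      rwa [Int.cast_pow, Int.cast_natCast, Int.cast_pow] at h2
    push_cast
    linear_combination 4 * this
  · rintro ⟨n, ⟨hn, k, rfl⟩, rfl⟩
    have hw : ((k + k : ℕ) : ℂ) ≠ 0 := Nat.cast_ne_zero.2 (by omega)
    rw [sinSqrt_of_sq rfl hw, div_eq_zero_iff]
    left
    rw [Complex.sin_eq_zero_iff]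
    exact ⟨k, by push_cast; ring⟩

lemma cosSqrt_eq_zero_iff (z : ℂ) :
    cosSqrt z (π / 2) = 0 ↔ ∃ k : ℕ, ((2 * k + 1 : ℕ) : ℂ) ^ 2 = z := by
  constructor
  · intro h
    obtain ⟨w, rfl, -⟩ := exists_sq z
    obtain ⟨k, rfl⟩ := exists_eq_of_cosSqrt_eq_zero h
    rcases le_or_gt 0 k with hk | hk
    · lift k to ℕ using hk
      exact ⟨k, by push_cast; ring⟩
    · obtain ⟨j, hj⟩ := Int.eq_ofNat_of_zero_le (by omega : 0 ≤ -k - 1)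
      refine ⟨j, ?_⟩
      have : (k : ℂ) = -j - 1 := by
        have : k = -j - 1 := by omega
        rw [this]; push_cast; ring
      rw [this]; push_cast; ring
  · rintro ⟨k, rfl⟩
    rw [cosSqrt_of_sq rfl, Complex.cos_eq_zero_iff]
    exact ⟨k, by push_cast; ring⟩

/-- At a multiple zero the chain rule would make v ↦ sin(vπ/2) vanish together with its derivative,
against sin² + cos² = 1. Here v ≠ 0, as the value at z = 0 is π/2. -/
lemma analyticOrderAt_sinSqrt {z : ℂ} (h : sinSqrt z (π / 2) = 0) :
    analyticOrderAt (fun z => sinSqrt z (π / 2)) z = 1 := by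
  have hd := differentiable_sinSqrt (π / 2)
  refine (hd.analyticAt z).analyticOrderAt_eq_one_of_zero_deriv_ne_zero h fun h0 => ?_
  obtain ⟨w, rfl, -⟩ := exists_sq z
  have hw : w ≠ 0 := by
    rintro rfl
    rw [zero_pow two_ne_zero, sinSqrt_zero_left] at h
    exact (Complex.ofReal_ne_zero.2 (by positivity : (π / 2 : ℝ) ≠ 0)) h
  have h1 : HasDerivAt (fun v : ℂ => sinSqrt (v ^ 2) (π / 2) * v) (0 * (2 * w) * w + 0) w := by
    have := ((hd (w ^ 2)).hasDerivAt.comp w (hasDerivAt_pow 2 w)).mul (hasDerivAt_id w)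
    rw [h0] at this
    refine this.congr_deriv ?_
    simp [h]
  have h2 : HasDerivAt (fun v : ℂ => sinSqrt (v ^ 2) (π / 2) * v)
      (Complex.cos (w * (π / 2 : ℝ)) * (π / 2 : ℝ)) w := by
    have := ((hasDerivAt_id w).mul_const ((π / 2 : ℝ) : ℂ)).csin
    refine (this.congr_of_eventuallyEq ?_).congr_deriv (by simp)
    filter_upwards [isOpen_ne.mem_nhds hw] with v hv
    rw [sinSqrt_of_sq rfl hv, div_mul_cancel₀ _ hv]; rfl
  have h3 := h1.unique h2
  rw [sinSqrt_of_sq rfl hw, div_eq_zero_iff, or_iff_left hw] at h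
  have h4 := Complex.sin_sq_add_cos_sq (w * (π / 2 : ℝ))
  have hp : ((π / 2 : ℝ) : ℂ) ≠ 0 := Complex.ofReal_ne_zero.2 (by positivity)
  have h5 : Complex.cos (w * (π / 2 : ℝ)) = 0 := by
    have : Complex.cos (w * (π / 2 : ℝ)) * (π / 2 : ℝ) = 0 := by rw [← h3]; ring
    exact (mul_eq_zero.1 this).resolve_right hp
  rw [h, h5] at h4
  simp at h4

lemma analyticOrderAt_two_mul_cosSqrt {z : ℂ} (h : cosSqrt z (π / 2) = 0) :
    analyticOrderAt (fun z => 2 * cosSqrt z (π / 2)) z = 1 := by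
  have hd : Differentiable ℂ fun z => 2 * cosSqrt z (π / 2) :=
    (differentiable_cosSqrt (π / 2)).const_mul 2
  refine (hd.analyticAt z).analyticOrderAt_eq_one_of_zero_deriv_ne_zero (by simp [h]) fun h0 => ?_
  obtain ⟨w, rfl, -⟩ := exists_sq z
  have h1 : HasDerivAt (fun v : ℂ => 2 * cosSqrt (v ^ 2) (π / 2)) 0 w := by
    have := (hd (w ^ 2)).hasDerivAt.comp w (hasDerivAt_pow 2 w)
    rw [h0] at this
    exact this.congr_deriv (by simp)
  have h2 : HasDerivAt (fun v : ℂ => 2 * cosSqrt (v ^ 2) (π / 2))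
      (2 * (-Complex.sin (w * (π / 2 : ℝ)) * (π / 2 : ℝ))) w := by
    have := (((hasDerivAt_id w).mul_const ((π / 2 : ℝ) : ℂ)).ccos).const_mul 2
    refine (this.congr_of_eventuallyEq ?_).congr_deriv (by simp)
    refine Filter.Eventually.of_forall fun v => ?_
    simp only [cosSqrt_of_sq rfl, id]
  have h3 := h1.unique h2
  rw [cosSqrt_of_sq rfl] at h
  have h4 := Complex.sin_sq_add_cos_sq (w * (π / 2 : ℝ))
  have hp : ((π / 2 : ℝ) : ℂ) ≠ 0 := Complex.ofReal_ne_zero.2 (by positivity)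
  have h5 : Complex.sin (w * (π / 2 : ℝ)) = 0 := by
    have : Complex.sin (w * (π / 2 : ℝ)) * (π / 2 : ℝ) = 0 := by linear_combination h3 / 2
    exact (mul_eq_zero.1 this).resolve_right hp
  rw [h, h5] at h4
  simp at h4

lemma natCast_sq_injective : Function.Injective fun n : ℕ => (n : ℂ) ^ 2 := fun a b h => by
  simp only at h
  have : a ^ 2 = b ^ 2 := by exact_mod_cast h
  exact Nat.pow_left_injective two_ne_zero this

lemma encard_even_sq_eq (z : ℂ) : {n : ℕ | (1 ≤ n ∧ Even n) ∧ (n : ℂ) ^ 2 = z}.encard =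
    analyticOrderAt (fun z => sinSqrt z (π / 2)) z := by
  by_cases h : sinSqrt z (π / 2) = 0
  · rw [analyticOrderAt_sinSqrt h]
    obtain ⟨n, hn, hnz⟩ := (sinSqrt_eq_zero_iff z).1 h
    rw [Set.encard_eq_one]
    refine ⟨n, Set.eq_singleton_iff_unique_mem.2 ⟨⟨hn, hnz⟩, fun k hk => ?_⟩⟩
    exact natCast_sq_injective (hk.2.trans hnz.symm)
  · rw [((differentiable_sinSqrt (π / 2)).analyticAt z).analyticOrderAt_eq_zero.2 h,
      Set.encard_eq_zero]
    refine Set.eq_empty_of_forall_notMem fun n hn => h ((sinSqrt_eq_zero_iff z).2 ⟨n, hn⟩)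

/-! ### The numbering of the eigenvalues -/

lemma eq_of_norm_sub_le_one {a b : ℤ} (h : ‖(a : ℂ) - b‖ ≤ 1) (h2 : Even (a - b)) : a = b := by
  have h1 : |a - b| ≤ 1 := by
    have e : (a : ℂ) - b = ((a - b : ℤ) : ℂ) := by push_cast; ring
    rw [e, Complex.norm_intCast] at h
    exact_mod_cast h
  obtain ⟨c, hc⟩ := h2
  rw [abs_le] at h1
  omega

/-- Rouché's theorem against 2cos(√z π/2) on |√z| = 2K, as far as possible from the odd integers.
The comparison function has the K simple zeros 1², 3², …, (2K-1)² inside. -/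
lemma exists_card_zeros_oddCharFun {q : ℝ → ℂ} (hq : MemW12 q) (hq0 : q 0 + q π = 0) :
    ∃ N : ℕ, ∀ K, N ≤ K → ∃ S : Multiset ℂ,
      (∀ s ∈ S, s ∈ Metric.ball (0 : ℂ) (4 * (K : ℝ) ^ 2)) ∧
      (∀ z ∈ Metric.ball (0 : ℂ) (4 * (K : ℝ) ^ 2),
        analyticOrderAt (oddCharFun q) z = S.count z) ∧ Multiset.card S = K := by
  obtain ⟨C, W, hC, hW, h⟩ := exists_norm_sub_odd_le hq hq0
  refine ⟨⌈W + C⌉₊ + 1, fun K hK => ?_⟩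
  have hKr : W + C + 1 ≤ K := by
    have := Nat.le_ceil (W + C)
    have h2 : ((⌈W + C⌉₊ + 1 : ℕ) : ℝ) ≤ K := by exact_mod_cast hK
    push_cast at h2; linarith
  have hcirc : ∀ z ∈ Metric.sphere (0 : ℂ) (4 * (K : ℝ) ^ 2),
      ‖oddCharFun q z - 2 * cosSqrt z (π / 2)‖ < ‖2 * cosSqrt z (π / 2)‖ := by
    intro z hz
    by_contra! hcon
    obtain ⟨w, rfl, -⟩ := exists_sq z
    have hw : ‖w‖ = 2 * K := by
      rw [mem_sphere_zero_iff_norm, norm_pow] at hz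
      refine (sq_eq_sq₀ (norm_nonneg _) (by positivity)).1 ?_
      rw [hz]; ring
    obtain ⟨k, hk⟩ := h w (by rw [hw]; linarith) hcon
    have h1 : C / ‖w‖ ^ 3 < 1 := by
      have : ‖w‖ ≤ ‖w‖ ^ 3 := le_self_pow₀ (by rw [hw]; linarith) (by norm_num)
      rw [div_lt_one (by rw [hw]; have : (0 : ℝ) < K := by linarith
                         positivity)]
      rw [hw] at this ⊢; linarith
    have h2 := (abs_norm_sub_norm_le w (2 * k + 1)).trans (hk.trans h1.le)
    have h3 := ((abs_norm_sub_norm_le w (2 * k + 1)).trans hk).trans_lt h1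
    have e : (2 * k + 1 : ℂ) = ((2 * k + 1 : ℤ) : ℂ) := by push_cast; ring
    rw [hw, e, Complex.norm_intCast] at h3
    -- An even and an odd integer cannot be at distance less than 1.
    have h4 : |(2 * K : ℤ) - (|2 * k + 1|)| < 1 := by exact_mod_cast h3
    rw [Int.abs_lt_one_iff] at h4
    rcases abs_cases (2 * k + 1) with ⟨h5, -⟩ | ⟨h5, -⟩ <;> omega
  have hKpos : (0 : ℝ) < K := by linarith
  obtain ⟨S, S₀, hS, hS₀, hSo, hS₀o, hcard⟩ := exists_zeros_card_eq_of_norm_sub_lt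
    (differentiable_oddCharFun hq.continuousOn) ((differentiable_cosSqrt (π / 2)).const_mul 2)
    (by positivity) hcirc
  refine ⟨S, hS, hSo, hcard.trans ?_⟩
  classical
  have hfin : S₀.toFinset = (Finset.range K).image fun k : ℕ => ((2 * k + 1 : ℕ) : ℂ) ^ 2 := by
    ext z
    rw [Multiset.mem_toFinset, Finset.mem_image]
    constructor
    · intro hz
      have h0 : analyticOrderAt (fun z => 2 * cosSqrt z (π / 2)) z ≠ 0 := by
        rw [hS₀o z (hS₀ z hz)]
        exact_mod_cast (Multiset.count_pos.2 hz).ne'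
      have h1 := apply_eq_zero_of_analyticOrderAt_ne_zero h0
      obtain ⟨k, rfl⟩ := (cosSqrt_eq_zero_iff z).1 (by simpa using h1)
      refine ⟨k, Finset.mem_range.2 ?_, rfl⟩
      have h2 := hS₀ _ hz
      rw [mem_ball_zero_iff, norm_pow, Complex.norm_natCast] at h2
      have h3 : (2 * k + 1) ^ 2 < 4 * K ^ 2 := by exact_mod_cast h2
      by_contra! hcon
      nlinarith
    · rintro ⟨k, hk, rfl⟩
      have hk' := Finset.mem_range.1 hk
      have hb : ((2 * k + 1 : ℕ) : ℂ) ^ 2 ∈ Metric.ball (0 : ℂ) (4 * (K : ℝ) ^ 2) := by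
        rw [mem_ball_zero_iff, norm_pow, Complex.norm_natCast]
        have : (2 * k + 1) ^ 2 < 4 * K ^ 2 := by nlinarith
        exact_mod_cast this
      have h1 := hS₀o _ hb
      rw [analyticOrderAt_two_mul_cosSqrt ((cosSqrt_eq_zero_iff _).2 ⟨k, rfl⟩)] at h1
      rw [← Multiset.count_pos]
      have : 1 = Multiset.count (((2 * k + 1 : ℕ) : ℂ) ^ 2) S₀ := by exact_mod_cast h1
      omega
  have hnodup : S₀.Nodup := by
    rw [Multiset.nodup_iff_count_le_one]
    intro z
    by_cases hz : z ∈ S₀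
    · have h1 := hS₀o z (hS₀ z hz)
      have h0 : analyticOrderAt (fun z => 2 * cosSqrt z (π / 2)) z ≠ 0 := by
        rw [h1]
        exact_mod_cast (Multiset.count_pos.2 hz).ne'
      have h2 := apply_eq_zero_of_analyticOrderAt_ne_zero h0
      rw [analyticOrderAt_two_mul_cosSqrt (by simpa using h2)] at h1
      have : 1 = Multiset.count z S₀ := by exact_mod_cast h1
      omega
    · rw [Multiset.count_eq_zero.2 hz]; omega
  rw [← Multiset.toFinset_card_of_nodup hnodup, hfin, Finset.card_image_of_injective,
    Finset.card_range]
  intro a b hab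
  have := natCast_sq_injective hab
  omega

lemma charFun_eq_mul (q : ℝ → ℂ) :
    charFun q = (fun z => sinSqrt z (π / 2)) * oddCharFun q := funext (charFun_eq q)

/-- Even indices receive the zeros of the sine factor, and 2k+1 receives the k-th zero of the other
factor. For large k its root lies in the annulus 2k ≤ |w| < 2k+2, which identifies the nearby odd
integer as 2k+1. -/
theorem exists_isNumbering {q : ℝ → ℂ} (hq : MemW12 q) (hq0 : q 0 + q π = 0) :
    ∃ lam : ℕ → ℂ, IsNumbering q lam := by
  obtain ⟨N, hN⟩ := exists_card_zeros_oddCharFun hq hq0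
  choose S hball hcount hcard using hN
  classical
  obtain ⟨μ, hμ, hμb⟩ := exists_enumeration_zeros (f := oddCharFun q)
    (R := fun K : ℕ => 4 * (K : ℝ) ^ 2) (N := N)
    (S := fun K => if h : N ≤ K then S K h else 0)
    (fun a b hab => by
      have : (a : ℝ) ≤ b := by exact_mod_cast hab
      simp only; gcongr)
    (Filter.Tendsto.const_mul_atTop (by norm_num)
      ((Filter.tendsto_pow_atTop two_ne_zero).comp tendsto_natCast_atTop_atTop))
    (fun K hK => by simpa only [dif_pos hK] using hball K hK)
    (fun K hK => by simpa only [dif_pos hK] using hcount K hK)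
    (fun K hK => by simpa only [dif_pos hK] using hcard K hK)
  have hF := differentiable_oddCharFun hq.continuousOn
  have hs := differentiable_sinSqrt (π / 2)
  have hcd : Differentiable ℂ (charFun q) := by rw [charFun_eq_mul]; exact hs.mul hF
  set lam : ℕ → ℂ := fun n => if Even n then (n : ℂ) ^ 2 else μ (n / 2) with hlam
  have heven : ∀ n, Even n → lam n = (n : ℂ) ^ 2 := fun n hn => if_pos hn
  have hodd : ∀ k, lam (2 * k + 1) = μ k := fun k => by
    have h1 : ¬ Even (2 * k + 1) := by simp
    simp only [hlam, if_neg h1]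
    congr 1; omega
  have hmult : ∀ z, {n : ℕ | 1 ≤ n ∧ lam n = z}.encard = analyticOrderAt (charFun q) z := by
    intro z
    rw [charFun_eq_mul, analyticOrderAt_mul (hs.analyticAt z) (hF.analyticAt z),
      ← encard_even_sq_eq, ← hμ z]
    have hinj : Function.Injective fun k : ℕ => 2 * k + 1 := fun a b h => by
      simp only at h; omega
    rw [← hinj.encard_image {k | μ k = z}, ← Set.encard_union_eq]
    · congr 1
      ext n
      simp only [mem_ofPred_eq, mem_union, mem_image]
      rcases Nat.even_or_odd n with hn | hn
      · rw [heven n hn]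
        constructor
        · rintro ⟨h1, h2⟩; exact Or.inl ⟨⟨h1, hn⟩, h2⟩
        · rintro (⟨⟨h1, -⟩, h2⟩ | ⟨k, -, rfl⟩)
          · exact ⟨h1, h2⟩
          · simp at hn
      · obtain ⟨k, rfl⟩ := hn
        rw [hodd]
        constructor
        · rintro ⟨-, h2⟩; exact Or.inr ⟨k, h2, rfl⟩
        · rintro (⟨⟨-, h1⟩, -⟩ | ⟨j, hj, hjk⟩)
          · simp at h1
          · obtain rfl : j = k := by omega
            exact ⟨by omega, hj⟩
    · rw [Set.disjoint_left]
      rintro n ⟨⟨-, h1⟩, -⟩ ⟨k, -, rfl⟩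
      simp at h1
  refine ⟨lam, ⟨fun z => ?_, hmult, fun n _ hn => heven n hn, ?_⟩⟩
  · rw [isEigenvalue_iff_charFun hq.continuousOn, ← (hcd.analyticAt z).analyticOrderAt_ne_zero,
      ← hmult, Set.encard_ne_zero]
    rfl
  · choose r hr hre using fun k => exists_sq (μ k)
    set ρ : ℕ → ℂ := fun n => if Even n then (n : ℂ) else r (n / 2) with hρ
    have hρe : ∀ n, Even n → ρ n = n := fun n hn => if_pos hn
    have hρo : ∀ k, ρ (2 * k + 1) = r k := fun k => by
      have h1 : ¬ Even (2 * k + 1) := by simp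
      simp only [hρ, if_neg h1]
      congr 1; omega
    refine ⟨fun n => n * (ρ n - n), ?_, fun n hn => ?_⟩
    · obtain ⟨C, W, hC, hW, h⟩ := exists_norm_sub_odd_le hq hq0
      -- It suffices that |ϰ_n| ≤ 8C/n for large n; the actual order n⁻² of ϰ_n is more than needed.
      have hsum : Summable fun n : ℕ => (8 * C) ^ 2 * (1 / (n : ℝ) ^ 2) :=
        (Real.summable_one_div_nat_pow.2 one_lt_two).mul_left _
      refine Summable.of_norm_bounded_eventually_nat hsum ?_
      filter_upwards [Filter.eventually_ge_atTop (2 * (N + ⌈W + C⌉₊ + 1))] with n hn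
      rw [norm_pow, norm_norm]
      rcases Nat.even_or_odd n with hne | ⟨k, rfl⟩
      · rw [hρe n hne]; simp; positivity
      · have hkN : N ≤ k := by omega
        have hkr : W + C + 1 ≤ k := by
          have h1 := Nat.le_ceil (W + C)
          have h2 : ((⌈W + C⌉₊ + 1 : ℕ) : ℝ) ≤ k := by exact_mod_cast (by omega)
          push_cast at h2; linarith
        rw [hρo]
        set w := r k
        obtain ⟨h1, h2⟩ := hμb k hkN
        rw [mem_ball_zero_iff, ← hr k, norm_pow] at h1 h2
        have hw1 : 2 * (k : ℝ) ≤ ‖w‖ := by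
          refine le_of_sq_le_sq ?_ (norm_nonneg _)
          push Not at h2; linarith
        have hw2 : ‖w‖ < 2 * k + 2 := by
          refine lt_of_pow_lt_pow_left₀ 2 (by positivity) ?_
          push_cast at h1; linarith
        have hF0 : oddCharFun q (w ^ 2) = 0 := by
          rw [hr k]
          refine apply_eq_zero_of_analyticOrderAt_ne_zero ?_
          rw [← hμ, Set.encard_ne_zero]
          exact ⟨k, rfl⟩
        obtain ⟨j, hj⟩ := h w (by linarith) (by rw [hF0, zero_sub, norm_neg])
        have hwp : 0 < ‖w‖ := by linarith
        have hlt : C / ‖w‖ ^ 3 < 1 := by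
          rw [div_lt_one (by positivity)]
          have : ‖w‖ ≤ ‖w‖ ^ 3 := le_self_pow₀ (by linarith) (by norm_num)
          linarith
        -- The annulus leaves 2k+1 as the only odd value of |2j+1|, and Re w ≥ 0 excludes the
        -- negative sign.
        have hjk : j = k := by
          have h3 := ((abs_norm_sub_norm_le w (2 * j + 1)).trans hj).trans_lt hlt
          have e : (2 * j + 1 : ℂ) = ((2 * j + 1 : ℤ) : ℂ) := by push_cast; ring
          rw [e, Complex.norm_intCast, abs_lt] at h3
          have h4 : (|2 * j + 1| : ℤ) < 2 * k + 3 := by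
            have : (|((2 * j + 1 : ℤ) : ℝ)|) < 2 * k + 3 := by linarith
            exact_mod_cast this
          have h5 : 2 * (k : ℤ) - 1 < |2 * j + 1| := by
            have : 2 * (k : ℝ) - 1 < (|((2 * j + 1 : ℤ) : ℝ)|) := by linarith
            exact_mod_cast this
          have h6 : (0 : ℤ) ≤ 2 * j + 1 := by
            by_contra! hneg
            have h7 := ((Complex.abs_re_le_norm _).trans hj).trans_lt hlt
            have h8 : (w - (2 * j + 1)).re = w.re - (2 * j + 1 : ℤ) := by simp
            rw [h8, abs_lt] at h7
            have h9 : ((2 * j + 1 : ℤ) : ℝ) ≤ -1 := by exact_mod_cast (by omega)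
            have h10 := hre k
            linarith [h7.2]
          rw [abs_of_nonneg h6] at h4 h5
          omega
        rw [hjk] at hj
        have hkp : (0 : ℝ) < k := by linarith
        have hb : ‖((2 * k + 1 : ℕ) : ℂ) * (w - ((2 * k + 1 : ℕ) : ℂ))‖ ≤
            8 * C * (1 / ((2 * k + 1 : ℕ) : ℝ)) := by
          rw [norm_mul, Complex.norm_natCast]
          have h3 : ‖w - ((2 * k + 1 : ℕ) : ℂ)‖ ≤ C / (2 * k) ^ 3 := by
            refine le_trans ?_ (hj.trans ?_)
            · push_cast; rfl
            · gcongr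
          have h4 : C / (2 * (k : ℝ)) ^ 3 ≤ 8 * C / ((2 * k + 1 : ℕ) : ℝ) ^ 2 := by
            rw [div_le_div_iff₀ (by positivity) (by positivity)]
            push_cast
            have : (2 * (k : ℝ) + 1) ^ 2 ≤ 8 * (2 * k) ^ 3 := by
              have : (1 : ℝ) ≤ k := by linarith
              nlinarith [sq_nonneg (k : ℝ), mul_pos hkp hkp, pow_pos hkp 3]
            calc C * (2 * (k : ℝ) + 1) ^ 2 ≤ C * (8 * (2 * k) ^ 3) := by gcongr
              _ = _ := by ring
          calc _ ≤ ((2 * k + 1 : ℕ) : ℝ) * (8 * C / ((2 * k + 1 : ℕ) : ℝ) ^ 2) := by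
                gcongr; exact h3.trans h4
            _ = _ := by field_simp
        calc _ ≤ (8 * C * (1 / ((2 * k + 1 : ℕ) : ℝ))) ^ 2 := by gcongr
          _ = _ := by rw [mul_pow, div_pow, one_pow]
    · have hn0 : (n : ℂ) ≠ 0 := Nat.cast_ne_zero.2 (by omega)
      rw [mul_div_cancel_left₀ _ hn0, add_sub_cancel]
      rcases Nat.even_or_odd n with hne | ⟨k, rfl⟩
      · rw [heven n hne, hρe n hne]
      · rw [hodd, hρo, hr]

/-- The eigenvalues of the continuous problem differ from `n²` by `O(n⁻²)`. -/
theorem IsNumbering.exists_norm_sub_sq_le {q : ℝ → ℂ} {lam : ℕ → ℂ} (hl : IsNumbering q lam)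
    (hq : MemW12 q) (hq0 : q 0 + q π = 0) :
    ∃ C : ℝ, 0 ≤ C ∧ ∀ n : ℕ, 1 ≤ n → ‖lam n - (n : ℂ) ^ 2‖ ≤ C / (n : ℝ) ^ 2 := by
  obtain ⟨K, W, hK, hW, h⟩ := exists_norm_sub_odd_le hq hq0
  obtain ⟨ϰ, hsum, hϰ⟩ := hl.asymptotics
  have hlarge : ∀ᶠ n : ℕ in Filter.atTop, 1 ≤ n → ‖lam n - (n : ℂ) ^ 2‖ ≤ 24 * K / (n : ℝ) ^ 2 := by
    filter_upwards [hsum.tendsto_atTop_zero.eventually_le_const (show (0 : ℝ) < 1 / 4 by norm_num),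
      tendsto_natCast_atTop_atTop.eventually_ge_atTop (2 * W + 16 * K + 1)] with n hn1 hn2 hn
    rcases Nat.even_or_odd n with hne | hno
    · rw [hl.even n hn hne]; simp; positivity
    have hnp : (0 : ℝ) < n := by exact_mod_cast hn
    have hn1' : (1 : ℝ) ≤ n := by exact_mod_cast hn
    set w : ℂ := n + ϰ n / n with hw
    have hwn : ‖w - n‖ ≤ 1 / 2 := by
      have : w - n = ϰ n / n := by rw [hw]; ring
      rw [this, norm_div, Complex.norm_natCast, div_le_iff₀ hnp]
      have : ‖ϰ n‖ ≤ 1 / 2 := le_of_sq_le_sq (by linarith) (by norm_num)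
      nlinarith
    have hwl : (n : ℝ) / 2 ≤ ‖w‖ := by
      have := norm_sub_norm_le (n : ℂ) w
      rw [norm_sub_rev, Complex.norm_natCast] at this
      linarith
    have hwp : 0 < ‖w‖ := by linarith
    have hw0 : w ≠ 0 := norm_pos_iff.1 hwp
    have hchar : charFun q (w ^ 2) = 0 := by
      refine apply_eq_zero_of_analyticOrderAt_ne_zero ?_
      rw [← hl.multiplicity, Set.encard_ne_zero]
      exact ⟨n, hn, hϰ n hn⟩
    -- A zero of the sine factor would make w an even integer within 1/2 of the odd n, so the
    -- eigenvalue belongs to the other factor.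
    have hs : sinSqrt (w ^ 2) (π / 2) ≠ 0 := by
      intro h0
      obtain ⟨k, hk⟩ := exists_eq_of_sinSqrt_eq_zero hw0 h0
      have e : w - n = ((2 * k - n : ℤ) : ℂ) := by rw [hk]; push_cast; ring
      rw [e, Complex.norm_intCast] at hwn
      have h1 : |2 * k - n| < 1 := by
        have : |((2 * k - n : ℤ) : ℝ)| < 1 := by linarith
        exact_mod_cast this
      rw [Int.abs_lt_one_iff] at h1
      obtain ⟨j, hj⟩ := hno
      omega
    rw [charFun_eq, mul_eq_zero, or_iff_right hs] at hchar
    obtain ⟨k, hk⟩ := h w (by linarith) (by rw [oddCharFun, hchar, zero_sub, norm_neg])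
    have hcu : K / ‖w‖ ^ 3 ≤ 8 * K / (n : ℝ) ^ 3 := by
      calc K / ‖w‖ ^ 3 ≤ K / ((n : ℝ) / 2) ^ 3 := by gcongr
        _ = _ := by field_simp; norm_num
    have hsm : 8 * K / (n : ℝ) ^ 3 ≤ 1 / 2 := by
      rw [div_le_iff₀ (by positivity)]
      have : (n : ℝ) ≤ (n : ℝ) ^ 3 := le_self_pow₀ hn1' (by norm_num)
      linarith
    -- Both odd integers lie within 1/2 of w, and their difference is even.
    have hkn : (2 * k + 1 : ℤ) = n := by
      refine eq_of_norm_sub_le_one ?_ ?_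
      · have e : ((2 * k + 1 : ℤ) : ℂ) - ((n : ℤ) : ℂ) = (w - n) - (w - (2 * k + 1)) := by
          push_cast; ring
        rw [e]
        refine (norm_sub_le _ _).trans ?_
        linarith
      · obtain ⟨j, rfl⟩ := hno
        exact ⟨k - j, by push_cast; ring⟩
    have hkn' : (2 * k + 1 : ℂ) = n := by exact_mod_cast congrArg (Int.cast : ℤ → ℂ) hkn
    rw [hkn'] at hk
    rw [hϰ n hn, ← hw, show w ^ 2 - (n : ℂ) ^ 2 = (w - n) * (w + n) by ring, norm_mul]
    have hadd : ‖w + n‖ ≤ 3 * n := by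
      have : w + n = (w - n) + 2 * n := by ring
      rw [this]
      refine (norm_add_le _ _).trans ?_
      rw [norm_mul, Complex.norm_two, Complex.norm_natCast]
      linarith
    calc ‖w - n‖ * ‖w + n‖ ≤ (8 * K / (n : ℝ) ^ 3) * (3 * n) := by
          gcongr; exact hk.trans hcu
      _ = _ := by field_simp; ring
  obtain ⟨M, hM⟩ := Filter.eventually_atTop.1 hlarge
  -- The factor 24 comes from |w - n| ≤ 8K/n³ and |w + n| ≤ 3n; the sum covers the finitely many
  -- small n.
  refine ⟨24 * K + ∑ n ∈ Finset.range M, ‖lam n - (n : ℂ) ^ 2‖ * (n : ℝ) ^ 2, by positivity,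
    fun n hn => ?_⟩
  have hnp : (0 : ℝ) < n := by exact_mod_cast hn
  have hs0 : 0 ≤ ∑ n ∈ Finset.range M, ‖lam n - (n : ℂ) ^ 2‖ * (n : ℝ) ^ 2 := by positivity
  rcases le_or_gt M n with h1 | h1
  · refine (hM n h1 hn).trans ?_
    gcongr; linarith
  · rw [le_div_iff₀ (by positivity)]
    have := Finset.single_le_sum (f := fun n : ℕ => ‖lam n - (n : ℂ) ^ 2‖ * (n : ℝ) ^ 2)
      (fun _ _ => by positivity) (Finset.mem_range.2 h1)
    linarith

/-! ### The characteristic polynomial of the discrete problem -/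

lemma step_pos {m : ℕ} (hm : 1 ≤ m) : 0 < step m := by
  have : (0 : ℝ) < m := by exact_mod_cast hm
  unfold step; positivity

lemma two_mul_mul_step {m : ℕ} (hm : 1 ≤ m) : 2 * m * step m = π := by
  have : (m : ℝ) ≠ 0 := by have : (0 : ℝ) < m := by exact_mod_cast hm
                           exact this.ne'
  unfold step; field_simp

/-- The values at the nodes of the eigenvectors of the discrete problem with `q = 0`. -/
noncomputable def nodeSin (m n j : ℕ) : ℝ := Real.sin (n * (j * step m))

lemma nodeSin_comm (m n j : ℕ) : nodeSin m n j = nodeSin m j n := by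
  unfold nodeSin; congr 1; ring

lemma nodeSin_zero (m n : ℕ) : nodeSin m n 0 = 0 := by simp [nodeSin]

lemma nodeSin_two_mul {m : ℕ} (hm : 1 ≤ m) (n : ℕ) : nodeSin m n (2 * m) = 0 := by
  unfold nodeSin
  push_cast
  rw [two_mul_mul_step hm, Real.sin_nat_mul_pi]

lemma freeEigenvalue_mul {m : ℕ} (hm : 1 ≤ m) (n : ℕ) :
    freeEigenvalue m n * step m ^ 2 = 2 - 2 * Real.cos (n * step m) := by
  have h : step m ≠ 0 := (step_pos hm).ne'
  unfold freeEigenvalue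
  rw [div_mul_cancel₀ _ (pow_ne_zero 2 h), Real.sin_sq, Real.cos_sq]
  ring_nf

lemma nodeSin_add_two (m n j : ℕ) :
    2 * nodeSin m n (j + 1) - nodeSin m n j - nodeSin m n (j + 2) =
      (2 - 2 * Real.cos (n * step m)) * nodeSin m n (j + 1) := by
  have h1 : nodeSin m n j = Real.sin (n * ((j + 1 : ℕ) * step m) - n * step m) := by
    unfold nodeSin; push_cast; congr 1; ring
  have h2 : nodeSin m n (j + 2) = Real.sin (n * ((j + 1 : ℕ) * step m) + n * step m) := by
    unfold nodeSin; push_cast; congr 1; ring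
  rw [h1, h2, Real.sin_sub, Real.sin_add, nodeSin]
  ring

/-- Multiplied by 2 sin(nh) ≠ 0, the sum of 2sin² - 1 over all 2m nodes from 0 telescopes to zero by
periodicity. -/
lemma sum_nodeSin_sq {m n : ℕ} (hn : 1 ≤ n) (hnm : n ≤ 2 * m - 1) :
    ∑ i ∈ Finset.range (2 * m - 1), nodeSin m n (i + 1) ^ 2 = m := by
  have hm : 1 ≤ m := by omega
  have hstep := two_mul_mul_step hm
  have hpos := step_pos hm
  have hs : Real.sin (n * step m) ≠ 0 := by
    refine (Real.sin_pos_of_pos_of_lt_pi ?_ ?_).ne'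
    · have : (0 : ℝ) < n := by exact_mod_cast hn
      positivity
    · rw [← hstep]
      have : (n : ℝ) < 2 * m := by exact_mod_cast (by omega : n < 2 * m)
      gcongr
  have key : ∀ i : ℕ, 2 * Real.sin (n * step m) * (2 * nodeSin m n i ^ 2 - 1) =
      (fun i : ℕ => -Real.sin ((2 * i - 1) * (n * step m))) (i + 1) -
        (fun i : ℕ => -Real.sin ((2 * i - 1) * (n * step m))) i := by
    intro i
    simp only [nodeSin]
    have e1 : (2 * ((i + 1 : ℕ) : ℝ) - 1) * (n * step m) = 2 * (n * (i * step m)) + n * step m := by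
      push_cast; ring
    have e2 : (2 * (i : ℝ) - 1) * (n * step m) = 2 * (n * (i * step m)) - n * step m := by ring
    rw [e1, e2, Real.sin_add, Real.sin_sub, Real.cos_two_mul, Real.cos_sq']
    ring
  have h1 := Finset.sum_range_sub
    (fun i : ℕ => -Real.sin ((2 * i - 1) * (n * step m))) (2 * m)
  rw [← Finset.sum_congr rfl fun i _ => key i, ← Finset.mul_sum] at h1
  have e3 : (2 * ((2 * m : ℕ) : ℝ) - 1) * (n * step m) = n * (2 * π) - n * step m := by
    rw [← hstep]; push_cast; ring
  simp only [e3, Real.sin_nat_mul_two_pi_sub] at h1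
  have h2 : ∑ i ∈ Finset.range (2 * m), (2 * nodeSin m n i ^ 2 - 1) = 0 := by
    have : 2 * Real.sin (n * step m) *
        ∑ i ∈ Finset.range (2 * m), (2 * nodeSin m n i ^ 2 - 1) = 0 := by
      rw [h1]; simp [neg_mul, Real.sin_neg]
    exact (mul_eq_zero.1 this).resolve_left (mul_ne_zero two_ne_zero hs)
  rw [Finset.sum_sub_distrib, ← Finset.mul_sum] at h2
  have h3 : 2 * m = (2 * m - 1) + 1 := by omega
  rw [h3, Finset.sum_range_succ', nodeSin_zero, ← h3] at h2
  simp at h2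
  linarith

/-- Green's formula for the second difference. -/
lemma sum_range_green {R : Type*} [CommRing R] (a b : ℕ → R) (L : ℕ) :
    ∑ i ∈ Finset.range L, (a (i + 1) * (2 * b (i + 1) - b i - b (i + 2)) -
      b (i + 1) * (2 * a (i + 1) - a i - a (i + 2))) =
    (a (L + 1) * b L - a L * b (L + 1)) - (a 1 * b 0 - a 0 * b 1) := by
  rw [← Finset.sum_range_sub (fun j => a (j + 1) * b j - a j * b (j + 1))]
  refine Finset.sum_congr rfl fun i _ => ?_
  ring

lemma freeEigenvalue_injOn {m n k : ℕ} (hn : n ≤ 2 * m) (hk : k ≤ 2 * m) (hm : 1 ≤ m)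
    (h : freeEigenvalue m n = freeEigenvalue m k) : n = k := by
  have hpos := step_pos hm
  have hmem : ∀ j : ℕ, j ≤ 2 * m → (j : ℝ) * step m ∈ Icc 0 π := fun j hj => by
    refine ⟨by positivity, ?_⟩
    rw [← two_mul_mul_step hm]
    have : (j : ℝ) ≤ 2 * m := by exact_mod_cast hj
    gcongr
  have h1 := freeEigenvalue_mul hm n
  rw [h, freeEigenvalue_mul hm k] at h1
  have := Real.injOn_cos (hmem n hn) (hmem k hk) (by linarith)
  exact_mod_cast mul_right_cancel₀ hpos.ne' this

/-- Orthogonality of eigenvectors with distinct eigenvalues: the boundary terms in Green's formula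
vanish. -/
lemma sum_nodeSin_mul_of_ne {m n k : ℕ} (hn : n ≤ 2 * m - 1) (hk : k ≤ 2 * m - 1) (hm : 1 ≤ m)
    (hnk : n ≠ k) :
    ∑ i ∈ Finset.range (2 * m - 1), nodeSin m n (i + 1) * nodeSin m k (i + 1) = 0 := by
  have h := sum_range_green (nodeSin m n) (nodeSin m k) (2 * m - 1)
  rw [show 2 * m - 1 + 1 = 2 * m by omega, nodeSin_two_mul hm, nodeSin_two_mul hm, nodeSin_zero,
    nodeSin_zero] at h
  simp only [nodeSin_add_two] at h
  have h2 : ∀ i, nodeSin m n (i + 1) * ((2 - 2 * Real.cos (k * step m)) * nodeSin m k (i + 1)) -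
      nodeSin m k (i + 1) * ((2 - 2 * Real.cos (n * step m)) * nodeSin m n (i + 1)) =
      (freeEigenvalue m k - freeEigenvalue m n) * step m ^ 2 *
        (nodeSin m n (i + 1) * nodeSin m k (i + 1)) := by
    intro i
    rw [← freeEigenvalue_mul hm, ← freeEigenvalue_mul hm]; ring
  simp only [h2] at h
  rw [← Finset.mul_sum] at h
  have h3 : (freeEigenvalue m k - freeEigenvalue m n) * step m ^ 2 ≠ 0 := by
    refine mul_ne_zero (sub_ne_zero.2 fun h => hnk ?_) (pow_ne_zero 2 (step_pos hm).ne')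
    exact freeEigenvalue_injOn (by omega) (by omega) hm h.symm
  refine (mul_eq_zero.1 (h.trans ?_)).resolve_left h3
  ring

/-- The matrix of the discrete sine transform. -/
noncomputable def sineMatrix (m : ℕ) : Matrix (Fin (2 * m - 1)) (Fin (2 * m - 1)) ℂ :=
  Matrix.of fun n i => (nodeSin m (n + 1) (i + 1) : ℂ)

lemma sineMatrix_mul_self {m : ℕ} (hm : 1 ≤ m) :
    sineMatrix m * sineMatrix m = (m : ℂ) • (1 : Matrix _ _ ℂ) := by
  ext n k
  have h1 : (sineMatrix m * sineMatrix m) n k = ((∑ i ∈ Finset.range (2 * m - 1),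
      nodeSin m (n + 1) (i + 1) * nodeSin m (k + 1) (i + 1) : ℝ) : ℂ) := by
    rw [Matrix.mul_apply, ← Fin.sum_univ_eq_sum_range
      (fun i => nodeSin m (n + 1) (i + 1) * nodeSin m (k + 1) (i + 1))]
    push_cast
    refine Finset.sum_congr rfl fun i _ => ?_
    simp only [sineMatrix, Matrix.of_apply]
    rw [nodeSin_comm m (i + 1) (k + 1)]
  rw [h1, Matrix.smul_apply, Matrix.one_apply]
  split_ifs with h
  · subst h
    have := sum_nodeSin_sq (m := m) (n := n + 1) (by omega) (by omega)
    simp only [pow_two] at this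
    rw [this]; simp
  · rw [sum_nodeSin_mul_of_ne (by omega) (by omega) hm fun h2 => h (Fin.ext (by omega))]
    simp

lemma det_sineMatrix_ne_zero {m : ℕ} (hm : 1 ≤ m) : (sineMatrix m).det ≠ 0 := by
  intro h
  have h1 := congrArg Matrix.det (sineMatrix_mul_self hm)
  rw [Matrix.det_mul, h, Matrix.det_smul, Matrix.det_one, mul_one, mul_zero] at h1
  have : (m : ℂ) ≠ 0 := Nat.cast_ne_zero.2 (by omega)
  exact pow_ne_zero _ this h1.symm

/-- The discrete sine transform of the values of `q` at the nodes. -/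
noncomputable def sineCoeff (q : ℝ → ℂ) (m n : ℕ) : ℂ :=
  ∑ i ∈ Finset.range (2 * m - 1), (nodeSin m n (i + 1) : ℂ) * q ((i + 1 : ℝ) * step m)

/-- The zero boundary values supply the neighbours missing in the first and last columns. Index i
stands for node i + 1, as in `discreteMatrix`. -/
lemma sum_range_second_difference (f : ℕ → ℂ) {L k : ℕ} (hk : k < L) (h0 : f 0 = 0)
    (hL : f (L + 1) = 0) :
    ∑ i ∈ Finset.range L, f (i + 1) * ((if k = i then 2 else 0) - (if k = i + 1 then 1 else 0)
        - (if k + 1 = i then 1 else 0)) = 2 * f (k + 1) - f k - f (k + 2) := by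
  have e1 : ∑ i ∈ Finset.range L, f (i + 1) * (if k = i then 2 else 0) = 2 * f (k + 1) := by
    simp [hk, mul_comm]
  have e2 : ∑ i ∈ Finset.range L, f (i + 1) * (if k = i + 1 then 1 else 0) = f k := by
    cases k with
    | zero => simp [h0]
    | succ k =>
      have : k < L := by omega
      simp [this]
  have e3 : ∑ i ∈ Finset.range L, f (i + 1) * (if k + 1 = i then 1 else 0) = f (k + 2) := by
    by_cases h : k + 1 < L
    · simp [h]
    · have : k + 1 = L := by omega
      simp [h]
      rw [← this] at hL
      exact hL.symm
  simp only [mul_sub, Finset.sum_sub_distrib, e1, e2, e3]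

/-- The transform diagonalizes the second difference. The frozen term has only the column of the
middle node m, so it is rank one: its column becomes the sine coefficients of q, its row the m-th
unit vector in the sine basis. -/
lemma sineMatrix_mul_discreteMatrix (q : ℝ → ℂ) {m : ℕ} (hm : 1 ≤ m) :
    sineMatrix m * discreteMatrix q m =
      (Matrix.diagonal (fun n : Fin (2 * m - 1) => (freeEigenvalue m (n + 1) : ℂ)) +
        Matrix.replicateCol Unit (fun n : Fin (2 * m - 1) => sineCoeff q m (n + 1)) *
        Matrix.replicateRow Unit (fun n : Fin (2 * m - 1) =>
          (1 / m : ℂ) * nodeSin m (n + 1) m)) * sineMatrix m := by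
  have hm0 : (m : ℂ) ≠ 0 := Nat.cast_ne_zero.2 (by omega)
  have hh : (step m : ℂ) ^ 2 ≠ 0 := pow_ne_zero 2 (Complex.ofReal_ne_zero.2 (step_pos hm).ne')
  ext n k
  -- By symmetry of `nodeSin` the row is 1/m times row m of the sine matrix, whose square is m times
  -- the identity.
  have hrow : ∑ j : Fin (2 * m - 1), (1 / m : ℂ) * nodeSin m (j + 1) m * sineMatrix m j k =
      if (k : ℕ) + 1 = m then 1 else 0 := by
    have h1 := congrFun (congrFun (sineMatrix_mul_self hm) ⟨m - 1, by omega⟩) k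
    rw [Matrix.mul_apply, Matrix.smul_apply, Matrix.one_apply] at h1
    have h2 : ∀ j : Fin (2 * m - 1), (1 / m : ℂ) * nodeSin m (j + 1) m * sineMatrix m j k =
        (1 / m : ℂ) * (sineMatrix m ⟨m - 1, by omega⟩ j * sineMatrix m j k) := by
      intro j
      simp only [sineMatrix, Matrix.of_apply, show m - 1 + 1 = m by omega]
      rw [nodeSin_comm m m]; ring
    simp only [h2]
    rw [← Finset.mul_sum, h1]
    have h3 : ((⟨m - 1, by omega⟩ : Fin (2 * m - 1)) = k) ↔ (k : ℕ) + 1 = m := by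
      rw [Fin.ext_iff]; simp only; omega
    simp only [h3]
    split_ifs <;> simp [hm0]
  have hL : (sineMatrix m * discreteMatrix q m) n k =
      (freeEigenvalue m (n + 1) : ℂ) * nodeSin m (n + 1) (k + 1) +
        if (k : ℕ) + 1 = m then sineCoeff q m (n + 1) else 0 := by
    rw [Matrix.mul_apply]
    simp only [sineMatrix, discreteMatrix, Matrix.of_apply, mul_add, Finset.sum_add_distrib]
    congr 1
    · have := sum_range_second_difference (fun j => (nodeSin m (n + 1) j : ℂ)) k.2
        (by simp [nodeSin_zero]) (by
          rw [show 2 * m - 1 + 1 = 2 * m by omega, nodeSin_two_mul hm]; simp)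
      rw [← Fin.sum_univ_eq_sum_range (fun i => (nodeSin m (n + 1) (i + 1) : ℂ) *
        ((if (k : ℕ) = i then 2 else 0) - (if (k : ℕ) = i + 1 then 1 else 0)
        - (if (k : ℕ) + 1 = i then 1 else 0)))] at this
      simp only [← mul_div_assoc, ← Finset.sum_div, Fin.ext_iff]
      rw [this, div_eq_iff hh]
      have h4 := nodeSin_add_two m (n + 1) k
      rw [← freeEigenvalue_mul hm] at h4
      have h5 := congrArg (Complex.ofReal) h4
      push_cast at h5
      rw [h5]; ring
    · split_ifs with h
      · rw [sineCoeff, ← Fin.sum_univ_eq_sum_range (fun i => (nodeSin m (n + 1) (i + 1) : ℂ) *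
          q ((i + 1 : ℝ) * step m))]
      · simp
  rw [hL, Matrix.add_mul, Matrix.add_apply, Matrix.diagonal_mul, Matrix.mul_assoc]
  congr 1
  rw [Matrix.mul_apply]
  simp only [Matrix.replicateCol_apply, Finset.univ_unique, Finset.sum_singleton,
    Matrix.mul_apply, Matrix.replicateRow_apply]
  rw [hrow]
  split_ifs <;> simp

/-- The residues of the resolvent of the discrete problem. -/
noncomputable def residueCoeff (q : ℝ → ℂ) (m n : ℕ) : ℂ :=
  (1 / m : ℂ) * nodeSin m n m * sineCoeff q m n

/-- Even modes vanish at the midpoint, where the solution is frozen: sin(nπ/2) = 0. -/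
lemma residueCoeff_of_even (q : ℝ → ℂ) {m n : ℕ} (hm : 1 ≤ m) (hn : Even n) :
    residueCoeff q m n = 0 := by
  obtain ⟨k, rfl⟩ := hn
  have : nodeSin m (k + k) m = 0 := by
    unfold nodeSin
    have : ((k + k : ℕ) : ℝ) * (m * step m) = k * π := by
      rw [← two_mul_mul_step hm]; push_cast; ring
    rw [this, Real.sin_nat_mul_pi]
  rw [residueCoeff, this]; simp

/-- Off the free spectrum the diagonal part can be factored out, and the matrix determinant lemma
evaluates the rank one remainder. -/
lemma eval_charpoly_discreteMatrix (q : ℝ → ℂ) {m : ℕ} (hm : 1 ≤ m) {z : ℂ}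
    (hz : ∀ n ∈ Finset.Icc 1 (2 * m - 1), z ≠ freeEigenvalue m n) :
    (discreteMatrix q m).charpoly.eval z =
      (∏ n ∈ Finset.Icc 1 (2 * m - 1), (z - freeEigenvalue m n)) *
        (1 - ∑ n ∈ Finset.Icc 1 (2 * m - 1), residueCoeff q m n / (z - freeEigenvalue m n)) := by
  have hIcc : Finset.Icc 1 (2 * m - 1) = (Finset.range (2 * m - 1)).map (addRightEmbedding 1) := by
    ext n
    simp only [Finset.mem_Icc, Finset.mem_map, Finset.mem_range, addRightEmbedding_apply]
    constructor
    · intro h; exact ⟨n - 1, by omega, by omega⟩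
    · rintro ⟨a, h1, rfl⟩; omega
  have hz' : ∀ n : Fin (2 * m - 1), z - freeEigenvalue m (n + 1) ≠ 0 := fun n =>
    sub_ne_zero.2 (hz _ (Finset.mem_Icc.2 ⟨by omega, by omega⟩))
  have hdet := det_sineMatrix_ne_zero hm
  set D : Matrix (Fin (2 * m - 1)) (Fin (2 * m - 1)) ℂ :=
    Matrix.diagonal fun n => z - freeEigenvalue m (n + 1) with hD
  set v : Fin (2 * m - 1) → ℂ := fun n => (1 / m : ℂ) * nodeSin m (n + 1) m with hv
  set u : Fin (2 * m - 1) → ℂ := fun n => sineCoeff q m (n + 1) with hu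
  set u' : Fin (2 * m - 1) → ℂ := fun n => -(u n / (z - freeEigenvalue m (n + 1))) with hu'
  have hmul : sineMatrix m * (Matrix.scalar _ z - discreteMatrix q m) =
      (D * (1 + Matrix.replicateCol Unit u' * Matrix.replicateRow Unit v)) * sineMatrix m := by
    rw [mul_sub, sineMatrix_mul_discreteMatrix q hm, ← (Matrix.scalar_commute z (fun _ => Commute.all _ _) _).eq,
      ← sub_mul]
    congr 1
    ext a b
    rw [Matrix.mul_add, Matrix.mul_one, ← Matrix.mul_assoc]
    simp only [Matrix.sub_apply, Matrix.add_apply, Matrix.mul_apply, Matrix.replicateCol_apply,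
      Matrix.replicateRow_apply, Finset.univ_unique, Finset.sum_singleton, hD,
      Matrix.scalar_apply, hu', Matrix.diagonal_apply]
    by_cases hab : a = b
    · subst hab
      have := hz' a
      simp
      field_simp
      ring
    · have := hz' a
      simp [hab]
      field_simp
      simp only [hu, hv]
      ring
  have h2 := congrArg Matrix.det hmul
  rw [Matrix.det_mul, Matrix.det_mul, mul_comm] at h2
  rw [Matrix.eval_charpoly, mul_right_cancel₀ hdet h2, Matrix.det_mul, hD, Matrix.det_diagonal,
    Matrix.det_one_add_replicateCol_mul_replicateRow, hIcc, Finset.prod_map, Finset.sum_map]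
  simp only [addRightEmbedding_apply]
  rw [← Fin.prod_univ_eq_prod_range (fun i => z - (freeEigenvalue m (i + 1) : ℂ)),
    ← Fin.sum_univ_eq_sum_range (fun i => residueCoeff q m (i + 1) /
      (z - (freeEigenvalue m (i + 1) : ℂ)))]
  congr 1
  rw [sub_eq_add_neg, ← Finset.sum_neg_distrib]
  congr 1
  refine Finset.sum_congr rfl fun n _ => ?_
  simp only [hv, hu', hu, residueCoeff]
  ring

open Polynomial in
/-- The factor of the characteristic polynomial of the discrete problem with the eigenvalues of odd
number. -/
noncomputable def secularPoly (q : ℝ → ℂ) (m : ℕ) : ℂ[X] :=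
  ∏ n ∈ (Finset.Icc 1 (2 * m - 1)).filter Odd, (X - C (freeEigenvalue m n : ℂ)) -
    ∑ n ∈ (Finset.Icc 1 (2 * m - 1)).filter Odd, C (residueCoeff q m n) *
      ∏ k ∈ ((Finset.Icc 1 (2 * m - 1)).filter Odd).erase n, (X - C (freeEigenvalue m k : ℂ))

lemma eval_secularPoly (q : ℝ → ℂ) (m : ℕ) {z : ℂ}
    (hz : ∀ n ∈ (Finset.Icc 1 (2 * m - 1)).filter Odd, z ≠ freeEigenvalue m n) :
    (secularPoly q m).eval z =
      (∏ n ∈ (Finset.Icc 1 (2 * m - 1)).filter Odd, (z - freeEigenvalue m n)) *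
        (1 - ∑ n ∈ (Finset.Icc 1 (2 * m - 1)).filter Odd,
          residueCoeff q m n / (z - freeEigenvalue m n)) := by
  simp only [secularPoly, Polynomial.eval_sub, Polynomial.eval_prod, Polynomial.eval_finsetSum,
    Polynomial.eval_mul, Polynomial.eval_X, Polynomial.eval_C]
  rw [mul_sub, mul_one, Finset.mul_sum]
  congr 1
  refine Finset.sum_congr rfl fun n hn => ?_
  have h := sub_ne_zero.2 (hz n hn)
  rw [← Finset.mul_prod_erase _ _ hn]
  field_simp

open Polynomial in
-- Both sides agree off the finitely many free eigenvalues, hence as polynomials. This keeps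
-- multiplicities correct even when an eigenvalue coincides with a pole.
lemma charpoly_discreteMatrix (q : ℝ → ℂ) {m : ℕ} (hm : 1 ≤ m) :
    (discreteMatrix q m).charpoly =
      (∏ n ∈ (Finset.Icc 1 (2 * m - 1)).filter Even, (X - C (freeEigenvalue m n : ℂ))) *
        secularPoly q m := by
  refine Polynomial.eq_of_infinite_eval_eq _ _ ?_
  have hfin : (((Finset.Icc 1 (2 * m - 1)).image fun n => (freeEigenvalue m n : ℂ)) :
      Set ℂ).Finite := Finset.finite_toSet _
  refine hfin.infinite_compl.mono fun z hz => ?_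
  have hz' : ∀ n ∈ Finset.Icc 1 (2 * m - 1), z ≠ freeEigenvalue m n := by
    rintro n hn rfl
    exact hz (Finset.mem_coe.2 (Finset.mem_image_of_mem _ hn))
  rw [mem_ofPred_eq, eval_charpoly_discreteMatrix q hm hz', Polynomial.eval_mul,
    eval_secularPoly q m fun n hn => hz' n (Finset.mem_filter.1 hn).1, Polynomial.eval_prod,
    ← mul_assoc]
  have hfe : (Finset.Icc 1 (2 * m - 1)).filter Odd =
      (Finset.Icc 1 (2 * m - 1)).filter fun n => ¬ Even n :=
    Finset.filter_congr fun n _ => Nat.not_even_iff_odd.symm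
  rw [hfe]
  simp only [Polynomial.eval_sub, Polynomial.eval_X, Polynomial.eval_C]
  rw [Finset.prod_filter_mul_prod_filter_not, ← Finset.sum_filter_add_sum_filter_not _ Even,
    Finset.sum_eq_zero (s := (Finset.Icc 1 (2 * m - 1)).filter Even), zero_add]
  intro n hn
  rw [residueCoeff_of_even q hm (Finset.mem_filter.1 hn).2, zero_div]

lemma secularPoly_ne_zero (q : ℝ → ℂ) {m : ℕ} (hm : 1 ≤ m) : secularPoly q m ≠ 0 := by
  intro h
  have := charpoly_discreteMatrix q hm
  rw [h, mul_zero] at this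
  exact (Matrix.charpoly_monic _).ne_zero this

lemma roots_charpoly_discreteMatrix (q : ℝ → ℂ) {m : ℕ} (hm : 1 ≤ m) :
    (discreteMatrix q m).charpoly.roots =
      ((Finset.Icc 1 (2 * m - 1)).filter Even).val.map (fun n => (freeEigenvalue m n : ℂ)) +
        (secularPoly q m).roots := by
  have h := charpoly_discreteMatrix q hm
  rw [h, Polynomial.roots_mul (by rw [← h]; exact (Matrix.charpoly_monic _).ne_zero)]
  congr 1
  have := Polynomial.roots_multiset_prod_X_sub_C
    (((Finset.Icc 1 (2 * m - 1)).filter Even).val.map (fun n => (freeEigenvalue m n : ℂ)))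
  rw [Multiset.map_map] at this
  exact this

lemma card_roots_secularPoly (q : ℝ → ℂ) {m : ℕ} (hm : 1 ≤ m) :
    Multiset.card (secularPoly q m).roots = ((Finset.Icc 1 (2 * m - 1)).filter Odd).card := by
  have h := congrArg Multiset.card (roots_charpoly_discreteMatrix q hm)
  rw [Multiset.card_add, Multiset.card_map, Finset.card_val,
    ← (IsAlgClosed.splits _).natDegree_eq_card_roots, Matrix.charpoly_natDegree_eq_dim,
    Fintype.card_fin] at h
  have h2 := Finset.card_filter_add_card_filter_not (s := Finset.Icc 1 (2 * m - 1)) Even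
  rw [Nat.card_Icc] at h2
  have hfe : (Finset.Icc 1 (2 * m - 1)).filter Odd =
      (Finset.Icc 1 (2 * m - 1)).filter fun n => ¬ Even n :=
    Finset.filter_congr fun n _ => Nat.not_even_iff_odd.symm
  rw [hfe]
  omega

/-! ### Bounds for the residues -/

/-- The sum of the second differences is controlled by the variation of the derivative. -/
lemma MemW12.exists_sum_second_difference_le {q : ℝ → ℂ} (hq : MemW12 q) :
    ∃ V : ℝ, 0 ≤ V ∧ ∀ m : ℕ, 1 ≤ m → ∑ i ∈ Finset.range (2 * m - 1),
      ‖2 * q ((i + 1 : ℕ) * step m) - q (i * step m) - q ((i + 2 : ℕ) * step m)‖ ≤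
        step m * V := by
  set q' := derivWithin q (Icc 0 π) with hq'
  have hd : ∀ x ∈ Icc 0 π, HasDerivWithinAt q (q' x) (Icc 0 π) x := fun x hx =>
    (hq.2.1 x hx).hasDerivWithinAt
  have hac : AbsolutelyContinuousOnInterval q' 0 π := hq.2.2.1
  have hq'c : ContinuousOn q' (Icc 0 π) := by
    have := hac.continuousOn; rwa [uIcc_of_le Real.pi_pos.le] at this
  have hbv : BoundedVariationOn q' (Icc 0 π) := by
    have := hac.boundedVariationOn; rwa [uIcc_of_le Real.pi_pos.le] at this
  refine ⟨(eVariationOn q' (Icc 0 π)).toReal, ENNReal.toReal_nonneg, fun m hm => ?_⟩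
  set h := step m with hh
  have hpos : 0 < h := step_pos hm
  have hstep := two_mul_mul_step hm
  have hmem : ∀ i : ℕ, i ≤ 2 * m - 1 → ∀ t ∈ Icc 0 h, i * h + t ∈ Icc 0 π := by
    intro i hi t ht
    refine ⟨by have := ht.1; positivity, ?_⟩
    have h1 : ((i : ℝ) + 1) ≤ 2 * m := by exact_mod_cast (by omega : i + 1 ≤ 2 * m)
    rw [← hstep]
    nlinarith [ht.2]
  have hcont : ∀ i : ℕ, i ≤ 2 * m - 1 → ContinuousOn (fun t => q' (i * h + t)) (Icc 0 h) :=
    fun i hi => hq'c.comp (by fun_prop) (hmem i hi)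
  have hint : ∀ i : ℕ, i ≤ 2 * m - 1 →
      q ((i + 1 : ℕ) * h) - q (i * h) = ∫ t in (0 : ℝ)..h, q' (i * h + t) := by
    intro i hi
    have e : ((i + 1 : ℕ) : ℝ) * h = i * h + h := by push_cast; ring
    rw [intervalIntegral.integral_comp_add_left, add_zero, ← e]
    refine (integral_eq_sub_of_hasDerivWithinAt_Icc hd hq'c ?_ ?_).symm
    · simpa using hmem i hi 0 (left_mem_Icc.2 hpos.le)
    · rw [e]; exact hmem i hi h (right_mem_Icc.2 hpos.le)
  have hII : ∀ i : ℕ, i ≤ 2 * m - 1 → IntervalIntegrable (fun t => q' (i * h + t)) volume 0 h :=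
    fun i hi => ContinuousOn.intervalIntegrable (by rw [uIcc_of_le hpos.le]; exact hcont i hi)
  have hIn : ∀ i ∈ Finset.range (2 * m - 1), IntervalIntegrable
      (fun t => ‖q' ((i + 1 : ℕ) * h + t) - q' (i * h + t)‖) volume 0 h := fun i hi => by
    have := Finset.mem_range.1 hi
    exact ((hII (i + 1) (by omega)).sub (hII i (by omega))).norm
  -- Each second difference is the integral over t in [0, h] of an increment of q' along the points
  -- ih + t. For fixed t these increments add up to at most the total variation of q'.
  calc _ ≤ ∑ i ∈ Finset.range (2 * m - 1), ∫ t in (0 : ℝ)..h,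
        ‖q' ((i + 1 : ℕ) * h + t) - q' (i * h + t)‖ := by
        refine Finset.sum_le_sum fun i hi => ?_
        have hi' := Finset.mem_range.1 hi
        have e : 2 * q ((i + 1 : ℕ) * h) - q (i * h) - q ((i + 2 : ℕ) * h) =
            -∫ t in (0 : ℝ)..h, (q' ((i + 1 : ℕ) * h + t) - q' (i * h + t)) := by
          rw [intervalIntegral.integral_sub (hII (i + 1) (by omega)) (hII i (by omega)),
            ← hint (i + 1) (by omega), ← hint i (by omega)]
          ring
        rw [e, norm_neg]
        exact intervalIntegral.norm_integral_le_integral_norm hpos.le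
    _ = ∫ t in (0 : ℝ)..h, ∑ i ∈ Finset.range (2 * m - 1),
        ‖q' ((i + 1 : ℕ) * h + t) - q' (i * h + t)‖ :=
        (intervalIntegral.integral_finsetSum hIn).symm
    _ ≤ ∫ t in (0 : ℝ)..h, (eVariationOn q' (Icc 0 π)).toReal := by
        refine intervalIntegral.integral_mono_on hpos.le ?_ (by simp) fun t ht => ?_
        · have := IntervalIntegrable.sum _ hIn
          rwa [Finset.sum_fn] at this
        have h1 := eVariationOn.sum_le_of_monotoneOn_Iic (f := q') (s := Icc 0 π)
          (n := 2 * m - 1) (u := fun i : ℕ => (i : ℝ) * h + t)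
          (fun a _ b _ hab => by
            have : (a : ℝ) ≤ b := by exact_mod_cast hab
            simp only; gcongr) (fun i hi => hmem i hi t ht)
        have h2 := ENNReal.toReal_mono hbv h1
        rw [ENNReal.toReal_sum (fun i _ => edist_ne_top _ _)] at h2
        refine le_trans (le_of_eq (Finset.sum_congr rfl fun i _ => ?_)) h2
        rw [← dist_edist, dist_eq_norm]
    _ = _ := by simp

lemma sin_half_lower {m n : ℕ} (hnm : n ≤ 2 * m) (hm : 1 ≤ m) :
    (n : ℝ) * step m / π ≤ Real.sin (n * step m / 2) := by
  have hpos := step_pos hm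
  have hp := Real.pi_pos
  have h1 : (n : ℝ) * step m / 2 ≤ π / 2 := by
    rw [← two_mul_mul_step hm]
    have : (n : ℝ) ≤ 2 * m := by exact_mod_cast hnm
    gcongr
  have := Real.mul_le_sin (x := (n : ℝ) * step m / 2) (by positivity) h1
  refine le_trans (le_of_eq ?_) this
  field_simp

/-- Summation by parts moves the second difference from the sine, where it is multiplication by
4sin²(nh/2), to q, where it sums to O(h). Jordan's inequality bounds the multiplier below by
4(nh/π)². -/
lemma MemW12.exists_norm_residueCoeff_le {q : ℝ → ℂ} (hq : MemW12 q) (hq0 : q 0 + q π = 0) :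
    ∃ B : ℝ, 0 ≤ B ∧ ∀ m n : ℕ, Odd n → n ≤ 2 * m - 1 →
      ‖residueCoeff q m n‖ ≤ B / (n : ℝ) ^ 2 := by
  obtain ⟨V, hV, h⟩ := hq.exists_sum_second_difference_le
  refine ⟨V * π / 2, by positivity, fun m n hn hnm => ?_⟩
  have hn1 : 1 ≤ n := hn.pos
  have hm : 1 ≤ m := by omega
  have hpos := step_pos hm
  have hstep := two_mul_mul_step hm
  have hnp : (0 : ℝ) < n := by exact_mod_cast hn1
  have hp := Real.pi_pos
  have hm0 : (0 : ℝ) < m := by exact_mod_cast hm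
  set s : ℕ → ℂ := fun j => (nodeSin m n j : ℂ) with hs
  set Q : ℕ → ℂ := fun j => q (j * step m) with hQ
  have hcoef : sineCoeff q m n = ∑ i ∈ Finset.range (2 * m - 1), s (i + 1) * Q (i + 1) := by
    simp only [sineCoeff, hs, hQ]; push_cast; rfl
  have hgreen := sum_range_green Q s (2 * m - 1)
  -- Odd modes are symmetric about π/2, so the two boundary terms combine into a multiple of q(0) +
  -- q(π).
  have hs1 : s (2 * m - 1) = s 1 := by
    simp only [hs, nodeSin]
    congr 1
    obtain ⟨k, rfl⟩ := hn
    have e : ((2 * k + 1 : ℕ) : ℝ) * (((2 * m - 1 : ℕ) : ℝ) * step m) =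
        π - ((2 * k + 1 : ℕ) : ℝ) * (((1 : ℕ) : ℝ) * step m) + k * (2 * π) := by
      rw [Nat.cast_sub (by omega), ← hstep]; push_cast; ring
    rw [e, Real.sin_add_nat_mul_two_pi, Real.sin_pi_sub]
  have hQend : Q (2 * m - 1 + 1) + Q 0 = 0 := by
    simp only [hQ, show 2 * m - 1 + 1 = 2 * m by omega]
    push_cast
    rw [hstep, zero_mul, add_comm, hq0]
  have hs0 : s 0 = 0 := by simp [hs, nodeSin_zero]
  have hsM : s (2 * m - 1 + 1) = 0 := by
    simp [hs, show 2 * m - 1 + 1 = 2 * m by omega, nodeSin_two_mul hm]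
  rw [hs0, hsM, hs1] at hgreen
  have hR : Q (2 * m - 1 + 1) * s 1 - Q (2 * m - 1) * 0 - (Q 1 * 0 - Q 0 * s 1) = 0 := by
    linear_combination s 1 * hQend
  rw [hR, Finset.sum_sub_distrib, sub_eq_zero] at hgreen
  have hd : ∀ i, 2 * s (i + 1) - s i - s (i + 2) =
      ((4 * Real.sin (n * step m / 2) ^ 2 : ℝ) : ℂ) * s (i + 1) := by
    intro i
    have h1 := congrArg Complex.ofReal (nodeSin_add_two m n i)
    have h2 : 2 - 2 * Real.cos (n * step m) = 4 * Real.sin (n * step m / 2) ^ 2 := by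
      rw [← freeEigenvalue_mul hm, freeEigenvalue, div_mul_cancel₀ _ (pow_ne_zero 2 hpos.ne')]
    rw [h2] at h1
    simp only [hs]
    rw [Complex.ofReal_sub, Complex.ofReal_sub, Complex.ofReal_mul, Complex.ofReal_mul] at h1
    exact h1
  have hleft : ∑ i ∈ Finset.range (2 * m - 1), Q (i + 1) * (2 * s (i + 1) - s i - s (i + 2)) =
      ((4 * Real.sin (n * step m / 2) ^ 2 : ℝ) : ℂ) * sineCoeff q m n := by
    rw [hcoef, Finset.mul_sum]
    refine Finset.sum_congr rfl fun i _ => ?_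
    rw [hd]; ring
  rw [hleft] at hgreen
  have hbound : 4 * Real.sin (n * step m / 2) ^ 2 * ‖sineCoeff q m n‖ ≤ step m * V := by
    have h1 := congrArg norm hgreen
    rw [norm_mul, Complex.norm_real, Real.norm_of_nonneg (by positivity)] at h1
    rw [h1]
    refine (norm_sum_le _ _).trans (le_trans (Finset.sum_le_sum fun i _ => ?_) (h m hm))
    rw [norm_mul]
    have h2 : ‖s (i + 1)‖ ≤ 1 := by
      simp only [hs, Complex.norm_real, nodeSin]; exact Real.abs_sin_le_one _
    exact mul_le_of_le_one_left (norm_nonneg _) h2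
  have hsin := sin_half_lower (n := n) (by omega : n ≤ 2 * m) hm
  have hsin2 : 4 * ((n : ℝ) * step m / π) ^ 2 * ‖sineCoeff q m n‖ ≤ step m * V := by
    refine le_trans ?_ hbound
    gcongr
  have hT : ‖residueCoeff q m n‖ ≤ 1 / m * ‖sineCoeff q m n‖ := by
    rw [residueCoeff, norm_mul, norm_mul, norm_div, Complex.norm_natCast, norm_one,
      Complex.norm_real]
    have : ‖nodeSin m n m‖ ≤ 1 := Real.abs_sin_le_one _
    gcongr
    exact mul_le_of_le_one_right (by positivity) this
  refine hT.trans ?_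
  rw [le_div_iff₀ (by positivity)]
  have hst : step m = π / (2 * m) := rfl
  rw [hst] at hsin2
  have e1 : 4 * ((n : ℝ) * (π / (2 * m)) / π) ^ 2 * ‖sineCoeff q m n‖ =
      (1 / m * ‖sineCoeff q m n‖ * n ^ 2) * (1 / m) := by field_simp; ring
  have e2 : π / (2 * m) * V = V * π / 2 * (1 / m) := by field_simp
  rw [e1, e2] at hsin2
  exact le_of_mul_le_mul_right hsin2 (by positivity)

/-! ### Location of the eigenvalues of the discrete problem -/

lemma sub_freeEigenvalue_eq {m : ℕ} (hm : 1 ≤ m) (k : ℕ) (θ : ℂ) :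
    (2 - 2 * Complex.cos θ) / (step m : ℂ) ^ 2 - freeEigenvalue m k =
      4 * (Complex.sin ((θ + (k * step m : ℝ)) / 2) * Complex.sin ((θ - (k * step m : ℝ)) / 2)) /
        (step m : ℂ) ^ 2 := by
  have hh : (step m : ℂ) ^ 2 ≠ 0 := pow_ne_zero 2 (Complex.ofReal_ne_zero.2 (step_pos hm).ne')
  have h1 : (freeEigenvalue m k : ℂ) * (step m : ℂ) ^ 2 =
      2 - 2 * Complex.cos ((k * step m : ℝ) : ℂ) := by
    have := congrArg Complex.ofReal (freeEigenvalue_mul hm k)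
    rw [Complex.ofReal_mul, Complex.ofReal_sub, Complex.ofReal_mul, Complex.ofReal_cos,
      Complex.ofReal_pow] at this
    exact_mod_cast this
  have h2 := Complex.cos_sub_cos θ ((k * step m : ℝ) : ℂ)
  rw [eq_div_iff hh, sub_mul, div_mul_cancel₀ _ hh, h1]
  linear_combination -2 * h2

lemma freeEigenvalue_eq {m : ℕ} (hm : 1 ≤ m) (n : ℕ) :
    (freeEigenvalue m n : ℂ) =
      (2 - 2 * Complex.cos ((n * step m : ℝ) : ℂ)) / (step m : ℂ) ^ 2 := by
  have := sub_freeEigenvalue_eq hm n ((n * step m : ℝ) : ℂ)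
  simp only [sub_self, zero_div, Complex.sin_zero, mul_zero] at this
  exact (sub_eq_zero.1 this).symm

/-- The difference is a product of the sines of the half-sum and the half-difference of θ and kh;
passing to real parts, Jordan's inequality makes both at least a multiple of |n-k|h. -/
lemma le_norm_sub_freeEigenvalue {m n k : ℕ} (hn : 1 ≤ n) (hnm : n ≤ 2 * m - 1) (hk : 1 ≤ k)
    (hkm : k ≤ 2 * m - 1) (hnk : n ≠ k) {θ : ℂ} (hθ : ‖θ - (n * step m : ℝ)‖ ≤ step m / 2) :
    2 / π ^ 2 * ((n : ℝ) - k) ^ 2 ≤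
      ‖(2 - 2 * Complex.cos θ) / (step m : ℂ) ^ 2 - freeEigenvalue m k‖ := by
  have hm : 1 ≤ m := by omega
  have hpos := step_pos hm
  have hstep := two_mul_mul_step hm
  have hp := Real.pi_pos
  set h := step m with hh
  set x := θ.re with hx
  have hxb : |x - n * h| ≤ h / 2 := by
    have := (Complex.abs_re_le_norm (θ - (n * h : ℝ))).trans hθ
    rwa [Complex.sub_re, Complex.ofReal_re] at this
  obtain ⟨hx1, hx2⟩ := abs_le.1 hxb
  set d : ℝ := |(n : ℝ) - k| with hd
  have hd1 : 1 ≤ d := by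
    have h1 : 1 ≤ |(n : ℤ) - k| := Int.one_le_abs (by omega)
    rw [hd]
    exact_mod_cast h1
  have hn' : (1 : ℝ) ≤ n := by exact_mod_cast hn
  have hk' : (1 : ℝ) ≤ k := by exact_mod_cast hk
  have hnm' : (n : ℝ) + 1 ≤ 2 * m := by exact_mod_cast (by omega : n + 1 ≤ 2 * m)
  have hkm' : (k : ℝ) + 1 ≤ 2 * m := by exact_mod_cast (by omega : k + 1 ≤ 2 * m)
  have hs1 : d * h / (2 * π) ≤ |Real.sin ((x - k * h) / 2)| := by
    have h1 : d * h / 2 ≤ |x - k * h| := by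
      have e : (n : ℝ) * h - k * h = (x - k * h) - (x - n * h) := by ring
      have h2 : d * h = |(n : ℝ) * h - k * h| := by
        rw [← sub_mul, abs_mul, abs_of_pos hpos]
      have h3 : d * h ≤ |x - k * h| + |x - n * h| := by
        rw [h2, e]; exact abs_sub _ _
      nlinarith
    have h4 : |(x - k * h) / 2| ≤ π / 2 := by
      rw [abs_div, abs_two]
      have : |x - k * h| ≤ π := by
        rw [abs_le, ← hstep]; constructor <;> nlinarith
      linarith
    refine le_trans ?_ (Real.mul_abs_le_abs_sin h4)
    rw [abs_div, abs_two]
    calc d * h / (2 * π) = 2 / π * (d * h / 2 / 2) := by field_simp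
      _ ≤ _ := by gcongr
  have hs2 : d * h / π ≤ |Real.sin ((x + k * h) / 2)| := by
    -- Since n and k lie in [1, 2m-1], the half-sum keeps distance at least dh/2 from both zeros 0
    -- and π of the sine; the slack of 2 absorbs the error h/2 in θ.
    have hdle : d ≤ n + k - 2 ∧ d ≤ 4 * m - n - k - 2 := by
      rw [hd, abs_sub_le_iff, abs_sub_le_iff]
      refine ⟨⟨?_, ?_⟩, ?_, ?_⟩ <;> linarith
    have ha : d * h / 2 ≤ (x + k * h) / 2 := by nlinarith [hdle.1]
    have hb : d * h / 2 ≤ π - (x + k * h) / 2 := by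
      rw [← hstep]; nlinarith [hdle.2]
    have hmain : ∀ a : ℝ, d * h / 2 ≤ a → a ≤ π / 2 → d * h / π ≤ |Real.sin a| := by
      intro a h1 h2
      have h3 : 0 ≤ a := le_trans (by positivity) h1
      refine le_trans ?_ ((Real.mul_le_sin h3 h2).trans (le_abs_self _))
      calc d * h / π = 2 / π * (d * h / 2) := by field_simp
        _ ≤ _ := by gcongr
    rcases le_total ((x + k * h) / 2) (π / 2) with h1 | h1
    · exact hmain _ ha h1
    · rw [← Real.sin_pi_sub]
      exact hmain _ hb (by linarith)
  rw [sub_freeEigenvalue_eq hm, norm_div, norm_mul, norm_mul, norm_pow, Complex.norm_real,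
    Real.norm_of_nonneg hpos.le, ← hh]
  have e1 : ((θ + (k * h : ℝ)) / 2).re = (x + k * h) / 2 := by
    rw [show (θ + (k * h : ℝ)) / 2 = (θ + (k * h : ℝ)) / ((2 : ℝ) : ℂ) by push_cast; rfl,
      Complex.div_ofReal_re, Complex.add_re, Complex.ofReal_re]
  have e2 : ((θ - (k * h : ℝ)) / 2).re = (x - k * h) / 2 := by
    rw [show (θ - (k * h : ℝ)) / 2 = (θ - (k * h : ℝ)) / ((2 : ℝ) : ℂ) by push_cast; rfl,
      Complex.div_ofReal_re, Complex.sub_re, Complex.ofReal_re]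
  have g1 := abs_sin_re_le_norm_sin ((θ + (k * h : ℝ)) / 2)
  have g2 := abs_sin_re_le_norm_sin ((θ - (k * h : ℝ)) / 2)
  rw [e1] at g1
  rw [e2] at g2
  rw [show ‖(4 : ℂ)‖ = 4 by simp, le_div_iff₀ (by positivity)]
  have hdsq : ((n : ℝ) - k) ^ 2 = d ^ 2 := (sq_abs _).symm
  rw [hdsq]
  calc 2 / π ^ 2 * d ^ 2 * h ^ 2 = 4 * (d * h / π * (d * h / (2 * π))) := by field_simp; ring
    _ ≤ _ := by
      gcongr
      · exact hs2.trans g1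
      · exact hs1.trans g2

lemma le_abs_freeEigenvalue_sub {m n k : ℕ} (hn : 1 ≤ n) (hnm : n ≤ 2 * m - 1) (hk : 1 ≤ k)
    (hkm : k ≤ 2 * m - 1) (hnk : n ≠ k) :
    2 / π ^ 2 * ((n : ℝ) - k) ^ 2 ≤ ‖(freeEigenvalue m n : ℂ) - freeEigenvalue m k‖ := by
  have hm : 1 ≤ m := by omega
  rw [freeEigenvalue_eq hm n]
  refine le_norm_sub_freeEigenvalue hn hnm hk hkm hnk ?_
  have := step_pos hm
  rw [sub_self, norm_zero]; positivity

/-- Surjectivity of the cosine gives some θ. As the product of the two sines is at most (εh/2)², one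
factor is at most εh/2; a sign change and a shift by 2πk, which preserve the cosine, bring θ near
nh. -/
lemma exists_norm_sub_le_of_norm_sub_freeEigenvalue {m : ℕ} (hm : 1 ≤ m) (n : ℕ) {z : ℂ} {ε : ℝ}
    (hε : 0 ≤ ε) (hz : ‖z - freeEigenvalue m n‖ ≤ ε ^ 2) :
    ∃ θ : ℂ, z = (2 - 2 * Complex.cos θ) / (step m : ℂ) ^ 2 ∧
      ‖θ - (n * step m : ℝ)‖ ≤ π / 2 * ε * step m := by
  have hpos := step_pos hm
  have hh : (step m : ℂ) ^ 2 ≠ 0 := pow_ne_zero 2 (Complex.ofReal_ne_zero.2 hpos.ne')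
  obtain ⟨θ, hθ⟩ := Complex.cos_surjective (1 - (step m : ℂ) ^ 2 * z / 2)
  have hz' : z = (2 - 2 * Complex.cos θ) / (step m : ℂ) ^ 2 := by
    rw [hθ, eq_div_iff hh]; ring
  rw [hz', sub_freeEigenvalue_eq hm, norm_div, norm_mul, norm_mul, norm_pow, Complex.norm_real,
    Real.norm_of_nonneg hpos.le, show ‖(4 : ℂ)‖ = 4 by simp, div_le_iff₀ (by positivity)] at hz
  set x : ℂ := ((n * step m : ℝ) : ℂ) with hx
  have hsmall : ‖Complex.sin ((θ + x) / 2)‖ ≤ ε * step m / 2 ∨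
      ‖Complex.sin ((θ - x) / 2)‖ ≤ ε * step m / 2 := by
    by_contra! hcon
    have h0 : 0 ≤ ε * step m / 2 := by positivity
    have := mul_lt_mul'' hcon.1 hcon.2 h0 h0
    nlinarith
  have key : ∀ v : ℂ, ‖Complex.sin v‖ ≤ ε * step m / 2 →
      ∃ k : ℤ, ‖2 * v - k * (2 * π)‖ ≤ π / 2 * ε * step m := by
    intro v hv
    obtain ⟨k, hk⟩ := exists_int_norm_sub_le_of_norm_sin v
    refine ⟨k, ?_⟩
    have e : 2 * v - k * (2 * π) = 2 * (v - k * π) := by ring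
    rw [e, norm_mul, Complex.norm_two]
    have : π / 2 * ‖Complex.sin v‖ ≤ π / 2 * (ε * step m / 2) := by gcongr
    linarith
  rcases hsmall with h1 | h1
  · obtain ⟨k, hk⟩ := key _ h1
    refine ⟨k * (2 * π) - θ, ?_, ?_⟩
    · rw [hz', Complex.cos_int_mul_two_pi_sub]
    · rw [← norm_neg]
      exact (congrArg norm (by ring)).trans_le hk
  · obtain ⟨k, hk⟩ := key _ h1
    refine ⟨θ - k * (2 * π), ?_, ?_⟩
    · rw [hz', Complex.cos_sub_int_mul_two_pi]
    · exact (congrArg norm (by ring)).trans_le hk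

/-- From n² ≤ 2(k² + (n-k)²), each term times n² is at most 2(1/k² + 1/(n-k)²), which is summable
uniformly in n. -/
lemma exists_sum_inv_sq_mul_inv_sq_le : ∃ σ : ℝ, 0 ≤ σ ∧ ∀ (O : Finset ℕ) (n : ℕ),
    1 ≤ n → (∀ k ∈ O, 1 ≤ k ∧ k ≠ n) →
      ∑ k ∈ O, 1 / ((k : ℝ) ^ 2 * ((n : ℝ) - k) ^ 2) ≤ σ / (n : ℝ) ^ 2 := by
  have hsum : Summable fun j : ℤ => 1 / (j : ℝ) ^ 2 := Real.summable_one_div_int_pow.2 one_lt_two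
  set Z := ∑' j : ℤ, 1 / (j : ℝ) ^ 2 with hZ
  have hZ0 : 0 ≤ Z := tsum_nonneg fun j => by positivity
  refine ⟨4 * Z, by positivity, fun O n hn hO => ?_⟩
  have hnp : (0 : ℝ) < n := by exact_mod_cast hn
  have hf : ∀ f : ℕ → ℤ, Function.Injective f → ∑ k ∈ O, 1 / ((f k : ℤ) : ℝ) ^ 2 ≤ Z := by
    intro f hfi
    have := hsum.sum_le_tsum (O.map ⟨f, hfi⟩) fun j _ => by positivity
    rwa [Finset.sum_map] at this
  have h1 := hf (fun k => (k : ℤ)) Nat.cast_injective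
  have h2 := hf (fun k => (n : ℤ) - k) fun a b hab => by simp only at hab; omega
  rw [le_div_iff₀ (by positivity), Finset.sum_mul]
  calc _ ≤ ∑ k ∈ O, 2 * (1 / ((k : ℤ) : ℝ) ^ 2 + 1 / (((n : ℤ) - k : ℤ) : ℝ) ^ 2) := by
        refine Finset.sum_le_sum fun k hk => ?_
        obtain ⟨hk1, hkn⟩ := hO k hk
        have hkp : (0 : ℝ) < k := by exact_mod_cast hk1
        have hd : ((n : ℝ) - k) ≠ 0 := by
          rw [sub_ne_zero]; exact_mod_cast hkn.symm
        push_cast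
        have e : 2 * (1 / (k : ℝ) ^ 2 + 1 / ((n : ℝ) - k) ^ 2) =
            2 * ((k : ℝ) ^ 2 + ((n : ℝ) - k) ^ 2) / ((k : ℝ) ^ 2 * ((n : ℝ) - k) ^ 2) := by
          field_simp; ring
        rw [e, div_mul_eq_mul_div, one_mul]
        gcongr
        nlinarith [sq_nonneg ((k : ℝ) - (n - k))]
    _ = 2 * (∑ k ∈ O, 1 / ((k : ℤ) : ℝ) ^ 2 + ∑ k ∈ O, 1 / (((n : ℤ) - k : ℤ) : ℝ) ^ 2) := by
        rw [← Finset.mul_sum, Finset.sum_add_distrib]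
    _ ≤ 2 * (Z + Z) := by gcongr
    _ = _ := by ring

/-- A bound for the part of the secular equation without the pole nearest to `z`. -/
lemma MemW12.exists_norm_sum_residueCoeff_le {q : ℝ → ℂ} (hq : MemW12 q) (hq0 : q 0 + q π = 0) :
    ∃ B : ℝ, 0 ≤ B ∧ (∀ m n : ℕ, Odd n → n ≤ 2 * m - 1 →
        ‖residueCoeff q m n‖ ≤ B / (n : ℝ) ^ 2) ∧
      ∀ m n : ℕ, Odd n → n ≤ 2 * m - 1 → ∀ z : ℂ,
        (∀ k, 1 ≤ k → k ≤ 2 * m - 1 → n ≠ k →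
          1 / π ^ 2 * ((n : ℝ) - k) ^ 2 ≤ ‖z - freeEigenvalue m k‖) →
        ‖∑ k ∈ ((Finset.Icc 1 (2 * m - 1)).filter Odd).erase n,
          residueCoeff q m k / (z - freeEigenvalue m k)‖ ≤ B / (n : ℝ) ^ 2 := by
  obtain ⟨B, hB, hres⟩ := hq.exists_norm_residueCoeff_le hq0
  obtain ⟨σ, hσ, hsum⟩ := exists_sum_inv_sq_mul_inv_sq_le
  have hp := Real.pi_pos
  refine ⟨B + B * π ^ 2 * σ, by positivity, fun m n hn hnm => (hres m n hn hnm).trans ?_,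
    fun m n hn hnm z hz => ?_⟩
  · have : 0 ≤ B * π ^ 2 * σ := by positivity
    gcongr
    linarith
  set O := ((Finset.Icc 1 (2 * m - 1)).filter Odd).erase n with hO
  have hmem : ∀ k ∈ O, k ≠ n ∧ (1 ≤ k ∧ k ≤ 2 * m - 1) ∧ Odd k := by
    intro k hk
    rwa [hO, Finset.mem_erase, Finset.mem_filter, Finset.mem_Icc] at hk
  calc _ ≤ ∑ k ∈ O, B * π ^ 2 * (1 / ((k : ℝ) ^ 2 * ((n : ℝ) - k) ^ 2)) := by
        refine (norm_sum_le _ _).trans (Finset.sum_le_sum fun k hk => ?_)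
        obtain ⟨hkn, ⟨hk1, hk2⟩, hko⟩ := hmem k hk
        have h1 := hres m k hko hk2
        have h2 := hz k hk1 hk2 hkn.symm
        have hd : ((n : ℝ) - k) ≠ 0 := by
          rw [sub_ne_zero]; exact_mod_cast hkn.symm
        have hkp : (0 : ℝ) < k := by exact_mod_cast hk1
        rw [norm_div]
        calc _ ≤ B / (k : ℝ) ^ 2 / (1 / π ^ 2 * ((n : ℝ) - k) ^ 2) := by gcongr
          _ = _ := by field_simp
    _ ≤ B * π ^ 2 * (σ / (n : ℝ) ^ 2) := by
        rw [← Finset.mul_sum]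
        gcongr
        exact hsum O n hn.pos fun k hk => ⟨(hmem k hk).2.1.1, (hmem k hk).1⟩
    _ ≤ _ := by
        rw [← mul_div_assoc]
        gcongr
        linarith

/-- The eigenvalues of odd number of the discrete problem differ from the free ones by `O(n⁻²)`. -/
theorem MemW12.exists_norm_sub_freeEigenvalue_le {q : ℝ → ℂ} (hq : MemW12 q)
    (hq0 : q 0 + q π = 0) :
    ∃ B : ℝ, 0 ≤ B ∧ ∃ N : ℕ, ∀ m n : ℕ, Odd n → N ≤ n → n ≤ 2 * m - 1 → ∀ θ : ℂ,
      ‖θ - (n * step m : ℝ)‖ ≤ step m / 2 →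
      (discreteMatrix q m).charpoly.eval ((2 - 2 * Complex.cos θ) / (step m : ℂ) ^ 2) = 0 →
      ‖(2 - 2 * Complex.cos θ) / (step m : ℂ) ^ 2 - freeEigenvalue m n‖ ≤ B / (n : ℝ) ^ 2 := by
  obtain ⟨B, hB, hres, hsum⟩ := hq.exists_norm_sum_residueCoeff_le hq0
  have hp := Real.pi_pos
  refine ⟨2 * B, by positivity, ⌈2 * B⌉₊, fun m n hn hNn hnm θ hθ h0 => ?_⟩
  have hm : 1 ≤ m := by have := hn.pos; omega
  have hn1 : (1 : ℝ) ≤ n := by exact_mod_cast hn.pos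
  have hnp : (0 : ℝ) < n := by linarith
  have hBn : 2 * B ≤ n := (Nat.le_ceil _).trans (by exact_mod_cast hNn)
  have hdist := fun k hk hkm hnk => le_norm_sub_freeEigenvalue hn.pos hnm (k := k) hk hkm hnk hθ
  set z : ℂ := (2 - 2 * Complex.cos θ) / (step m : ℂ) ^ 2 with hz
  by_cases hzn : z = freeEigenvalue m n
  · rw [hzn, sub_self, norm_zero]; positivity
  have hne : ∀ k ∈ Finset.Icc 1 (2 * m - 1), z ≠ freeEigenvalue m k := by
    intro k hk
    rcases eq_or_ne n k with rfl | hnk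
    · exact hzn
    · intro hzk
      rw [Finset.mem_Icc] at hk
      have := hdist k hk.1 hk.2 hnk
      rw [hzk, sub_self, norm_zero] at this
      have hd : ((n : ℝ) - k) ≠ 0 := by
        rw [sub_ne_zero]; exact_mod_cast hnk
      have : 0 < 2 / π ^ 2 * ((n : ℝ) - k) ^ 2 := by positivity
      linarith
  have hneO : ∀ k ∈ (Finset.Icc 1 (2 * m - 1)).filter Odd, z ≠ freeEigenvalue m k :=
    fun k hk => hne k (Finset.mem_filter.1 hk).1
  rw [charpoly_discreteMatrix q hm, Polynomial.eval_mul, Polynomial.eval_prod, mul_eq_zero,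
    eval_secularPoly q m hneO, mul_eq_zero] at h0
  -- Away from all free eigenvalues the products are nonzero, so the secular factor itself vanishes.
  have h1 : 1 - ∑ k ∈ (Finset.Icc 1 (2 * m - 1)).filter Odd,
      residueCoeff q m k / (z - freeEigenvalue m k) = 0 := by
    rcases h0 with h0 | h0 | h0
    · obtain ⟨k, hk, hk0⟩ := Finset.prod_eq_zero_iff.1 h0
      refine absurd ?_ (hne k (Finset.mem_filter.1 hk).1)
      simpa [sub_eq_zero] using hk0
    · obtain ⟨k, hk, hk0⟩ := Finset.prod_eq_zero_iff.1 h0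
      exact absurd (sub_eq_zero.1 hk0) (hneO k hk)
    · exact h0
  have hnO : n ∈ (Finset.Icc 1 (2 * m - 1)).filter Odd :=
    Finset.mem_filter.2 ⟨Finset.mem_Icc.2 ⟨hn.pos, hnm⟩, hn⟩
  rw [← Finset.add_sum_erase _ _ hnO] at h1
  have hrest := hsum m n hn hnm z fun k hk hkm hnk => le_trans (by gcongr; norm_num)
    (hdist k hk hkm hnk)
  have hhalf : B / (n : ℝ) ^ 2 ≤ 1 / 2 := by
    rw [div_le_iff₀ (by positivity)]; nlinarith
  have hzp : 0 < ‖z - freeEigenvalue m n‖ := norm_pos_iff.2 (sub_ne_zero.2 hzn)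
  -- The other terms contribute at most B/n² ≤ 1/2 to a sum equal to 1, so the n-th term supplies
  -- the rest.
  have h2 : 1 / 2 ≤ ‖residueCoeff q m n‖ / ‖z - freeEigenvalue m n‖ := by
    rw [← norm_div]
    have h3 := norm_sub_norm_le (1 : ℂ) (residueCoeff q m n / (z - freeEigenvalue m n))
    have h4 : (1 : ℂ) - residueCoeff q m n / (z - freeEigenvalue m n) =
        ∑ k ∈ ((Finset.Icc 1 (2 * m - 1)).filter Odd).erase n,
          residueCoeff q m k / (z - freeEigenvalue m k) := by linear_combination h1
    rw [h4, norm_one] at h3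
    linarith
  rw [le_div_iff₀ hzp] at h2
  have h5 := hres m n hn hnm
  have : 2 * B / (n : ℝ) ^ 2 = 2 * (B / (n : ℝ) ^ 2) := by ring
  rw [this]; linarith

/-! ### Existence and numbering of the discrete eigenvalues -/

/-- Rouché's theorem against the unperturbed product. The radius is half the lower bound 2/π² for
the gaps of the free spectrum, and on the circle the secular sum is below 1 once n is large,
uniformly in m. -/
lemma MemW12.exists_root_secularPoly {q : ℝ → ℂ} (hq : MemW12 q) (hq0 : q 0 + q π = 0) :
    ∃ N : ℕ, ∀ m n : ℕ, Odd n → N ≤ n → n ≤ 2 * m - 1 →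
      ∃ z ∈ (secularPoly q m).roots, ‖z - freeEigenvalue m n‖ < 1 / π ^ 2 := by
  obtain ⟨B, hB, hres, hsum⟩ := hq.exists_norm_sum_residueCoeff_le hq0
  have hp := Real.pi_pos
  refine ⟨⌈B * (π ^ 2 + 1)⌉₊ + 1, fun m n hn hNn hnm => ?_⟩
  have hm : 1 ≤ m := by have := hn.pos; omega
  have hn1 : (1 : ℝ) ≤ n := by exact_mod_cast hn.pos
  have hBn : B * (π ^ 2 + 1) < n := by
    have h1 := Nat.le_ceil (B * (π ^ 2 + 1))
    have h2 : ((⌈B * (π ^ 2 + 1)⌉₊ + 1 : ℕ) : ℝ) ≤ n := by exact_mod_cast hNn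
    push_cast at h2; linarith
  have hnO : n ∈ (Finset.Icc 1 (2 * m - 1)).filter Odd :=
    Finset.mem_filter.2 ⟨Finset.mem_Icc.2 ⟨hn.pos, hnm⟩, hn⟩
  set O := (Finset.Icc 1 (2 * m - 1)).filter Odd with hO
  have hr : (0 : ℝ) < 1 / π ^ 2 := by positivity
  have hcirc : ∀ z ∈ Metric.sphere (freeEigenvalue m n : ℂ) (1 / π ^ 2),
      ‖(secularPoly q m).eval z - ∏ k ∈ O, (z - freeEigenvalue m k)‖ <
        ‖∏ k ∈ O, (z - freeEigenvalue m k)‖ := by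
    intro z hz
    rw [mem_sphere_iff_norm] at hz
    have hdist : ∀ k, 1 ≤ k → k ≤ 2 * m - 1 → n ≠ k →
        1 / π ^ 2 * ((n : ℝ) - k) ^ 2 ≤ ‖z - freeEigenvalue m k‖ := by
      intro k hk hkm hnk
      have h1 := le_abs_freeEigenvalue_sub hn.pos hnm hk hkm hnk
      have h2 := norm_sub_le_norm_sub_add_norm_sub (freeEigenvalue m n : ℂ) z (freeEigenvalue m k)
      rw [norm_sub_rev _ z, hz] at h2
      have h3 : (1 : ℝ) ≤ ((n : ℝ) - k) ^ 2 := by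
        have : 1 ≤ |(n : ℤ) - k| := Int.one_le_abs (by omega)
        have : (1 : ℝ) ≤ |(n : ℝ) - k| := by exact_mod_cast this
        rw [← sq_abs]; nlinarith
      have h4 : 1 / π ^ 2 * 1 ≤ 1 / π ^ 2 * ((n : ℝ) - k) ^ 2 := by gcongr
      have h5 : 2 / π ^ 2 * ((n : ℝ) - k) ^ 2 = 2 * (1 / π ^ 2 * ((n : ℝ) - k) ^ 2) := by ring
      linarith
    have hne : ∀ k ∈ O, z ≠ freeEigenvalue m k := by
      intro k hk hzk
      rcases eq_or_ne n k with rfl | hnk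
      · rw [hzk, sub_self, norm_zero] at hz; linarith
      · have hk' := Finset.mem_Icc.1 (Finset.mem_filter.1 hk).1
        have := hdist k hk'.1 hk'.2 hnk
        rw [hzk, sub_self, norm_zero] at this
        have hd : ((n : ℝ) - k) ≠ 0 := by
          rw [sub_ne_zero]; exact_mod_cast hnk
        have : 0 < 1 / π ^ 2 * ((n : ℝ) - k) ^ 2 := by positivity
        linarith
    have hP : 0 < ‖∏ k ∈ O, (z - (freeEigenvalue m k : ℂ))‖ :=
      norm_pos_iff.2 (Finset.prod_ne_zero_iff.2 fun k hk => sub_ne_zero.2 (hne k hk))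
    have hlt : ‖∑ k ∈ O, residueCoeff q m k / (z - freeEigenvalue m k)‖ < 1 := by
      rw [← Finset.add_sum_erase _ _ hnO]
      have h1 := hsum m n hn hnm z hdist
      have h2 : ‖residueCoeff q m n / (z - freeEigenvalue m n)‖ ≤ B / (n : ℝ) ^ 2 * π ^ 2 := by
        rw [norm_div, hz, div_div_eq_mul_div, div_one]
        gcongr
        exact hres m n hn hnm
      refine (norm_add_le _ _).trans_lt ((add_le_add h2 h1).trans_lt ?_)
      have : B / (n : ℝ) ^ 2 * π ^ 2 + B / (n : ℝ) ^ 2 = B * (π ^ 2 + 1) / (n : ℝ) ^ 2 := by ring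
      rw [this, div_lt_one (by positivity)]
      nlinarith
    rw [eval_secularPoly q m hne, mul_sub, mul_one, sub_sub_cancel_left, norm_neg, norm_mul]
    exact mul_lt_of_lt_one_right hP hlt
  obtain ⟨S, S₀, hS, hS₀, hSo, hS₀o, hcard⟩ := exists_zeros_card_eq_of_norm_sub_lt
    (secularPoly q m).differentiable
    (f₀ := fun z => ∏ k ∈ O, (z - (freeEigenvalue m k : ℂ))) (by fun_prop) hr hcirc
  have hμ : (freeEigenvalue m n : ℂ) ∈ S₀ := by
    have h1 := hS₀o _ (Metric.mem_ball_self hr)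
    have h2 : analyticOrderAt (fun z => ∏ k ∈ O, (z - (freeEigenvalue m k : ℂ)))
        (freeEigenvalue m n : ℂ) ≠ 0 := by
      rw [AnalyticAt.analyticOrderAt_ne_zero (by fun_prop)]
      exact Finset.prod_eq_zero hnO (sub_self _)
    rw [h1] at h2
    exact Multiset.count_ne_zero.1 (by exact_mod_cast h2)
  obtain ⟨s, hs⟩ := Multiset.card_pos_iff_exists_mem.1
    (hcard.symm ▸ Multiset.card_pos_iff_exists_mem.2 ⟨_, hμ⟩ : 0 < Multiset.card S)
  refine ⟨s, ?_, by simpa [dist_eq_norm] using hS s hs⟩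
  rw [Polynomial.mem_roots (secularPoly_ne_zero q hm)]
  refine apply_eq_zero_of_analyticOrderAt_ne_zero
    (f := fun z => (secularPoly q m).eval z) ?_
  rw [hSo s (hS s hs)]
  exact_mod_cast Multiset.count_ne_zero.2 hs

lemma exists_map_val_eq {ι α : Type*} [DecidableEq ι] (K : Finset ι) [Nonempty α] :
    ∀ T : Multiset α, Multiset.card T = K.card → ∃ g : ι → α, K.val.map g = T := by
  induction K using Finset.induction_on with
  | empty =>
    intro T hT
    obtain rfl := Multiset.card_eq_zero.1 (by simpa using hT)
    exact ⟨fun _ => Classical.arbitrary α, by simp⟩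
  | insert a K ha ih =>
    intro T hT
    rw [Finset.card_insert_of_notMem ha] at hT
    obtain ⟨t, ht⟩ := Multiset.card_pos_iff_exists_mem.1 (by omega : 0 < Multiset.card T)
    obtain ⟨T', rfl⟩ := Multiset.exists_cons_of_mem ht
    rw [Multiset.card_cons] at hT
    obtain ⟨g, rfl⟩ := ih T' (by omega)
    refine ⟨Function.update g a t, ?_⟩
    rw [Finset.insert_val_of_notMem ha, Multiset.map_cons, Function.update_self]
    congr 1
    refine Multiset.map_congr rfl fun x hx => Function.update_of_ne ?_ _ _
    rintro rfl
    exact ha hx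

/-- The prescribed values are distinct, so they form a submultiset of S; what is left of S is
distributed arbitrarily over K \ J. -/
lemma exists_map_val_eq_extending {ι α : Type*} [DecidableEq ι] [Nonempty α] {K J : Finset ι}
    (hJ : J ⊆ K) {S : Multiset α} (hS : Multiset.card S = K.card) {ζ : ι → α}
    (hζ : Set.InjOn ζ J) (hζS : ∀ n ∈ J, ζ n ∈ S) :
    ∃ f : ι → α, K.val.map f = S ∧ ∀ n ∈ J, f n = ζ n := by
  have hle : J.val.map ζ ≤ S := by
    refine (Multiset.le_iff_subset (Multiset.Nodup.map_on (fun x hx y hy h => hζ hx hy h)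
      J.nodup)).2 fun x hx => ?_
    obtain ⟨n, hn, rfl⟩ := Multiset.mem_map.1 hx
    exact hζS n hn
  obtain ⟨T, rfl⟩ := Multiset.le_iff_exists_add.1 hle
  have hsd := Finset.card_sdiff_add_card_eq_card hJ
  rw [Multiset.card_add, Multiset.card_map, Finset.card_val] at hS
  obtain ⟨g, rfl⟩ := exists_map_val_eq (K \ J) T (by omega)
  refine ⟨fun n => if n ∈ J then ζ n else g n, ?_, fun n hn => if_pos hn⟩
  have hK : K.val = J.val + (K \ J).val := by
    rw [Finset.sdiff_val]
    exact (add_tsub_cancel_of_le (Finset.val_le_iff.2 hJ)).symm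
  rw [hK, Multiset.map_add]
  congr 1
  · exact Multiset.map_congr rfl fun n hn => if_pos hn
  · exact Multiset.map_congr rfl fun n hn => if_neg (Finset.mem_sdiff.1 hn).2

/-- The discs are disjoint, so the roots found in them for large n are distinct and may be
prescribed; the remaining roots go to the small odd indices in any order. -/
lemma exists_map_eq_roots_secularPoly {q : ℝ → ℂ} (hq : MemW12 q) (hq0 : q 0 + q π = 0) :
    ∃ N : ℕ, ∀ m : ℕ, ∃ f : ℕ → ℂ, 1 ≤ m →
      ((Finset.Icc 1 (2 * m - 1)).filter Odd).val.map f = (secularPoly q m).roots ∧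
      ∀ n, Odd n → N ≤ n → n ≤ 2 * m - 1 → ‖f n - freeEigenvalue m n‖ < 1 / π ^ 2 := by
  obtain ⟨N, hN⟩ := hq.exists_root_secularPoly hq0
  refine ⟨N, fun m => ?_⟩
  by_cases hm : 1 ≤ m
  swap
  · exact ⟨fun _ => 0, fun h => absurd h hm⟩
  have hex : ∀ n, ∃ z : ℂ, Odd n → N ≤ n → n ≤ 2 * m - 1 →
      z ∈ (secularPoly q m).roots ∧ ‖z - freeEigenvalue m n‖ < 1 / π ^ 2 := by
    intro n
    by_cases h : Odd n ∧ N ≤ n ∧ n ≤ 2 * m - 1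
    · obtain ⟨z, h1, h2⟩ := hN m n h.1 h.2.1 h.2.2
      exact ⟨z, fun _ _ _ => ⟨h1, h2⟩⟩
    · exact ⟨0, fun h1 h2 h3 => absurd ⟨h1, h2, h3⟩ h⟩
  choose ζ hζ using hex
  set J := ((Finset.Icc 1 (2 * m - 1)).filter Odd).filter fun n => N ≤ n with hJ
  have hmem : ∀ n, n ∈ J ↔ (Odd n ∧ N ≤ n ∧ n ≤ 2 * m - 1) := by
    intro n
    rw [hJ, Finset.mem_filter, Finset.mem_filter, Finset.mem_Icc]
    exact ⟨fun h => ⟨h.1.2, h.2, h.1.1.2⟩, fun h => ⟨⟨⟨h.1.pos, h.2.2⟩, h.1⟩, h.2.1⟩⟩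
  have hinj : Set.InjOn ζ J := by
    intro a ha b hb hab
    obtain ⟨a1, a2, a3⟩ := (hmem a).1 ha
    obtain ⟨b1, b2, b3⟩ := (hmem b).1 hb
    by_contra hne
    have h1 := (hζ a a1 a2 a3).2
    have h2 := (hζ b b1 b2 b3).2
    have h3 := le_abs_freeEigenvalue_sub a1.pos a3 b1.pos b3 hne
    rw [hab, norm_sub_rev] at h1
    have h4 := norm_sub_le_norm_sub_add_norm_sub (freeEigenvalue m a : ℂ) (ζ b) (freeEigenvalue m b)
    have h5 : (1 : ℝ) ≤ ((a : ℝ) - b) ^ 2 := by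
      have : 1 ≤ |(a : ℤ) - b| := Int.one_le_abs (by omega)
      have : (1 : ℝ) ≤ |(a : ℝ) - b| := by exact_mod_cast this
      rw [← sq_abs]; nlinarith
    have h6 : 2 / π ^ 2 * 1 ≤ 2 / π ^ 2 * ((a : ℝ) - b) ^ 2 := by gcongr
    have h7 : 2 / π ^ 2 * 1 = 2 * (1 / π ^ 2) := by ring
    linarith
  have hroot : ∀ n ∈ J, ζ n ∈ (secularPoly q m).roots := by
    intro n hn
    obtain ⟨h1, h2, h3⟩ := (hmem n).1 hn
    exact (hζ n h1 h2 h3).1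
  obtain ⟨f, hf, hfζ⟩ := exists_map_val_eq_extending (Finset.filter_subset _ _ : J ⊆ _)
    (card_roots_secularPoly q hm) hinj hroot
  refine ⟨f, fun _ => ⟨hf, fun n h1 h2 h3 => ?_⟩⟩
  rw [hfζ n ((hmem n).2 ⟨h1, h2, h3⟩)]
  exact (hζ n h1 h2 h3).2

lemma exists_forall_le_of_le_div {α : ℝ} (hα : 0 < α) (X : ℝ) : ∃ M : ℕ, ∀ m, M ≤ m → ∀ n : ℕ,
    1 ≤ m → α ≤ (n : ℝ) / (2 * m) → X ≤ n := by
  refine ⟨⌈X / (2 * α)⌉₊, fun m hm n hm1 hn => ?_⟩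
  have h1 : X / (2 * α) ≤ m := (Nat.le_ceil _).trans (by exact_mod_cast hm)
  have hmp : (0 : ℝ) < m := by exact_mod_cast hm1
  rw [div_le_iff₀ (by positivity)] at h1
  rw [le_div_iff₀ (by positivity)] at hn
  linarith

/-- The location is obtained in two rounds: Rouché gives θ within h/2 of nh, the secular equation
then gives O(n⁻²) for the eigenvalue, and this yields a new θ within O(h/n) = o(h). -/
theorem exists_isDiscreteNumbering {q : ℝ → ℂ} (hq : MemW12 q) (hq0 : q 0 + q π = 0) :
    ∃ lamD : ℕ → ℕ → ℂ, IsDiscreteNumbering q lamD := by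
  obtain ⟨N, hN⟩ := exists_map_eq_roots_secularPoly hq hq0
  choose f hf using hN
  obtain ⟨B, hB, N', hN'⟩ := hq.exists_norm_sub_freeEigenvalue_le hq0
  have hp := Real.pi_pos
  refine ⟨fun m n => if Even n then (freeEigenvalue m n : ℂ) else f m n, ?_, ?_, ?_⟩
  · intro m hm
    rw [roots_charpoly_discreteMatrix q hm, ← (hf m hm).1]
    have hfe : (Finset.Icc 1 (2 * m - 1)).filter Odd =
        (Finset.Icc 1 (2 * m - 1)).filter fun n => ¬ Even n :=
      Finset.filter_congr fun n _ => Nat.not_even_iff_odd.symm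
    rw [hfe, Finset.filter_val, Finset.filter_val]
    conv_lhs => rw [← Multiset.filter_add_not Even (Finset.Icc 1 (2 * m - 1)).val]
    rw [Multiset.map_add]
    congr 1
    · exact Multiset.map_congr rfl fun n hn => if_pos (Multiset.mem_filter.1 hn).2
    · exact Multiset.map_congr rfl fun n hn => if_neg (Multiset.mem_filter.1 hn).2
  · intro m n _ _ hn
    exact if_pos hn
  · intro α hα δ hδ
    obtain ⟨M, hM⟩ := exists_forall_le_of_le_div hα (N + N' + π / 2 * √B / δ)
    refine ⟨M, fun m hm n hn hnm hαn => ?_⟩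
    have hm1 : 1 ≤ m := by omega
    have hX := hM m hm n hm1 hαn
    have hpos := step_pos hm1
    have hsq : 0 ≤ π / 2 * √B / δ := by positivity
    rcases Nat.even_or_odd n with hne | hno
    · refine ⟨(n * step m : ℝ), ?_, ?_⟩
      · simp only [if_pos hne]; exact freeEigenvalue_eq hm1 n
      · rw [sub_self, norm_zero]; positivity
    simp only [if_neg (Nat.not_even_iff_odd.2 hno)]
    have hNn : N ≤ n := by
      have : (N : ℝ) ≤ n := by have : (0 : ℝ) ≤ N' := by positivity
                               linarith
      exact_mod_cast this
    have hNn' : N' ≤ n := by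
      have : (N' : ℝ) ≤ n := by have : (0 : ℝ) ≤ N := by positivity
                                linarith
      exact_mod_cast this
    have hnp : (0 : ℝ) < n := by exact_mod_cast hn
    have hclose := ((hf m hm1).2 n hno hNn hnm).le
    have hroot : (discreteMatrix q m).charpoly.eval (f m n) = 0 := by
      have h1 : f m n ∈ (discreteMatrix q m).charpoly.roots := by
        rw [roots_charpoly_discreteMatrix q hm1, ← (hf m hm1).1, Multiset.mem_add]
        right
        exact Multiset.mem_map_of_mem _
          (Finset.mem_filter.2 ⟨Finset.mem_Icc.2 ⟨hn, hnm⟩, hno⟩)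
      exact (Polynomial.mem_roots'.1 h1).2
    -- The value ε = 1/π matches the Rouché radius 1/π² and gives exactly the h/2 needed next.
    obtain ⟨θ, hθ, hθn⟩ := exists_norm_sub_le_of_norm_sub_freeEigenvalue hm1 n
      (ε := 1 / π) (by positivity) (hclose.trans (by rw [div_pow, one_pow]))
    have hhalf : π / 2 * (1 / π) * step m = step m / 2 := by field_simp
    rw [hhalf] at hθn
    have h2 := hN' m n hno hNn' hnm θ hθn (by rw [← hθ]; exact hroot)
    rw [← hθ] at h2
    obtain ⟨θ', hθ', hθn'⟩ := exists_norm_sub_le_of_norm_sub_freeEigenvalue hm1 n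
      (ε := √B / n) (by positivity) (h2.trans (by rw [div_pow, Real.sq_sqrt hB]))
    refine ⟨θ', hθ', hθn'.trans ?_⟩
    gcongr
    rw [← mul_div_assoc, div_le_iff₀ hnp]
    have h3 : π / 2 * √B / δ ≤ n := by
      have h4 : (0 : ℝ) ≤ N := by positivity
      have h5 : (0 : ℝ) ≤ N' := by positivity
      linarith
    rw [div_le_iff₀ hδ] at h3
    linarith

/-- The location property is needed only with δ = 1/2, which attaches the eigenvalue to the n-th
pole; for n ≥ 2mα, large m forces n past the threshold of the secular estimate. -/
theorem IsDiscreteNumbering.exists_norm_sub_le {q : ℝ → ℂ} {lamD : ℕ → ℕ → ℂ}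
    (hl : IsDiscreteNumbering q lamD) (hq : MemW12 q) (hq0 : q 0 + q π = 0) {α : ℝ}
    (hα : 0 < α) :
    ∃ B : ℝ, 0 ≤ B ∧ ∃ M : ℕ, ∀ m, M ≤ m → ∀ n, 1 ≤ n → n ≤ 2 * m - 1 →
      α ≤ (n : ℝ) / (2 * m) → ‖lamD m n - freeEigenvalue m n‖ ≤ B / (n : ℝ) ^ 2 := by
  obtain ⟨B, hB, N, hN⟩ := hq.exists_norm_sub_freeEigenvalue_le hq0
  obtain ⟨M₁, hM₁⟩ := exists_forall_le_of_le_div hα N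
  obtain ⟨M₂, hM₂⟩ := hl.location α hα (1 / 2) (by norm_num)
  refine ⟨B, hB, max M₁ M₂, fun m hm n hn hnm hαn => ?_⟩
  rcases Nat.even_or_odd n with hne | hno
  · rw [hl.even m n hn hnm hne, sub_self, norm_zero]; positivity
  have hm1 : 1 ≤ m := by omega
  obtain ⟨θ, hθ, hθn⟩ := hM₂ m ((le_max_right _ _).trans hm) n hn hnm hαn
  have hNn : N ≤ n := by exact_mod_cast hM₁ m ((le_max_left _ _).trans hm) n hm1 hαn
  rw [hθ]
  refine hN m n hno hNn hnm θ (hθn.trans_eq (by ring)) ?_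
  rw [← hθ]
  have h1 : lamD m n ∈ (discreteMatrix q m).charpoly.roots := by
    rw [← hl.roots_eq m hm1]
    exact Multiset.mem_map_of_mem _ (Finset.mem_Icc.2 ⟨hn, hnm⟩)
  exact (Polynomial.mem_roots'.1 h1).2

end FrozenArgument

/-! ### Comparison of the two problems -/

theorem mainTheorem7 (q : ℝ → ℂ) (hq : FrozenArgument.MemW12 q) (hq0 : q 0 + q Real.pi = 0) :
    (∃ lam : ℕ → ℂ, FrozenArgument.IsNumbering q lam) ∧
    (∃ lamD : ℕ → ℕ → ℂ, FrozenArgument.IsDiscreteNumbering q lamD) ∧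
    ∀ lam : ℕ → ℂ, FrozenArgument.IsNumbering q lam →
    ∀ lamD : ℕ → ℕ → ℂ, FrozenArgument.IsDiscreteNumbering q lamD →
    ∀ α : ℝ, 0 < α → ∃ C : ℝ, ∀ m : ℕ, 1 ≤ m → ∀ n : ℕ, 1 ≤ n → n ≤ 2 * m - 1 →
      α ≤ (n : ℝ) / (2 * m) →
      ‖(lam n - (n : ℂ) ^ 2) - (lamD m n - (FrozenArgument.freeEigenvalue m n : ℂ))‖
        ≤ C * FrozenArgument.step m ^ 2 := by
  refine ⟨FrozenArgument.exists_isNumbering hq hq0,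
    FrozenArgument.exists_isDiscreteNumbering hq hq0, fun lam hlam lamD hlamD α hα => ?_⟩
  obtain ⟨A, hA, hcont⟩ := hlam.exists_norm_sub_sq_le hq hq0
  obtain ⟨B, hB, M, hdisc⟩ := hlamD.exists_norm_sub_le hq hq0 hα
  set E : ℕ → ℕ → ℝ := fun m n =>
    ‖(lam n - (n : ℂ) ^ 2) - (lamD m n - (FrozenArgument.freeEigenvalue m n : ℂ))‖ with hE
  have hp := Real.pi_pos
  -- For m < M only finitely many pairs occur, with n < 2M; the sum of their ratios to h² bounds
  -- each of them.
  set C₀ : ℝ := ∑ m ∈ Finset.range M, ∑ n ∈ Finset.range (2 * M),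
    E m n / FrozenArgument.step m ^ 2 with hC₀
  have hC₀0 : 0 ≤ C₀ := by positivity
  refine ⟨(A + B) / (π * α) ^ 2 + C₀, fun m hm n hn hnm hαn => ?_⟩
  have hpos := FrozenArgument.step_pos hm
  have hnp : (0 : ℝ) < n := by exact_mod_cast hn
  rcases le_or_gt M m with hMm | hMm
  · have h1 : ‖(lam n - (n : ℂ) ^ 2) - (lamD m n - (FrozenArgument.freeEigenvalue m n : ℂ))‖ ≤
        A / (n : ℝ) ^ 2 + B / (n : ℝ) ^ 2 :=
      (norm_sub_le _ _).trans (add_le_add (hcont n hn) (hdisc m hMm n hn hnm hαn))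
    -- This converts n⁻² into h²/(πα)²; it is the only use of n/(2m) ≥ α beyond the discrete
    -- estimate.
    have h2 : π * α ≤ n * FrozenArgument.step m := by
      rw [← FrozenArgument.two_mul_mul_step hm]
      have hmp : (0 : ℝ) < m := by exact_mod_cast hm
      rw [le_div_iff₀ (by positivity)] at hαn
      calc _ = α * (2 * m) * FrozenArgument.step m := by ring
        _ ≤ _ := by gcongr
    refine h1.trans ?_
    rw [← add_div, add_mul]
    have h3 : (A + B) / (n : ℝ) ^ 2 ≤ (A + B) / (π * α) ^ 2 * FrozenArgument.step m ^ 2 := by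
      rw [div_mul_eq_mul_div, div_le_div_iff₀ (by positivity) (by positivity), mul_assoc]
      have h4 : (π * α) ^ 2 ≤ (n * FrozenArgument.step m) ^ 2 := by gcongr
      have : (0 : ℝ) ≤ A + B := by positivity
      gcongr
      linarith [mul_pow (n : ℝ) (FrozenArgument.step m) 2]
    have : 0 ≤ C₀ * FrozenArgument.step m ^ 2 := by positivity
    linarith
  · have h1 : E m n / FrozenArgument.step m ^ 2 ≤ C₀ := by
      have h2 := Finset.single_le_sum (f := fun n => E m n / FrozenArgument.step m ^ 2)
        (s := Finset.range (2 * M)) (fun _ _ => by positivity)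
        (Finset.mem_range.2 (by omega : n < 2 * M))
      have h3 := Finset.single_le_sum
        (f := fun m => ∑ n ∈ Finset.range (2 * M), E m n / FrozenArgument.step m ^ 2)
        (s := Finset.range M) (fun _ _ => by positivity) (Finset.mem_range.2 hMm)
      exact h2.trans h3
    rw [div_le_iff₀ (by positivity)] at h1
    refine h1.trans ?_
    have : (0 : ℝ) ≤ (A + B) / (π * α) ^ 2 := by positivity
    gcongr
    linarith
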